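/- Let $d\ge 1$, $z>0$, and let $\Gamma$ be the space of locally finite subsets (configurations) of $\mathbb R^d$ with its usual $\sigma$-algebra. Let $\pi_z$ be the Poisson measure on $\Gamma$ with intensity measure $z\,dx$. Let $a,b:\mathbb R^d\to[0,\infty]$ be measurable, even and integrable functions, with $\operatorname{ess\,sup} b<\infty$. Write $\langle f\rangle:=\int_{\mathbb R^d}f(x)\,dx$. On the linear span $\mathscr F_{\exp}$ of the functions $\gamma\mapsto e^{\langle\varphi,\gamma\rangle}$, where $\varphi:\mathbb R^d\to\mathbb R$ is continuous with compact support and $\langle\varphi,\gamma\rangle:=\sum_{x\in\gamma}\varphi(x)$, set $$\begin{aligned}(L_0F)(\gamma):=\langle a\rangle^2\Big[&\sum_{\{x_1,x_2\}\subset\gamma}b(x_2-x_1)\big(F(\gamma\setminus\{x_1,x_2\})-F(\gamma)\big)\\&+\tfrac12\int_{\mathbb R^d}z\,dx_1\int_{\mathbb R^d}z\,dx_2\,b(x_2-x_1)\big(F(\gamma\cup\{x_1,x_2\})-F(\gamma)\big)\\&+z\langle b\rangle\sum_{x\in\gamma}\big(F(\gamma\setminus\{x\})-F(\gamma)\big)+z\langle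 b\rangle\int_{\mathbb R^d}z\,dx\,\big(F(\gamma\cup\{x\})-F(\gamma)\big)\Big]\end{aligned}$$ and $\mathcal E_0(F,G):=\int_\Gamma(-L_0F)(\gamma)\,G(\gamma)\,\pi_z(d\gamma)$. Then $F,\,L_0F\in L^2(\Gamma,\pi_z)$ for all $F\in\mathscr F_{\exp}$, and the quadratic form $(\mathcal E_0,\mathscr F_{\exp})$ is symmetric and closable in the real space $L^2(\Gamma,\pi_z)$. Its closure, denoted by $(\mathcal E_0,D(\mathcal E_0))$, satisfies the Poincaré inequality $$\mathcal E_0(F,F)\ \ge\ \langle a\rangle^2z\langle b\rangle\int_\Gamma\Big(F(\gamma)-\int_\Gamma F\,d\pi_z\Big)^2\pi_z(d\gamma),\qquad F\in D(\mathcal E_0).$$ Let $(-L_0,D(L_0))$ be the generator of the closed form $(\mathcal E_0,D(\mathcal E_0))$, that is, $F\in D(L_0)$ and $-L_0F=H$ if and only if $F\in D(\mathcal E_0)$ and $\mathcal E_0(F,G)=(H,G)_{L^2(\Gamma,\pi_z)}$ for all $G\in D(\mathcal E_0)$. Then the interval $\big(0,\langle a\rangle^2z\langle b\rangle\big)$ is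 contained in the resolvent set of $-L_0$. If moreover $\langle a\rangle>0$ and $\langle b\rangle>0$, then the kernel of $-L_0$ consists exactly of the ($\pi_z$-a.e.) constant functions. -/

import Mathlib

open MeasureTheory ProbabilityTheory Filter Topology
open scoped ENNReal NNReal CompactlySupported

namespace BirthDeath

/-- The configuration space `Γ` over `ℝ^d`: all subsets of `ℝ^d` having finitely many points in
every compact set. -/
def Config (d : ℕ) : Type :=
  {γ : Set (EuclideanSpace ℝ (Fin d)) // ∀ K, IsCompact K → (γ ∩ K).Finite}

namespace Config

variable {d : ℕ}

/-- The underlying set of points of a configuration. -/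
def points (γ : Config d) : Set (EuclideanSpace ℝ (Fin d)) := γ.1

/-- `|γ ∩ A|`. It is used for bounded sets `A` only, where the intersection is finite. -/
noncomputable def count (A : Set (EuclideanSpace ℝ (Fin d))) (γ : Config d) : ℕ :=
  (γ.points ∩ A).ncard

/-- The Borel `σ`-algebra of the vague topology on `Γ`, in its usual description as the
`σ`-algebra generated by the counting maps `γ ↦ |γ ∩ A|`, with `A` bounded and Borel. -/
noncomputable instance : MeasurableSpace (Config d) :=
  ⨆ A : {A : Set (EuclideanSpace ℝ (Fin d)) // Bornology.IsBounded A ∧ MeasurableSet A},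
    MeasurableSpace.comap (count A.1) ⊤

/-- `γ ∪ {x}`. -/
def add (γ : Config d) (x : EuclideanSpace ℝ (Fin d)) : Config d :=
  ⟨γ.points ∪ {x}, fun K hK => by
    rw [Set.union_inter_distrib_right]
    exact (γ.2 K hK).union ((Set.finite_singleton x).inter_of_left K)⟩

/-- `γ \ {x}`. -/
def remove (γ : Config d) (x : EuclideanSpace ℝ (Fin d)) : Config d :=
  ⟨γ.points \ {x}, fun K hK =>
    (γ.2 K hK).subset (Set.inter_subset_inter_left K Set.sdiff_subset)⟩

/-- `⟨φ, γ⟩ = ∑_{x ∈ γ} φ x` (a sum with finitely many nonzero terms). -/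
noncomputable def pairing (φ : C_c(EuclideanSpace ℝ (Fin d), ℝ)) (γ : Config d) : ℝ :=
  ∑' x : γ.points, φ x

end Config

variable {d : ℕ}

/-- `π` is the Poisson measure `π_z` on `Γ` with intensity measure `z dx`: it is a probability
measure, the number of points in a bounded Borel set `A` has the Poisson distribution with
parameter `z |A|`, and the numbers of points in disjoint bounded Borel sets are independent. -/
structure IsPoissonMeasure (z : ℝ) (π : Measure (Config d)) : Prop where
  isProbabilityMeasure : IsProbabilityMeasure π
  map_count : ∀ A : Set (EuclideanSpace ℝ (Fin d)), Bornology.IsBounded A → MeasurableSet A →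
    π.map (Config.count A) = poissonMeasure (Real.toNNReal (z * (volume A).toReal))
  iIndepFun_count : ∀ (n : ℕ) (A : Fin n → Set (EuclideanSpace ℝ (Fin d))),
    (∀ i, Bornology.IsBounded (A i)) → (∀ i, MeasurableSet (A i)) →
    Pairwise (Function.onFun Disjoint A) →
    iIndepFun (fun i => Config.count (A i)) π

/-- `⟨f⟩ = ∫ f(x) dx` for a nonnegative integrable function `f` on `ℝ^d`. -/
noncomputable def mean (f : EuclideanSpace ℝ (Fin d) → ℝ≥0∞) : ℝ := (∫⁻ x, f x).toReal

/-- The linear span of the functions `γ ↦ exp ⟨φ, γ⟩`, with `φ` continuous and compactly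
supported. -/
noncomputable def expSpan (d : ℕ) : Submodule ℝ (Config d → ℝ) :=
  Submodule.span ℝ (Set.range fun (φ : C_c(EuclideanSpace ℝ (Fin d), ℝ)) (γ : Config d) =>
    Real.exp (γ.pairing φ))

/-- The operator `L₀` of the birth-and-death dynamics. The sum over unordered pairs
`{x₁, x₂} ⊂ γ` is one half of the sum over ordered pairs of distinct points of `γ`. -/
noncomputable def genL (a b : EuclideanSpace ℝ (Fin d) → ℝ≥0∞) (z : ℝ) (F : Config d → ℝ)
    (γ : Config d) : ℝ :=
  mean a ^ 2 *
    ((1 / 2) * (∑' p : γ.points.offDiag,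
        (b (p.1.2 - p.1.1)).toReal * (F ((γ.remove p.1.1).remove p.1.2) - F γ))
      + (1 / 2) * (∫ x₁ : EuclideanSpace ℝ (Fin d), z * ∫ x₂ : EuclideanSpace ℝ (Fin d),
          z * ((b (x₂ - x₁)).toReal * (F ((γ.add x₁).add x₂) - F γ)))
      + z * mean b * (∑' x : γ.points, (F (γ.remove x) - F γ))
      + z * mean b * (∫ x : EuclideanSpace ℝ (Fin d), z * (F (γ.add x) - F γ)))

/-- `ℰ₀(F, G) = ∫ (-L₀ F) G dπ`, for `F` and `G` in the linear span of the exponentials. -/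
noncomputable def preForm (a b : EuclideanSpace ℝ (Fin d) → ℝ≥0∞) (z : ℝ)
    (π : Measure (Config d)) (F G : Config d → ℝ) : ℝ :=
  ∫ γ, (-genL a b z F γ) * G γ ∂π

/-- The sequence `F n` of elements of `expSpan d` is Cauchy with respect to `ℰ₀`. -/
def FormCauchy (a b : EuclideanSpace ℝ (Fin d) → ℝ≥0∞) (z : ℝ) (π : Measure (Config d))
    (F : ℕ → Config d → ℝ) : Prop :=
  (∀ n, F n ∈ expSpan d) ∧
  ∀ ε > 0, ∃ N, ∀ m ≥ N, ∀ n ≥ N, preForm a b z π (F m - F n) (F m - F n) < ε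

/-- The form `(ℰ₀, expSpan d)` is closable in `L²(Γ, π)`. -/
def IsClosableForm (a b : EuclideanSpace ℝ (Fin d) → ℝ≥0∞) (z : ℝ)
    (π : Measure (Config d)) : Prop :=
  ∀ F : ℕ → Config d → ℝ, FormCauchy a b z π F →
    Tendsto (fun n => eLpNorm (F n) 2 π) atTop (𝓝 0) →
    Tendsto (fun n => preForm a b z π (F n) (F n)) atTop (𝓝 0)

/-- `F n` is an `ℰ₀`-Cauchy sequence in `expSpan d` that converges to `f` in `L²(Γ, π)`. -/
def Approximates (a b : EuclideanSpace ℝ (Fin d) → ℝ≥0∞) (z : ℝ) (π : Measure (Config d))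
    (F : ℕ → Config d → ℝ) (f : Lp ℝ 2 π) : Prop :=
  FormCauchy a b z π F ∧ Tendsto (fun n => eLpNorm (F n - ⇑f) 2 π) atTop (𝓝 0)

/-- The domain `D(ℰ₀)` of the closure of `(ℰ₀, expSpan d)` in `L²(Γ, π)`. -/
def formDomain (a b : EuclideanSpace ℝ (Fin d) → ℝ≥0∞) (z : ℝ) (π : Measure (Config d)) :
    Set (Lp ℝ 2 π) :=
  {f | ∃ F, Approximates a b z π F f}

open Classical in
/-- The closure of `(ℰ₀, expSpan d)`: the limit of `ℰ₀(F n, G n)` along approximating sequences of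
`f` and `g`. For a closable form the limit exists and does not depend on the sequences. -/
noncomputable def form (a b : EuclideanSpace ℝ (Fin d) → ℝ≥0∞) (z : ℝ) (π : Measure (Config d))
    (f g : Lp ℝ 2 π) : ℝ :=
  if h : f ∈ formDomain a b z π ∧ g ∈ formDomain a b z π then
    limUnder atTop fun n => preForm a b z π (h.1.choose n) (h.2.choose n)
  else 0

/-- The graph of the generator `(-L₀, D(L₀))` of the closed form `(ℰ₀, D(ℰ₀))`: `f ∈ D(L₀)` and
`-L₀ f = h` mean that `f ∈ D(ℰ₀)` and `ℰ₀(f, g) = (h, g)_{L²}` for all `g ∈ D(ℰ₀)`. -/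
def GeneratorGraph (a b : EuclideanSpace ℝ (Fin d) → ℝ≥0∞) (z : ℝ) (π : Measure (Config d))
    (f h : Lp ℝ 2 π) : Prop :=
  f ∈ formDomain a b z π ∧ ∀ g ∈ formDomain a b z π, form a b z π f g = inner ℝ h g

/-- The number `r` is in the resolvent set of the operator `T` with the graph
`{(f, h) | T f h}`: `T - r` maps the domain of `T` bijectively onto the space, with a bounded
inverse. -/
def InResolventSet {H : Type*} [NormedAddCommGroup H] [NormedSpace ℝ H] (T : H → H → Prop)
    (r : ℝ) : Prop :=
  (∀ g, ∃! f, ∃ h, T f h ∧ h - r • f = g) ∧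
  ∃ C : ℝ, ∀ f h, T f h → ‖f‖ ≤ C * ‖h - r • f‖

end BirthDeath

open BirthDeath

/-! Everything is computed on the exponentials e_φ = exp⟨φ,·⟩. The Mecke formula
(`IsPoissonMeasure.compProd_pointKernel`, and `IsPoissonMeasure.compProd_pairKernel` for pairs)
replaces a sum over the points of γ, averaged over π, by an integral over z dx in which the point is
added to γ. Adding a new point x multiplies e_φ by exp φ(x). Hence, with m(φ) = ∫ e_φ dπ, the form
is explicit (`IsPairRate.preForm_expPairing`): ℰ₀(e_φ, e_ψ) = ⟨a⟩² [½ z² X(φ,ψ) + z⟨b⟩ t(φ,ψ)]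
m(φ+ψ), where t(φ,ψ) = z ∫ (e^φ−1)(e^ψ−1) dx and X is the integral of
b(y−x)(e^{φ(x)+φ(y)}−1)(e^{ψ(x)+ψ(y)}−1) over pairs. This is symmetric in φ and ψ.

The Poincaré inequality on the span (`IsPairRate.gap_le_bilin`) is a positivity statement about
kernels in (φ,ψ). The pair part is a Schur product of two Gram kernels, hence nonnegative, and is
dropped. The Laplace functional gives m(φ+ψ) = m(φ)m(ψ)e^{t(φ,ψ)}. Thus, up to the factor ⟨a⟩²z⟨b⟩,
the one-particle part minus the variance is the quadratic form of the kernel t e^t − e^t + 1 with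
coefficients c_φ m(φ). The power series of s e^s − e^s + 1 has nonnegative coefficients and t is a
Gram kernel, so all powers of t, and then the whole kernel, are positive semidefinite. In terms of
chaos expansions, the one-particle part is a multiple of the number operator, which is at least 1
off the constants.

Since ℰ₀(F,·) = (−L₀F,·) is bounded in L² for F in the span, the form is closable. The only serious
point in L₀F ∈ L² is the sum over pairs, whose second moment, weighted by an exponential, is bounded
by repeated use of a Mecke inequality (`lintegral_weightedShotNoise_sq_lt_top`).

The spectral statements are Hilbert space theory for a nonnegative closable form that vanishes on a
unit vector x and has a gap c on its complement (`SymmForm.HasGap`). For 0 < r < c the form ℰ −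
r(·,·) is made coercive by a rank one term along x, the perturbed equation is solved variationally,
and a corrected right-hand side makes the extra term cancel. -/

namespace BirthDeath

/-! ### Sums over a set as integrals against a sum of Dirac measures. -/

section PointMeasure

variable {α β : Type*} [MeasurableSpace α] [MeasurableSpace β]

/-- The measure `∑_{x ∈ S} δ_x`. -/
noncomputable def pointMeasure (S : Set α) : Measure α := Measure.sum fun x : S => Measure.dirac x.1

lemma lintegral_pointMeasure [MeasurableSingletonClass α] (S : Set α) (f : α → ℝ≥0∞) :
    ∫⁻ x, f x ∂pointMeasure S = ∑' x : S, f x := by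
  simp [pointMeasure, lintegral_sum_measure]

lemma pointMeasure_apply (S : Set α) {A : Set α} (hA : MeasurableSet A) :
    pointMeasure S A = (S ∩ A).encard := by
  rw [pointMeasure, Measure.sum_apply _ hA]
  have h1 : ∀ x : S, Measure.dirac x.1 A = (Subtype.val ⁻¹' A : Set S).indicator 1 x := by
    intro x
    rw [Measure.dirac_apply' _ hA]
    rfl
  simp_rw [h1]
  rw [← tsum_subtype]
  simp only [Pi.one_apply]
  rw [ENNReal.tsum_set_one, ← Set.InjOn.encard_image Subtype.val_injective.injOn,
    Subtype.image_preimage_coe]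

lemma integral_pointMeasure [MeasurableSingletonClass α] {S : Set α} (hS : S.Countable)
    (f : α → ℝ) : ∫ x, f x ∂pointMeasure S = ∑' x : S, f x := by
  have := hS.to_subtype
  have := integral_sum_dirac (f := f) (x := fun x : S => x.1) (c := fun _ => 1) (by simp)
  simpa [pointMeasure] using this

lemma integrable_pointMeasure_iff [MeasurableSingletonClass α] {S : Set α} (hS : S.Countable)
    {f : α → ℝ} : Integrable f (pointMeasure S) ↔ Summable fun x : S => f x := by
  have := hS.to_subtype
  have := integrable_sum_dirac_iff (f := f) (x := fun x : S => x.1) (c := fun _ => 1) (by simp)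
  rw [← summable_norm_iff]
  simpa [pointMeasure] using this

lemma ae_pointMeasure (S : Set α) {p : α → Prop} (hp : MeasurableSet {x | p x})
    (h : ∀ x ∈ S, p x) : ∀ᵐ x ∂pointMeasure S, p x := by
  rw [ae_iff, ← Set.compl_ofPred, pointMeasure_apply _ hp.compl]
  have : S ∩ {a | p a}ᶜ = ∅ := by
    ext x
    simp only [Set.mem_inter_iff, Set.mem_compl_iff, Set.mem_ofPred_eq, Set.mem_empty_iff_false,
      iff_false, not_and, not_not]
    exact h x
  simp [this]

end PointMeasure

/-! ### Measurable structure of the configuration space, and the kernels of points and of pairs. -/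

section Configurations

variable {d : ℕ}

/-- Points of the underlying Euclidean space. -/
abbrev Point (d : ℕ) := EuclideanSpace ℝ (Fin d)

namespace Config

lemma finite_inter (γ : Config d) {A : Set (Point d)} (hA : Bornology.IsBounded A) :
    (γ.points ∩ A).Finite :=
  (γ.2 _ hA.isCompact_closure).subset (Set.inter_subset_inter_right _ subset_closure)

lemma countable_points (γ : Config d) : γ.points.Countable := by
  have : γ.points = ⋃ n : ℕ, γ.points ∩ Metric.ball 0 n := by
    rw [← Set.inter_iUnion, Metric.iUnion_ball_nat, Set.inter_univ]
  rw [this]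
  exact Set.countable_iUnion fun n => (γ.finite_inter Metric.isBounded_ball).countable

lemma countable_offDiag (γ : Config d) : γ.points.offDiag.Countable :=
  (γ.countable_points.prod γ.countable_points).mono
    (fun _ h => Set.mem_prod.2 ⟨(Set.mem_offDiag.1 h).1, (Set.mem_offDiag.1 h).2.1⟩)

@[ext] lemma ext_points {γ γ' : Config d} (h : γ.points = γ'.points) : γ = γ' := Subtype.ext h

lemma mem_add {γ : Config d} {x y : Point d} : y ∈ (γ.add x).points ↔ y ∈ γ.points ∨ y = x :=
  Iff.rfl

lemma mem_remove {γ : Config d} {x y : Point d} :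
    y ∈ (γ.remove x).points ↔ y ∈ γ.points ∧ y ≠ x := Iff.rfl

lemma remove_add {γ : Config d} {x : Point d} (hx : x ∈ γ.points) : (γ.remove x).add x = γ := by
  ext y
  rw [mem_add, mem_remove]
  by_cases hy : y = x
  · subst hy; tauto
  · tauto

lemma measurable_count {A : Set (Point d)} (hA : Bornology.IsBounded A) (hA' : MeasurableSet A) :
    Measurable (count A : Config d → ℕ) := by
  rw [measurable_iff_comap_le]
  exact le_iSup (fun A : {A : Set (Point d) // Bornology.IsBounded A ∧ MeasurableSet A} =>
    MeasurableSpace.comap (count A.1) ⊤) ⟨A, hA, hA'⟩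

lemma measurable_of_count {α : Type*} [MeasurableSpace α] {f : α → Config d}
    (h : ∀ A : Set (Point d), Bornology.IsBounded A → MeasurableSet A →
      Measurable fun a => count A (f a)) : Measurable f := by
  rw [measurable_iff_le_map]
  refine iSup_le fun A => ?_
  rw [← MeasurableSpace.comap_le_iff_le_map, MeasurableSpace.comap_comp]
  exact (h A.1 A.2.1 A.2.2).comap_le

/-- Membership is expressed through counts in countably many balls, which makes it jointly
measurable in γ and x. A point every neighbourhood of which meets γ belongs to γ because γ is
locally finite, hence closed. -/
lemma mem_points_iff (γ : Config d) (x : Point d) :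
    x ∈ γ.points ↔ ∀ n : ℕ, ∃ k : ℕ, x ∈ Metric.ball (TopologicalSpace.denseSeq (Point d) k)
      (1 / (n + 1)) ∧ 1 ≤ count (Metric.ball (TopologicalSpace.denseSeq (Point d) k)
      (1 / (n + 1))) γ := by
  have hfin : ∀ y : Point d, ∀ r : ℝ, (γ.points ∩ Metric.ball y r).Finite := fun y r =>
    γ.finite_inter Metric.isBounded_ball
  constructor
  · intro hx n
    obtain ⟨k, hk⟩ := (TopologicalSpace.denseRange_denseSeq (Point d)).exists_dist_lt x
      (Nat.one_div_pos_of_nat (α := ℝ) (n := n))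
    refine ⟨k, hk, ?_⟩
    rw [count, Nat.one_le_iff_ne_zero, ← Nat.pos_iff_ne_zero, Set.ncard_pos (hfin _ _)]
    exact ⟨x, hx, hk⟩
  · intro h
    have hcl : IsClosed (γ.points ∩ Metric.closedBall x 2) :=
      (γ.finite_inter Metric.isBounded_closedBall).isClosed
    refine (hcl.closure_subset (Metric.mem_closure_iff.2 fun ε hε => ?_)).1
    obtain ⟨n, hn⟩ := exists_nat_one_div_lt (half_pos hε)
    obtain ⟨k, hk, hc⟩ := h n
    rw [count, Nat.one_le_iff_ne_zero, ← Nat.pos_iff_ne_zero, Set.ncard_pos (hfin _ _)] at hc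
    obtain ⟨y, hy, hyk⟩ := hc
    have hd : dist x y < 2 * (1 / (n + 1)) := by
      calc dist x y ≤ _ := dist_triangle_right x y (TopologicalSpace.denseSeq (Point d) k)
        _ < 2 * (1 / (n + 1)) := by
          rw [Metric.mem_ball] at hk hyk
          linarith
    have hle : (1 : ℝ) / (n + 1) ≤ 1 := by
      rw [div_le_one (by positivity)]
      linarith [(Nat.cast_nonneg n : (0 : ℝ) ≤ n)]
    refine ⟨y, ⟨hy, ?_⟩, by linarith⟩
    rw [Metric.mem_closedBall, dist_comm]
    linarith

lemma measurableSet_mem : MeasurableSet {p : Config d × Point d | p.2 ∈ p.1.points} := by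
  simp_rw [mem_points_iff, Set.ofPred_forall, Set.ofPred_exists, Set.ofPred_and]
  refine MeasurableSet.iInter fun n => MeasurableSet.iUnion fun k => ?_
  exact (measurable_snd Metric.isOpen_ball.measurableSet).inter
    ((measurable_count Metric.isBounded_ball Metric.isOpen_ball.measurableSet).comp measurable_fst
      (measurableSet_Ici (a := 1)))

open Classical in
lemma count_add {A : Set (Point d)} (hA : Bornology.IsBounded A) (γ : Config d) (x : Point d) :
    count A (γ.add x) = count A γ + if x ∈ A ∧ x ∉ γ.points then 1 else 0 := by
  have hfin := γ.finite_inter hA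
  split_ifs with h
  · have : (γ.add x).points ∩ A = insert x (γ.points ∩ A) := by
      ext y
      simp only [Set.mem_inter_iff, mem_add, Set.mem_insert_iff]
      by_cases hy : y = x
      · subst hy; tauto
      · tauto
    rw [count, this, Set.ncard_insert_of_notMem (fun h' => h.2 h'.1) hfin, count]
  · have : (γ.add x).points ∩ A = γ.points ∩ A := by
      ext y
      simp only [Set.mem_inter_iff, mem_add]
      by_cases hy : y = x
      · subst hy; tauto
      · tauto
    rw [count, this, count, add_zero]

open Classical in
lemma count_remove {A : Set (Point d)} (hA : Bornology.IsBounded A) (γ : Config d) (x : Point d) :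
    count A (γ.remove x) = count A γ - if x ∈ A ∧ x ∈ γ.points then 1 else 0 := by
  have hfin := γ.finite_inter hA
  split_ifs with h
  · have : (γ.remove x).points ∩ A = (γ.points ∩ A) \ {x} := by
      ext y
      simp only [Set.mem_inter_iff, mem_remove, Set.mem_sdiff, Set.mem_singleton_iff]
      by_cases hy : y = x
      · subst hy; tauto
      · tauto
    have hx : x ∈ γ.points ∩ A := ⟨h.2, h.1⟩
    rw [count, this, Set.ncard_sdiff_singleton_of_mem hx, count]
  · have : (γ.remove x).points ∩ A = γ.points ∩ A := by
      ext y
      simp only [Set.mem_inter_iff, mem_remove]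
      by_cases hy : y = x
      · subst hy; tauto
      · tauto
    rw [count, this, count, tsub_zero]

lemma measurable_add : Measurable fun p : Config d × Point d => p.1.add p.2 := by
  classical
  refine measurable_of_count fun A hA hA' => ?_
  simp_rw [count_add hA]
  refine ((measurable_count hA hA').comp measurable_fst).add (Measurable.ite ?_
    measurable_const measurable_const)
  exact (measurable_snd hA').inter measurableSet_mem.compl

lemma measurable_remove : Measurable fun p : Config d × Point d => p.1.remove p.2 := by
  classical
  refine measurable_of_count fun A hA hA' => ?_
  simp_rw [count_remove hA]
  refine ((measurable_count hA hA').comp measurable_fst).sub (Measurable.ite ?_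
    measurable_const measurable_const)
  exact (measurable_snd hA').inter measurableSet_mem

end Config

open Config

/-- The annulus `{x | n ≤ ‖x‖ < n + 1}`. -/
def annulus (d n : ℕ) : Set (Point d) := {x | ⌊‖x‖⌋₊ = n}

lemma measurableSet_annulus (n : ℕ) : MeasurableSet (annulus d n) :=
  (Nat.measurable_floor.comp measurable_norm) (measurableSet_singleton n)

lemma isBounded_annulus (n : ℕ) : Bornology.IsBounded (annulus d n) := by
  refine (Metric.isBounded_ball (x := (0 : Point d)) (r := n + 1)).subset fun x hx => ?_
  rw [mem_ball_zero_iff, ← (hx : ⌊‖x‖⌋₊ = n)]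
  exact Nat.lt_floor_add_one _

lemma pointMeasure_points_of_isBounded (γ : Config d) {A : Set (Point d)}
    (hA : Bornology.IsBounded A) (hA' : MeasurableSet A) :
    pointMeasure γ.points A = count A γ := by
  rw [pointMeasure_apply _ hA', count, ← (γ.finite_inter hA).cast_ncard_eq]
  simp

/-- The counts control bounded sets only; cutting along annuli reduces arbitrary Borel sets to them.
-/
lemma measure_eq_tsum_annulus (μ : Measure (Point d)) {A : Set (Point d)} (hA : MeasurableSet A) :
    μ A = ∑' n, μ (A ∩ annulus d n) := by
  rw [← measure_iUnion]
  · congr 1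
    ext x
    simp [annulus]
  · intro m n hmn
    refine Set.disjoint_left.2 fun x hx hx' => hmn ?_
    exact hx.2.symm.trans hx'.2
  · exact fun n => hA.inter (measurableSet_annulus n)

/-- The kernel `γ ↦ ∑_{x ∈ γ} δ_x`. -/
noncomputable def pointKernel (d : ℕ) : Kernel (Config d) (Point d) where
  toFun γ := pointMeasure γ.points
  measurable' := by
    refine Measure.measurable_of_measurable_coe _ fun A hA => ?_
    simp_rw [measure_eq_tsum_annulus _ hA]
    refine Measurable.tsum fun n => ?_
    have hb : Bornology.IsBounded (A ∩ annulus d n) :=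
      (isBounded_annulus n).subset Set.inter_subset_right
    have hm := hA.inter (measurableSet_annulus (d := d) n)
    simp_rw [pointMeasure_points_of_isBounded _ hb hm]
    exact measurable_from_nat.comp (measurable_count hb hm)

lemma pointKernel_apply (γ : Config d) : pointKernel d γ = pointMeasure γ.points := rfl

instance : IsSFiniteKernel (pointKernel d) := by
  have hms : ∀ p : ℕ × ℕ, MeasurableSet {γ : Config d | count (annulus d p.1) γ = p.2} := fun p =>
    measurable_count (isBounded_annulus p.1) (measurableSet_annulus p.1)
      (measurableSet_singleton p.2)
  classical
  -- The number of points in an annulus is finite but not bounded in γ, so the kernel is cut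
  -- according to the annulus and to its number of points. Each piece is bounded by that number.
  let η : ℕ × ℕ → Kernel (Config d) (Point d) := fun p => Kernel.piecewise (hms p)
    (Kernel.restrict (pointKernel d) (measurableSet_annulus p.1)) 0
  have hη : ∀ p, IsFiniteKernel (η p) := by
    intro p
    refine ⟨⟨p.2, by simp, fun γ => ?_⟩⟩
    rw [Kernel.piecewise_apply']
    split_ifs with h
    · rw [Kernel.restrict_apply' _ _ _ MeasurableSet.univ, Set.univ_inter, pointKernel_apply,
        pointMeasure_points_of_isBounded _ (isBounded_annulus _) (measurableSet_annulus _)]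
      exact_mod_cast h.le
    · simp
  have : pointKernel d = Kernel.sum η := by
    ext γ A hA
    rw [Kernel.sum_apply' _ _ hA, measure_eq_tsum_annulus _ hA, ENNReal.tsum_prod']
    refine tsum_congr fun n => ?_
    rw [tsum_eq_single (count (annulus d n) γ)]
    · simp only [η]
      rw [Kernel.piecewise_apply', if_pos (by simp), Kernel.restrict_apply' _ _ _ hA]
    · intro k hk
      simp only [η]
      rw [Kernel.piecewise_apply', if_neg (by simpa using hk.symm)]
      simp
  rw [this]
  exact Kernel.isSFiniteKernel_sum

lemma measurableSet_ne : MeasurableSet {p : Point d × Point d | p.1 ≠ p.2} :=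
  (measurableSet_eq_fun measurable_fst measurable_snd).compl

/-- The kernel `γ ↦ ∑ δ_{(x, y)}`, the sum being over the ordered pairs of distinct points
of `γ`. -/
noncomputable def pairKernel (d : ℕ) : Kernel (Config d) (Point d × Point d) :=
  Kernel.restrict (pointKernel d ×ₖ pointKernel d) measurableSet_ne

instance : IsSFiniteKernel (pairKernel d) := by
  unfold pairKernel
  infer_instance

lemma lintegral_pairKernel (γ : Config d) {f : Point d × Point d → ℝ≥0∞} (hf : Measurable f) :
    ∫⁻ p, f p ∂pairKernel d γ =
      ∫⁻ x, ∫⁻ y, {p : Point d × Point d | p.1 ≠ p.2}.indicator f (x, y)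
        ∂pointKernel d γ ∂pointKernel d γ := by
  rw [pairKernel, Kernel.restrict_apply, ← lintegral_indicator measurableSet_ne,
    Kernel.lintegral_prod _ _ _ (hf.indicator measurableSet_ne)]

lemma pairKernel_apply (γ : Config d) : pairKernel d γ = pointMeasure γ.points.offDiag := by
  refine Measure.ext_of_lintegral _ fun f hf => ?_
  rw [lintegral_pairKernel _ hf, lintegral_pointMeasure, pointKernel_apply, lintegral_pointMeasure]
  simp_rw [lintegral_pointMeasure]
  rw [← ENNReal.tsum_prod (f := fun x y : γ.points => {p : Point d × Point d | p.1 ≠ p.2}.indicator f (x, y))]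
  rw [tsum_subtype γ.points.offDiag f]
  let e : γ.points × γ.points → Point d × Point d := fun p => (p.1, p.2)
  have he : Function.Injective e := fun p q h => by
    simp only [e, Prod.mk.injEq] at h
    exact Prod.ext (Subtype.ext h.1) (Subtype.ext h.2)
  rw [← he.tsum_eq (f := γ.points.offDiag.indicator f)]
  · refine tsum_congr fun p => ?_
    classical
    simp [Set.indicator_apply, e, Set.mem_offDiag]
  · intro p hp
    have := Set.mem_of_indicator_ne_zero hp
    exact ⟨(⟨p.1, this.1⟩, ⟨p.2, this.2.1⟩), rfl⟩

end Configurations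

end BirthDeath

/-! ### The Mecke formula, from Poisson counts to an identity of measures. -/

namespace BirthDeath

/-- The Poisson weights satisfy k p_k = r p_{k−1}. The truncated value of k − 1 at k = 0 is harmless
because of the factor k. This is the Mecke formula for a single count. -/
lemma lintegral_poissonMeasure_mul (r : ℝ≥0) (g : ℕ → ℝ≥0∞) :
    ∫⁻ k, k * g (k - 1) ∂poissonMeasure r = r * ∫⁻ k, g k ∂poissonMeasure r := by
  rw [lintegral_countable', lintegral_countable', tsum_eq_zero_add' ENNReal.summable,
    ← ENNReal.tsum_mul_left]
  simp only [Nat.cast_zero, zero_mul, zero_add, Nat.add_sub_cancel]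
  refine tsum_congr fun k => ?_
  have h : ((k + 1 : ℕ) : ℝ≥0∞) * poissonMeasure r {k + 1} = r * poissonMeasure r {k} := by
    rw [poissonMeasure_singleton, poissonMeasure_singleton, ← ENNReal.ofReal_coe_nnreal,
      ← ENNReal.ofReal_natCast, ← ENNReal.ofReal_mul (by positivity),
      ← ENNReal.ofReal_mul (by positivity)]
    congr 1
    rw [Nat.factorial_succ, pow_succ]
    push_cast
    have : (k.factorial : ℝ) ≠ 0 := by exact_mod_cast k.factorial_ne_zero
    field_simp
  calc ((k + 1 : ℕ) : ℝ≥0∞) * g k * poissonMeasure r {k + 1}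
      = ((k + 1 : ℕ) : ℝ≥0∞) * poissonMeasure r {k + 1} * g k := by ring
    _ = r * (g k * poissonMeasure r {k}) := by rw [h]; ring

lemma lintegral_pi_poissonMeasure_mul {J : Type*} [Fintype J] [DecidableEq J] (r : J → ℝ≥0)
    (h : (J → ℕ) → ℝ≥0∞) (j : J) :
    ∫⁻ n, n j * h (Function.update n j (n j - 1)) ∂Measure.pi (fun i => poissonMeasure (r i)) =
      r j * ∫⁻ n, h n ∂Measure.pi (fun i => poissonMeasure (r i)) := by
  have hm : ∀ f : (J → ℕ) → ℝ≥0∞, Measurable f := fun f => measurable_of_countable f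
  rw [← lintegral_const_mul _ (hm _), lintegral_eq_lmarginal_univ (fun _ => 0),
    lintegral_eq_lmarginal_univ (fun _ => 0), lmarginal_erase' _ (hm _) (Finset.mem_univ j),
    lmarginal_erase' _ (hm _) (Finset.mem_univ j)]
  congr 1
  funext x
  simp only [Function.update_self, Function.update_idem]
  rw [lintegral_const_mul _ (measurable_of_countable _)]
  exact lintegral_poissonMeasure_mul (r j) fun k => h (Function.update x j k)

variable {d : ℕ} {z : ℝ} {π : Measure (Config d)}

open Config

lemma ae_pointKernel_mem (γ : Config d) : ∀ᵐ x ∂pointKernel d γ, x ∈ γ.points :=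
  ae_pointMeasure _ γ.countable_points.measurableSet fun _ h => h

section DisjointFamily

variable {J : Type*} {D : J → Set (Point d)}

lemma IsPoissonMeasure.map_counts [Fintype J] (hπ : IsPoissonMeasure z π) (hb : ∀ j, Bornology.IsBounded (D j))
    (hm : ∀ j, MeasurableSet (D j)) (hD : Pairwise (Function.onFun Disjoint D)) :
    π.map (fun γ j => count (D j) γ) =
      Measure.pi fun j => poissonMeasure (Real.toNNReal (z * (volume (D j)).toReal)) := by
  have := hπ.isProbabilityMeasure
  let e := Fintype.equivFin J
  have h := hπ.iIndepFun_count _ (fun i => D (e.symm i)) (fun i => hb _) (fun i => hm _)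
    (fun i j hij => hD (e.symm.injective.ne hij))
  have h2 : iIndepFun (fun j => count (D j) : J → Config d → ℕ) π := by
    have := h.precomp e.injective
    simpa using this
  rw [iIndepFun_iff_map_fun_eq_pi_map
    (fun j => (measurable_count (hb j) (hm j)).aemeasurable)] at h2
  rw [h2]
  congr 1
  funext j
  exact hπ.map_count _ (hb j) (hm j)

lemma counts_remove [DecidableEq J] (hb : ∀ j, Bornology.IsBounded (D j))
    (hD : Pairwise (Function.onFun Disjoint D)) (γ : Config d) {x : Point d} (hx : x ∈ γ.points)
    {j : J} (hxj : x ∈ D j) :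
    (fun i => count (D i) (γ.remove x)) =
      Function.update (fun i => count (D i) γ) j (count (D j) γ - 1) := by
  funext i
  rw [count_remove (hb i)]
  by_cases hij : i = j
  · subst hij
    simp [hx, hxj]
  · have : x ∉ D i := fun h => Set.disjoint_left.1 (hD hij) h hxj
    simp [hij, this]

/-- For disjoint sets, removing a point of the j-th one lowers only the j-th count, and this is the
same for each of its points. The inner sum is therefore a count times a function of the counts, and
independence reduces the claim to a product of Poisson laws. -/
lemma IsPoissonMeasure.lintegral_remove_of_disjoint [Fintype J] [DecidableEq J] (hz : 0 < z) (hπ : IsPoissonMeasure z π)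
    (hb : ∀ j, Bornology.IsBounded (D j))
    (hm : ∀ j, MeasurableSet (D j)) (hD : Pairwise (Function.onFun Disjoint D))
    (h : (J → ℕ) → ℝ≥0∞) (j : J) :
    ∫⁻ γ, ∫⁻ x in D j, h (fun i => count (D i) (γ.remove x)) ∂pointKernel d γ ∂π =
      ENNReal.ofReal z * volume (D j) * ∫⁻ γ, h (fun i => count (D i) γ) ∂π := by
  have hmeas : Measurable fun (γ : Config d) (i : J) => count (D i) γ :=
    measurable_pi_lambda _ fun i => measurable_count (hb i) (hm i)
  have h1 : ∀ γ : Config d, ∫⁻ x in D j, h (fun i => count (D i) (γ.remove x)) ∂pointKernel d γ =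
      (fun n : J → ℕ => n j * h (Function.update n j (n j - 1))) (fun i => count (D i) γ) := by
    intro γ
    have : ∀ᵐ x ∂(pointKernel d γ).restrict (D j), h (fun i => count (D i) (γ.remove x)) =
        h (Function.update (fun i => count (D i) γ) j (count (D j) γ - 1)) := by
      rw [ae_restrict_iff' (hm j)]
      filter_upwards [ae_pointKernel_mem γ] with x hx hxj
      rw [counts_remove hb hD γ hx hxj]
    rw [lintegral_congr_ae this, lintegral_const, Measure.restrict_apply_univ, pointKernel_apply,
      pointMeasure_points_of_isBounded _ (hb j) (hm j), mul_comm]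
  have h2 : ∀ g : (J → ℕ) → ℝ≥0∞, ∫⁻ γ, g (fun i => count (D i) γ) ∂π =
      ∫⁻ n, g n ∂Measure.pi
        fun j => poissonMeasure (Real.toNNReal (z * (volume (D j)).toReal)) := fun g => by
    rw [← hπ.map_counts hb hm hD, lintegral_map (measurable_of_countable g) hmeas]
  rw [lintegral_congr h1, h2 (fun n => n j * h (Function.update n j (n j - 1))), h2 h,
    lintegral_pi_poissonMeasure_mul]
  congr 1
  rw [ENNReal.ofNNReal_toNNReal, ENNReal.ofReal_mul hz.le, ENNReal.ofReal_toReal]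
  exact (hb j).measure_lt_top.ne

end DisjointFamily

/-! ### Reduction of overlapping sets to disjoint atoms. -/

section Atoms

variable {ι : Type*}

/-- The atoms of the algebra generated by a finite family of sets, inside their union. -/
def atom (A : ι → Set (Point d)) (s : Set ι) : Set (Point d) :=
  (⋃ i, A i) ∩ ⋂ i, {x | x ∈ A i ↔ i ∈ s}

variable {A : ι → Set (Point d)}

lemma isBounded_atom [Finite ι] (hb : ∀ i, Bornology.IsBounded (A i)) (s : Set ι) :
    Bornology.IsBounded (atom A s) :=
  ((Bornology.isBounded_iUnion).2 hb).subset Set.inter_subset_left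

lemma measurableSet_atom [Finite ι] (hm : ∀ i, MeasurableSet (A i)) (s : Set ι) :
    MeasurableSet (atom A s) := by
  refine (MeasurableSet.iUnion hm).inter (MeasurableSet.iInter fun i => ?_)
  by_cases h : i ∈ s
  · simpa [h] using hm i
  · have : {x | x ∈ A i ↔ i ∈ s} = (A i)ᶜ := by
      ext x
      simp [h]
    rw [this]
    exact (hm i).compl

lemma pairwise_disjoint_atom : Pairwise (Function.onFun Disjoint (atom A)) := by
  intro s t hst
  refine Set.disjoint_left.2 fun x hx hx' => hst ?_
  ext i
  have h1 := Set.mem_iInter.1 hx.2 i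
  have h2 := Set.mem_iInter.1 hx'.2 i
  exact Iff.trans (Iff.symm h1) h2

lemma iUnion_atom (i : ι) : A i = ⋃ s : {s : Set ι // i ∈ s}, atom A s := by
  ext x
  simp only [Set.mem_iUnion]
  constructor
  · intro hx
    exact ⟨⟨{j | x ∈ A j}, hx⟩, Set.mem_iUnion.2 ⟨i, hx⟩, Set.mem_iInter.2 fun j => Iff.rfl⟩
  · rintro ⟨⟨s, hs⟩, hx⟩
    have := Set.mem_iInter.1 hx.2 i
    exact (Iff.mpr this hs)

lemma count_eq_sum_atom [Finite ι] (hb : ∀ i, Bornology.IsBounded (A i))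
    (hm : ∀ i, MeasurableSet (A i)) (γ : Config d) (i : ι) [Fintype {s : Set ι // i ∈ s}] :
    count (A i) γ = ∑ s : {s : Set ι // i ∈ s}, count (atom A s) γ := by
  have h : pointMeasure γ.points (A i) =
      ∑ s : {s : Set ι // i ∈ s}, pointMeasure γ.points (atom A s) := by
    conv_lhs => rw [iUnion_atom (A := A) i]
    rw [measure_iUnion _ fun s => measurableSet_atom hm _, tsum_fintype]
    exact fun s t hst => pairwise_disjoint_atom fun h => hst (Subtype.ext h)
  rw [pointMeasure_points_of_isBounded _ (hb i) (hm i)] at h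
  simp_rw [pointMeasure_points_of_isBounded _ (isBounded_atom hb _) (measurableSet_atom hm _)] at h
  exact_mod_cast h

/-- Every count of the family is a sum of counts of the disjoint atoms, and `A i` is the disjoint
union of its atoms. The disjoint case is summed over them. -/
lemma IsPoissonMeasure.lintegral_remove_of_family [Fintype ι] (hz : 0 < z) (hπ : IsPoissonMeasure z π)
    (hb : ∀ i, Bornology.IsBounded (A i)) (hm : ∀ i, MeasurableSet (A i))
    (h : (ι → ℕ) → ℝ≥0∞) (i : ι) :
    ∫⁻ γ, ∫⁻ x in A i, h (fun j => count (A j) (γ.remove x)) ∂pointKernel d γ ∂π =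
      ENNReal.ofReal z * volume (A i) * ∫⁻ γ, h (fun j => count (A j) γ) ∂π := by
  classical
  have hdisj : Pairwise (Function.onFun Disjoint fun s : {s : Set ι // i ∈ s} => atom A s) :=
    fun s t hst => pairwise_disjoint_atom fun h => hst (Subtype.ext h)
  let S : (Set ι → ℕ) → ι → ℕ := fun n j => ∑ s : {s : Set ι // j ∈ s}, n s
  have hS : ∀ γ : Config d, (fun j => count (A j) γ) = S fun s => count (atom A s) γ :=
    fun γ => funext fun j => count_eq_sum_atom hb hm γ j
  have hmN : Measurable fun (γ : Config d) (s : Set ι) => count (atom A s) γ :=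
    measurable_pi_lambda _ fun s => measurable_count (isBounded_atom hb s) (measurableSet_atom hm s)
  simp_rw [hS]
  have key := fun s => hπ.lintegral_remove_of_disjoint hz (isBounded_atom hb)
    (measurableSet_atom hm) pairwise_disjoint_atom (fun n => h (S n)) s
  have hjoint : Measurable (fun p : Config d × Point d =>
      h (S fun s => count (atom A s) (p.1.remove p.2))) :=
    (measurable_of_countable fun n => h (S n)).comp (hmN.comp measurable_remove)
  calc _ = ∫⁻ γ, ∑ s : {s : Set ι // i ∈ s}, ∫⁻ x in atom A s,
        h (S fun s => count (atom A s) (γ.remove x)) ∂pointKernel d γ ∂π := by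
        refine lintegral_congr fun γ => ?_
        conv_lhs => rw [iUnion_atom (A := A) i]
        rw [lintegral_iUnion (fun s => measurableSet_atom hm _) hdisj, tsum_fintype]
    _ = ∑ s : {s : Set ι // i ∈ s}, ∫⁻ γ, ∫⁻ x in atom A s,
        h (S fun s => count (atom A s) (γ.remove x)) ∂pointKernel d γ ∂π := by
        refine lintegral_finsetSum _ fun s _ => ?_
        simp_rw [← Kernel.restrict_apply (pointKernel d) (measurableSet_atom hm (s : Set ι))]
        exact Measurable.lintegral_kernel_prod_right hjoint
    _ = _ := by
        simp_rw [key]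
        rw [← Finset.sum_mul, ← Finset.mul_sum]
        congr 2
        conv_rhs => rw [iUnion_atom (A := A) i]
        rw [measure_iUnion hdisj (fun s => measurableSet_atom hm _), tsum_fintype]

end Atoms

/-- The Campbell measure of a Poisson measure, reduced by removing the marked point. -/
lemma IsPoissonMeasure.map_remove (hz : 0 < z) (hπ : IsPoissonMeasure z π) :
    (π ⊗ₘ pointKernel d).map (fun p => (p.1.remove p.2, p.2)) =
      π.prod (ENNReal.ofReal z • volume) := by
  have := hπ.isProbabilityMeasure
  let I := {A : Set (Point d) // Bornology.IsBounded A ∧ MeasurableSet A}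
  let m : I → MeasurableSpace (Config d) := fun A => MeasurableSpace.comap (count A.1) ⊤
  -- Cylinder sets determined by finitely many counts form a π-system, as do the bounded Borel sets.
  -- It is enough to compare both measures on products of these.
  let C := piiUnionInter (fun A => {s | MeasurableSet[m A] s}) Set.univ
  let C' := {A : Set (Point d) | Bornology.IsBounded A ∧ MeasurableSet A}
  have hC : MeasurableSpace.generateFrom C = (inferInstance : MeasurableSpace (Config d)) := by
    refine (generateFrom_piiUnionInter_measurableSet m Set.univ).trans ?_
    simp only [Set.mem_univ, iSup_pos]
    rfl
  have hC' : MeasurableSpace.generateFrom C' =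
      (inferInstance : MeasurableSpace (Point d)) := by
    refine le_antisymm (MeasurableSpace.generateFrom_le fun s hs => hs.2) ?_
    intro s hs
    have : s = ⋃ n, s ∩ annulus d n := by
      ext x
      simp [annulus]
    rw [this]
    exact MeasurableSet.iUnion fun n => MeasurableSpace.measurableSet_generateFrom
      ⟨(isBounded_annulus n).subset Set.inter_subset_right, hs.inter (measurableSet_annulus n)⟩
  have hπC : IsPiSystem C := isPiSystem_piiUnionInter _
    (fun A => @MeasurableSpace.isPiSystem_measurableSet _ (m A)) _
  have hπC' : IsPiSystem C' := fun s hs t ht _ =>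
    ⟨hs.1.subset Set.inter_subset_left, hs.2.inter ht.2⟩
  symm
  refine Measure.prod_eq_generateFrom hC hC' hπC hπC'
    ⟨fun _ => Set.univ, fun _ => ⟨∅, by simp, fun _ => Set.univ, by simp, by simp⟩,
      fun _ => measure_lt_top _ _, Set.iUnion_const _⟩
    ⟨fun n => Metric.ball 0 n, fun n => ⟨Metric.isBounded_ball, Metric.isOpen_ball.measurableSet⟩,
      fun n => ?_, Metric.iUnion_ball_nat 0⟩ ?_
  · rw [Measure.smul_apply, smul_eq_mul]
    exact ENNReal.mul_lt_top ENNReal.ofReal_lt_top measure_ball_lt_top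
  · rintro _ ⟨t, -, f, hf, rfl⟩ A hA
    classical
    have hf' : ∀ i : t, ∃ U : Set ℕ, count i.1.1 ⁻¹' U = f i := fun i => by
      obtain ⟨U, -, hU⟩ := hf i i.2
      exact ⟨U, hU⟩
    choose U hU using hf'
    -- The sets that define the cylinder are joined by `A` itself, at `none`, so that the formula
    -- for one finite family applies.
    let A' : Option t → Set (Point d) := fun o => o.elim A fun i => i.1.1
    have hb : ∀ o, Bornology.IsBounded (A' o) := by
      rintro (_ | i)
      exacts [hA.1, i.1.2.1]
    have hm : ∀ o, MeasurableSet (A' o) := by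
      rintro (_ | i)
      exacts [hA.2, i.1.2.2]
    let T : Set (Option t → ℕ) := {n | ∀ i, n (some i) ∈ U i}
    have hB : (⋂ x ∈ t, f x) = {γ | (fun j => count (A' j) γ) ∈ T} := by
      ext γ
      simp only [Set.mem_iInter]
      constructor
      · intro h i
        have h2 := h i i.2
        rw [← hU i] at h2
        exact h2
      · intro h i hi
        rw [← hU ⟨i, hi⟩]
        exact h ⟨i, hi⟩
    have hmN : Measurable fun (γ : Config d) (o : Option t) => count (A' o) γ :=
      measurable_pi_lambda _ fun o => measurable_count (hb o) (hm o)
    have hBm : MeasurableSet (⋂ x ∈ t, f x) := by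
      rw [hB]
      exact hmN (Set.to_countable T).measurableSet
    have hR : Measurable fun p : Config d × Point d => (p.1.remove p.2, p.2) :=
      measurable_remove.prodMk measurable_snd
    have key := hπ.lintegral_remove_of_family hz hb hm (T.indicator 1) none
    have h1 : ∀ γ : Config d, T.indicator (1 : (Option t → ℕ) → ℝ≥0∞) (fun j => count (A' j) γ) =
        (⋂ x ∈ t, f x).indicator 1 γ := by
      intro γ
      rw [hB]
      rfl
    simp_rw [h1] at key
    rw [lintegral_indicator_one hBm] at key
    rw [Measure.map_apply hR (hBm.prod hA.2), Measure.compProd_apply (hR (hBm.prod hA.2)),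
      Measure.smul_apply, smul_eq_mul, mul_comm]
    refine Eq.trans ?_ key
    refine lintegral_congr fun γ => ?_
    have hs : MeasurableSet {x : Point d | γ.remove x ∈ ⋂ x ∈ t, f x} :=
      (measurable_remove.comp measurable_prodMk_left) hBm
    have h2 : (fun x => (⋂ x ∈ t, f x).indicator (1 : Config d → ℝ≥0∞) (γ.remove x)) =
        {x : Point d | γ.remove x ∈ ⋂ x ∈ t, f x}.indicator 1 := rfl
    rw [h2, lintegral_indicator_one hs, Measure.restrict_apply hs]
    rfl

/-- The Mecke formula, as an identity of measures. -/
theorem IsPoissonMeasure.compProd_pointKernel (hz : 0 < z) (hπ : IsPoissonMeasure z π) :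
    π ⊗ₘ pointKernel d =
      (π.prod (ENNReal.ofReal z • volume)).map (fun p => (p.1.add p.2, p.2)) := by
  have := hπ.isProbabilityMeasure
  have hR : Measurable fun p : Config d × Point d => (p.1.remove p.2, p.2) :=
    measurable_remove.prodMk measurable_snd
  have hA : Measurable fun p : Config d × Point d => (p.1.add p.2, p.2) :=
    measurable_add.prodMk measurable_snd
  rw [← hπ.map_remove hz, Measure.map_map hA hR]
  conv_lhs => rw [← Measure.map_id (μ := π ⊗ₘ pointKernel d)]
  refine Measure.map_congr ?_
  -- Almost surely the marked point lies in γ, so putting it back undoes its removal.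
  filter_upwards [Measure.ae_compProd_of_ae_ae measurableSet_mem
    (ae_of_all π fun γ => ae_pointKernel_mem γ)] with p hp
  simp [remove_add hp]

end BirthDeath

/-! ### Integral forms of the Mecke formula, for points and for pairs. -/

namespace BirthDeath

open Config

variable {d : ℕ} {z : ℝ} {π : Measure (Config d)}

/-- The intensity measure `z dx`. -/
noncomputable def intensity (d : ℕ) (z : ℝ) : Measure (Point d) := ENNReal.ofReal z • volume

instance : SFinite (intensity d z) := by
  unfold intensity
  infer_instance

lemma ae_intensity {p : Point d → Prop} (h : ∀ᵐ x, p x) : ∀ᵐ x ∂intensity d z, p x :=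
  Measure.ae_smul_measure h _

lemma lintegral_intensity (f : Point d → ℝ≥0∞) :
    ∫⁻ x, f x ∂intensity d z = ENNReal.ofReal z * ∫⁻ x, f x := by
  rw [intensity, lintegral_smul_measure, smul_eq_mul]

lemma integral_intensity (hz : 0 < z) (f : Point d → ℝ) :
    ∫ x, f x ∂intensity d z = z * ∫ x, f x := by
  rw [intensity, integral_smul_measure, ENNReal.toReal_ofReal hz.le, smul_eq_mul]

lemma integrable_intensity {f : Point d → ℝ} (hf : Integrable f) :
    Integrable f (intensity d z) := hf.smul_measure ENNReal.ofReal_ne_top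

lemma ae_notMem_points [NullSingletonClass (volume : Measure (Point d))] (γ : Config d) :
    ∀ᵐ x ∂intensity d z, x ∉ γ.points :=
  ae_intensity (measure_eq_zero_iff_ae_notMem.1 (γ.countable_points.measure_zero _))

lemma ae_ne [NullSingletonClass (volume : Measure (Point d))] (y : Point d) :
    ∀ᵐ x ∂intensity d z, x ≠ y :=
  ae_intensity (by
    have := measure_eq_zero_iff_ae_notMem.1 (measure_singleton (μ := (volume : Measure (Point d))) y)
    simpa using this)

section PointMeasures

lemma pointMeasure_add {γ : Config d} {x : Point d} (hx : x ∉ γ.points) :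
    pointMeasure (γ.add x).points = pointMeasure γ.points + Measure.dirac x := by
  ext A hA
  rw [Measure.add_apply, pointMeasure_apply _ hA, pointMeasure_apply _ hA,
    Measure.dirac_apply' _ hA]
  by_cases hxA : x ∈ A
  · have : (γ.add x).points ∩ A = insert x (γ.points ∩ A) := by
      ext y
      simp only [Set.mem_inter_iff, mem_add, Set.mem_insert_iff]
      by_cases hy : y = x
      · subst hy; tauto
      · tauto
    rw [this, Set.encard_insert_of_notMem fun h => hx h.1]
    simp [hxA]
  · have : (γ.add x).points ∩ A = γ.points ∩ A := by
      ext y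
      simp only [Set.mem_inter_iff, mem_add]
      by_cases hy : y = x
      · subst hy; tauto
      · tauto
    rw [this]
    simp [hxA]

lemma lintegral_pointKernel_add {γ : Config d} {x : Point d} (hx : x ∉ γ.points)
    (f : Point d → ℝ≥0∞) :
    ∫⁻ y, f y ∂pointKernel d (γ.add x) = ∫⁻ y, f y ∂pointKernel d γ + f x := by
  rw [pointKernel_apply, pointMeasure_add hx, lintegral_add_measure, lintegral_dirac,
    pointKernel_apply]

lemma add_of_mem {γ : Config d} {x : Point d} (hx : x ∈ γ.points) : γ.add x = γ := by
  ext y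
  rw [mem_add]
  exact ⟨fun h => h.elim id fun h => h ▸ hx, Or.inl⟩

lemma lintegral_pointKernel_add_of_eq_zero (γ : Config d) {x : Point d}
    {f : Point d → ℝ≥0∞} (hf : f x = 0) :
    ∫⁻ y, f y ∂pointKernel d (γ.add x) = ∫⁻ y, f y ∂pointKernel d γ := by
  by_cases hx : x ∈ γ.points
  · rw [add_of_mem hx]
  · rw [lintegral_pointKernel_add hx, hf, add_zero]

lemma add_add_comm (γ : Config d) (x y : Point d) : (γ.add x).add y = (γ.add y).add x := by
  ext w
  simp only [mem_add]
  tauto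

end PointMeasures

section Mecke

/-- The Mecke formula. -/
theorem IsPoissonMeasure.lintegral_pointKernel (hz : 0 < z) (hπ : IsPoissonMeasure z π)
    {f : Config d × Point d → ℝ≥0∞} (hf : Measurable f) :
    ∫⁻ γ, ∫⁻ x, f (γ, x) ∂pointKernel d γ ∂π =
      ∫⁻ x, ∫⁻ γ, f (γ.add x, x) ∂π ∂intensity d z := by
  have := hπ.isProbabilityMeasure
  have hA : Measurable fun p : Config d × Point d => (p.1.add p.2, p.2) :=
    measurable_add.prodMk measurable_snd
  rw [← Measure.lintegral_compProd hf, hπ.compProd_pointKernel hz, lintegral_map hf hA]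
  exact lintegral_prod_symm' (ν := intensity d z) _ (hf.comp hA)

lemma measurable_add_add :
    Measurable fun p : Config d × Point d × Point d => (p.1.add p.2.1).add p.2.2 :=
  measurable_add.comp ((measurable_add.comp
    (measurable_fst.prodMk (measurable_fst.comp measurable_snd))).prodMk
    (measurable_snd.comp measurable_snd))

/-- The Mecke formula for pairs, as an identity of measures. -/
theorem IsPoissonMeasure.compProd_pairKernel [NullSingletonClass (volume : Measure (Point d))] (hz : 0 < z)
    (hπ : IsPoissonMeasure z π) :
    π ⊗ₘ pairKernel d =
      (π.prod ((intensity d z).prod (intensity d z))).map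
        (fun p => ((p.1.add p.2.1).add p.2.2, p.2)) := by
  have := hπ.isProbabilityMeasure
  refine Measure.ext_of_lintegral _ fun f hf => ?_
  have hA : Measurable fun p : Config d × Point d × Point d =>
      ((p.1.add p.2.1).add p.2.2, p.2) := measurable_add_add.prodMk measurable_snd
  rw [Measure.lintegral_compProd hf, lintegral_map hf hA]
  let g : Config d × Point d → Point d → ℝ≥0∞ := fun q y =>
    {p : Point d × Point d | p.1 ≠ p.2}.indicator (fun p => f (q.1, p)) (q.2, y)
  have hg : Measurable (Function.uncurry g) := by
    have : Function.uncurry g = {r : (Config d × Point d) × Point d | r.1.2 ≠ r.2}.indicator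
        (fun r => f (r.1.1, r.1.2, r.2)) := by
      ext r
      rfl
    rw [this]
    exact (hf.comp (by fun_prop)).indicator (measurableSet_eq_fun (by fun_prop) (by fun_prop)).compl
  -- The integrand vanishes on the diagonal, so the point x added by the first use of the Mecke
  -- formula does not enter the inner sum, which becomes a sum over γ. The formula then applies
  -- again.
  have hg0 : ∀ γ x, g (γ, x) x = 0 := fun γ x => by simp [g]
  calc ∫⁻ γ, ∫⁻ p, f (γ, p) ∂pairKernel d γ ∂π
      = ∫⁻ γ, ∫⁻ x, (∫⁻ y, g (γ, x) y ∂pointKernel d γ) ∂pointKernel d γ ∂π :=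
        lintegral_congr fun γ => lintegral_pairKernel γ (hf.comp measurable_prodMk_left)
    _ = ∫⁻ x, ∫⁻ γ, ∫⁻ y, g (γ.add x, x) y ∂pointKernel d (γ.add x) ∂π ∂intensity d z := by
        refine hπ.lintegral_pointKernel hz
          (f := fun q : Config d × Point d => ∫⁻ y, g q y ∂pointKernel d q.1) ?_
        have := Measurable.lintegral_kernel_prod_right
          (κ := (pointKernel d).comap (Prod.fst : Config d × Point d → Config d) measurable_fst) hg
        simpa only [Kernel.comap_apply] using this
    _ = ∫⁻ x, ∫⁻ y, ∫⁻ γ, f (((γ.add x).add y), x, y) ∂π ∂intensity d z ∂intensity d z := by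
        refine lintegral_congr fun x => ?_
        simp_rw [fun γ => lintegral_pointKernel_add_of_eq_zero γ (hg0 (γ.add x) x)]
        have hgx : Measurable fun q : Config d × Point d => g (q.1.add x, x) q.2 :=
          hg.comp (((measurable_add.comp
            (measurable_fst.prodMk measurable_const)).prodMk measurable_const).prodMk
              measurable_snd)
        rw [hπ.lintegral_pointKernel hz hgx]
        refine lintegral_congr_ae ?_
        filter_upwards [ae_ne x] with y hy
        refine lintegral_congr fun γ => ?_
        simp only [g]
        rw [Set.indicator_of_mem (by exact hy.symm), add_add_comm]
    _ = ∫⁻ p, f ((p.1.add p.2.1).add p.2.2, p.2)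
          ∂(π.prod ((intensity d z).prod (intensity d z))) := by
        have hf' : Measurable fun p : Config d × Point d × Point d =>
            f ((p.1.add p.2.1).add p.2.2, p.2) := hf.comp hA
        rw [lintegral_prod_symm' _ hf', lintegral_prod]
        exact (Measurable.lintegral_prod_left' hf').aemeasurable

/-- Integration of a tilted linear statistic by means of a Mecke type identity. -/
lemma integral_mul_integral_kernel {X : Type*} [MeasurableSpace X] [SFinite π]
    {η : Kernel (Config d) X} [IsSFiniteKernel η] {ν : Measure X} [SFinite ν]
    {T : Config d × X → Config d} (hT : Measurable T)
    (h : π ⊗ₘ η = (π.prod ν).map fun p => (T p, p.2)) {W : Config d → ℝ} (hW : Measurable W)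
    (hWpos : ∀ γ, 0 < W γ) (hWint : Integrable W π) {w : X → ℝ}
    (hw : ∀ γ, ∀ᵐ x ∂ν, W (T (γ, x)) = W γ * w x) (hwm : Measurable w)
    {g : X → ℝ} (hg : Measurable g) (hgint : Integrable (fun x => w x * g x) ν) :
    Integrable (fun γ => W γ * ∫ x, g x ∂η γ) π ∧
      ∫ γ, W γ * ∫ x, g x ∂η γ ∂π = (∫ x, w x * g x ∂ν) * ∫ γ, W γ ∂π ∧
      ∀ᵐ γ ∂π, Integrable g (η γ) := by
  have hTm : Measurable fun p : Config d × X => (T p, p.2) := hT.prodMk measurable_snd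
  -- Under the Mecke type identity the integrand becomes W(T(γ,x)) g(x) = W(γ) w(x) g(x), a product;
  -- Fubini then separates γ from x.
  let F : Config d × X → ℝ := fun p => W p.1 * g p.2
  have hF : Measurable F := (hW.comp measurable_fst).mul (hg.comp measurable_snd)
  have hae : (fun p => F (T p, p.2)) =ᵐ[π.prod ν] fun p => W p.1 * (w p.2 * g p.2) := by
    have hms : MeasurableSet {p : Config d × X | F (T p, p.2) = W p.1 * (w p.2 * g p.2)} :=
      measurableSet_eq_fun (hF.comp hTm) ((hW.comp measurable_fst).mul
        ((hwm.comp measurable_snd).mul (hg.comp measurable_snd)))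
    refine (Measure.ae_prod_iff_ae_ae hms).2 (ae_of_all _ fun γ => ?_)
    filter_upwards [hw γ] with x hx
    simp only [F, hx, mul_assoc]
  have hint' : Integrable (fun p : Config d × X => W p.1 * (w p.2 * g p.2)) (π.prod ν) :=
    hWint.mul_prod hgint
  have hint : Integrable F (π ⊗ₘ η) := by
    rw [h, integrable_map_measure hF.aestronglyMeasurable hTm.aemeasurable]
    exact hint'.congr hae.symm
  have hI : ∀ γ, ∫ x, F (γ, x) ∂η γ = W γ * ∫ x, g x ∂η γ := fun γ => by
    simp only [F]
    exact integral_const_mul _ _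
  refine ⟨?_, ?_, ?_⟩
  · exact (hint.integral_compProd (κ := Kernel.const Unit π)  (η := Kernel.prodMkLeft Unit η) (a := ())).congr (ae_of_all _ hI)
  · have h1 := Measure.integral_compProd hint
    simp_rw [hI] at h1
    rw [← h1, h, integral_map hTm.aemeasurable hF.aestronglyMeasurable, integral_congr_ae hae,
      integral_prod_mul (μ := π) (ν := ν) W (fun x => w x * g x), mul_comm]
  -- Integrability of W(γ)g against the kernel passes to g, because W(γ) is a nonzero constant
  -- there.
  · filter_upwards [((Measure.integrable_compProd_iff hF.aestronglyMeasurable).1 hint).1] with γ hγ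
    have := hγ.const_mul (W γ)⁻¹
    refine this.congr (ae_of_all _ fun x => ?_)
    simp only [F]
    rw [inv_mul_cancel_left₀ (hWpos γ).ne']

end Mecke

end BirthDeath

/-! ### Exponential functions of configurations and the Laplace functional. -/

namespace BirthDeath

open Config

variable {d : ℕ} {z : ℝ} {π : Measure (Config d)}

section Pairing

lemma integrable_pointKernel_of_hasCompactSupport (γ : Config d) {f : Point d → ℝ}
    (hf : HasCompactSupport f) : Integrable f (pointKernel d γ) := by
  rw [pointKernel_apply, integrable_pointMeasure_iff γ.countable_points]
  refine summable_of_hasFiniteSupport (Set.Finite.of_finite_image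
    ((γ.2 _ hf).subset ?_) Subtype.val_injective.injOn)
  rintro _ ⟨x, hx, rfl⟩
  exact ⟨x.2, subset_tsupport _ hx⟩

lemma pairing_eq_integral (φ : C_c(Point d, ℝ)) (γ : Config d) :
    γ.pairing φ = ∫ x, φ x ∂pointKernel d γ :=
  (integral_pointMeasure γ.countable_points _).symm

lemma measurable_integral_pointKernel {g : Point d → ℝ} (hg : Measurable g) :
    Measurable fun γ => ∫ x, g x ∂pointKernel d γ :=
  hg.stronglyMeasurable.integral_kernel.measurable

lemma measurable_pairing (φ : C_c(Point d, ℝ)) : Measurable fun γ : Config d => γ.pairing φ := by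
  simp_rw [pairing_eq_integral]
  exact measurable_integral_pointKernel φ.continuous.measurable

lemma pairing_add_left (φ ψ : C_c(Point d, ℝ)) (γ : Config d) :
    γ.pairing (φ + ψ) = γ.pairing φ + γ.pairing ψ := by
  simp only [pairing_eq_integral, CompactlySupportedContinuousMap.add_apply]
  exact integral_add (integrable_pointKernel_of_hasCompactSupport γ φ.hasCompactSupport)
    (integrable_pointKernel_of_hasCompactSupport γ ψ.hasCompactSupport)

lemma pairing_smul (t : ℝ) (φ : C_c(Point d, ℝ)) (γ : Config d) :
    γ.pairing (t • φ) = t * γ.pairing φ := by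
  simp only [pairing_eq_integral, CompactlySupportedContinuousMap.smul_apply, smul_eq_mul]
  exact integral_const_mul _ _

lemma pairing_zero (γ : Config d) : γ.pairing 0 = 0 := by
  simp [pairing]

lemma pairing_add (φ : C_c(Point d, ℝ)) {γ : Config d} {x : Point d} (hx : x ∉ γ.points) :
    (γ.add x).pairing φ = γ.pairing φ + φ x := by
  have h := integrable_pointKernel_of_hasCompactSupport (γ.add x) φ.hasCompactSupport
  rw [pairing_eq_integral, pairing_eq_integral]
  rw [pointKernel_apply, pointMeasure_add hx] at h ⊢
  rw [integral_add_measure (integrable_add_measure.1 h).1 (integrable_add_measure.1 h).2,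
    integral_dirac, pointKernel_apply]

lemma pairing_remove (φ : C_c(Point d, ℝ)) {γ : Config d} {x : Point d} (hx : x ∈ γ.points) :
    (γ.remove x).pairing φ = γ.pairing φ - φ x := by
  have h := pairing_add φ (γ := γ.remove x) (x := x) (by simp [mem_remove])
  rw [remove_add hx] at h
  rw [h]
  ring

end Pairing

/-- The function `γ ↦ exp ⟨φ, γ⟩`. -/
noncomputable def expPairing (φ : C_c(Point d, ℝ)) (γ : Config d) : ℝ := Real.exp (γ.pairing φ)

lemma measurable_expPairing (φ : C_c(Point d, ℝ)) : Measurable (expPairing φ) :=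
  (measurable_pairing φ).exp

lemma expPairing_pos (φ : C_c(Point d, ℝ)) (γ : Config d) : 0 < expPairing φ γ := Real.exp_pos _

lemma expPairing_mul (φ ψ : C_c(Point d, ℝ)) (γ : Config d) :
    expPairing φ γ * expPairing ψ γ = expPairing (φ + ψ) γ := by
  rw [expPairing, expPairing, expPairing, pairing_add_left, Real.exp_add]

lemma expPairing_zero (γ : Config d) : expPairing 0 γ = 1 := by
  rw [expPairing, pairing_zero, Real.exp_zero]

lemma expPairing_add (φ : C_c(Point d, ℝ)) {γ : Config d} {x : Point d} (hx : x ∉ γ.points) :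
    expPairing φ (γ.add x) = expPairing φ γ * Real.exp (φ x) := by
  rw [expPairing, pairing_add φ hx, Real.exp_add, expPairing]

lemma expPairing_remove (φ : C_c(Point d, ℝ)) {γ : Config d} {x : Point d} (hx : x ∈ γ.points) :
    expPairing φ (γ.remove x) = expPairing φ γ * Real.exp (-φ x) := by
  rw [expPairing, pairing_remove φ hx, sub_eq_add_neg, Real.exp_add, expPairing]

lemma exists_bound (φ : C_c(Point d, ℝ)) : ∃ M : ℝ, 0 ≤ M ∧ ∀ x, |φ x| ≤ M := by
  obtain ⟨M, hM⟩ := φ.hasCompactSupport.exists_bound_of_continuous φ.continuous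
  exact ⟨max M 0, le_max_right _ _, fun x => (hM x).trans (le_max_left _ _)⟩

lemma pairing_le (φ : C_c(Point d, ℝ)) {M : ℝ} (hM : ∀ x, |φ x| ≤ M) (γ : Config d) :
    γ.pairing φ ≤ M * count (tsupport φ) γ := by
  have hc : IsCompact (tsupport φ) := φ.hasCompactSupport
  have hK : MeasurableSet (tsupport φ) := hc.measurableSet
  have hind : Integrable ((tsupport φ).indicator fun _ => M) (pointKernel d γ) := by
    rw [integrable_indicator_iff hK]
    refine integrableOn_const ?_
    rw [pointKernel_apply, pointMeasure_points_of_isBounded _ hc.isBounded hK]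
    exact ENNReal.natCast_ne_top _
  calc γ.pairing φ = ∫ x, φ x ∂pointKernel d γ := pairing_eq_integral φ γ
    _ ≤ ∫ x, (tsupport φ).indicator (fun _ => M) x ∂pointKernel d γ := by
        refine integral_mono
          (integrable_pointKernel_of_hasCompactSupport γ φ.hasCompactSupport) hind fun x => ?_
        by_cases hx : x ∈ tsupport φ
        · rw [Set.indicator_of_mem hx]
          exact (le_abs_self _).trans (hM x)
        · rw [Set.indicator_of_notMem hx]
          exact (image_eq_zero_of_notMem_tsupport hx).le
    _ = M * count (tsupport φ) γ := by
        rw [integral_indicator hK, setIntegral_const, smul_eq_mul, mul_comm, measureReal_def,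
          pointKernel_apply, pointMeasure_points_of_isBounded _ hc.isBounded hK]
        simp

/-- The pairing is at most sup|φ| times the number of points in the support of φ, and a Poisson
variable has all exponential moments. -/
lemma IsPoissonMeasure.integrable_expPairing (hπ : IsPoissonMeasure z π) (φ : C_c(Point d, ℝ)) :
    Integrable (expPairing φ) π := by
  obtain ⟨M, hM0, hM⟩ := exists_bound φ
  have hc : IsCompact (tsupport φ) := φ.hasCompactSupport
  have hK : MeasurableSet (tsupport φ) := hc.measurableSet
  have h1 : Integrable (fun n : ℕ => Real.exp (M * n)) (π.map (count (tsupport φ))) := by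
    rw [hπ.map_count _ hc.isBounded hK, integrable_poissonMeasure_iff]
    set r := Real.toNNReal (z * (volume (tsupport φ)).toReal)
    have := (Real.summable_pow_div_factorial (r * Real.exp M)).mul_left (Real.exp (-r))
    refine this.congr fun n => ?_
    rw [Real.norm_of_nonneg (Real.exp_pos _).le, mul_pow, ← Real.exp_nat_mul, mul_comm (n : ℝ) M]
    ring
  have h2 := h1.comp_measurable (measurable_count hc.isBounded hK)
  refine h2.mono' (measurable_expPairing φ).aestronglyMeasurable (ae_of_all _ fun γ => ?_)
  rw [Real.norm_of_nonneg (expPairing_pos _ _).le]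
  exact Real.exp_le_exp.2 (pairing_le φ hM γ)

lemma IsPoissonMeasure.memLp_expPairing (hπ : IsPoissonMeasure z π) (φ : C_c(Point d, ℝ)) :
    MemLp (expPairing φ) 2 π := by
  rw [memLp_two_iff_integrable_sq (measurable_expPairing φ).aestronglyMeasurable]
  simp_rw [sq, expPairing_mul]
  exact hπ.integrable_expPairing _

lemma integrable_exp_mul {g : Point d → ℝ} (hg : Integrable g) (θ : C_c(Point d, ℝ)) :
    Integrable fun x => Real.exp (θ x) * g x := by
  obtain ⟨M, -, hM⟩ := exists_bound θ
  refine hg.bdd_mul (c := Real.exp M) θ.continuous.rexp.aestronglyMeasurable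
    (ae_of_all _ fun x => ?_)
  rw [Real.norm_of_nonneg (Real.exp_pos _).le]
  exact Real.exp_le_exp.2 ((le_abs_self _).trans (hM x))

section Statistics

variable [NullSingletonClass (volume : Measure (Point d))]

lemma IsPoissonMeasure.integral_expPairing_mul_sum (hz : 0 < z) (hπ : IsPoissonMeasure z π)
    (θ : C_c(Point d, ℝ)) {g : Point d → ℝ} (hg : Measurable g) (hgint : Integrable g) :
    Integrable (fun γ => expPairing θ γ * ∫ x, g x ∂pointKernel d γ) π ∧
      ∫ γ, expPairing θ γ * ∫ x, g x ∂pointKernel d γ ∂π =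
        z * (∫ x, Real.exp (θ x) * g x) * ∫ γ, expPairing θ γ ∂π := by
  have := hπ.isProbabilityMeasure
  have h := integral_mul_integral_kernel (η := pointKernel d) (ν := intensity d z)
    measurable_add (hπ.compProd_pointKernel hz)
    (measurable_expPairing θ) (expPairing_pos θ) (hπ.integrable_expPairing θ)
    (w := fun x => Real.exp (θ x))
    (fun γ => by
      filter_upwards [ae_notMem_points γ] with x hx
      exact expPairing_add θ hx)
    θ.continuous.rexp.measurable hg (integrable_intensity (integrable_exp_mul hgint θ))
  refine ⟨h.1, ?_⟩
  rw [h.2.1, integral_intensity hz]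

lemma IsPoissonMeasure.integral_expPairing_mul_pairSum (hz : 0 < z) (hπ : IsPoissonMeasure z π)
    (θ : C_c(Point d, ℝ)) {g : Point d × Point d → ℝ} (hg : Measurable g)
    (hgint : Integrable g (volume.prod volume)) :
    Integrable (fun γ => expPairing θ γ * ∫ p, g p ∂pairKernel d γ) π ∧
      ∫ γ, expPairing θ γ * ∫ p, g p ∂pairKernel d γ ∂π =
        z ^ 2 * (∫ p, Real.exp (θ p.1 + θ p.2) * g p ∂(volume.prod volume)) *
          ∫ γ, expPairing θ γ ∂π ∧
      ∀ᵐ γ ∂π, Integrable g (pairKernel d γ) := by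
  have := hπ.isProbabilityMeasure
  have hprod : (intensity d z).prod (intensity d z) =
      (ENNReal.ofReal z * ENNReal.ofReal z) • (volume.prod volume) := by
    rw [intensity, Measure.prod_smul_left, Measure.prod_smul_right, smul_smul]
  obtain ⟨M, -, hM⟩ := exists_bound θ
  have hcont : Continuous fun p : Point d × Point d => Real.exp (θ p.1 + θ p.2) := by fun_prop
  have hint : Integrable (fun p => Real.exp (θ p.1 + θ p.2) * g p) (volume.prod volume) := by
    refine hgint.bdd_mul (c := Real.exp (M + M)) hcont.aestronglyMeasurable
      (ae_of_all _ fun p => ?_)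
    rw [Real.norm_of_nonneg (Real.exp_pos _).le]
    exact Real.exp_le_exp.2
      (add_le_add ((le_abs_self _).trans (hM _)) ((le_abs_self _).trans (hM _)))
  have h := integral_mul_integral_kernel (η := pairKernel d)
    (ν := (intensity d z).prod (intensity d z)) (T := fun p => (p.1.add p.2.1).add p.2.2)
    measurable_add_add (hπ.compProd_pairKernel hz)
    (measurable_expPairing θ) (expPairing_pos θ) (hπ.integrable_expPairing θ)
    (w := fun p => Real.exp (θ p.1 + θ p.2))
    (fun γ => by
      have h1 : ∀ᵐ p ∂(intensity d z).prod (intensity d z), p.1 ∉ γ.points :=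
        Measure.quasiMeasurePreserving_fst.ae (ae_notMem_points γ)
      have h2 : ∀ᵐ p ∂(intensity d z).prod (intensity d z), p.2 ∉ γ.points :=
        Measure.quasiMeasurePreserving_snd.ae (ae_notMem_points γ)
      have h3 : ∀ᵐ p ∂(intensity d z).prod (intensity d z), p.1 ≠ p.2 :=
        -- The added points are new and distinct almost everywhere, so each multiplies the
        -- exponential by its own factor.
        (Measure.ae_prod_iff_ae_ae measurableSet_ne).2 (ae_of_all _ fun x => by
          filter_upwards [ae_ne x] with y hy using hy.symm)
      filter_upwards [h1, h2, h3] with p hp1 hp2 hp3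
      rw [expPairing_add, expPairing_add θ hp1, Real.exp_add, mul_assoc]
      rw [mem_add]
      rintro (h | h)
      exacts [hp2 h, hp3 h.symm])
    hcont.measurable hg (by
      rw [hprod]
      exact hint.smul_measure (ENNReal.mul_ne_top ENNReal.ofReal_ne_top ENNReal.ofReal_ne_top))
  refine ⟨h.1, ?_, h.2.2⟩
  rw [h.2.1, hprod, integral_smul_measure, ENNReal.toReal_mul, ENNReal.toReal_ofReal hz.le,
    smul_eq_mul, sq]

end Statistics

section Laplace

lemma hasCompactSupport_exp_sub_one (φ : C_c(Point d, ℝ)) :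
    HasCompactSupport fun x => Real.exp (φ x) - 1 :=
  φ.hasCompactSupport.comp_left (g := fun t => Real.exp t - 1) (by simp)

lemma integrable_exp_sub_one (φ : C_c(Point d, ℝ)) :
    Integrable fun x => Real.exp (φ x) - 1 :=
  Continuous.integrable_of_hasCompactSupport (by fun_prop) (hasCompactSupport_exp_sub_one φ)

lemma integrable_coe (φ : C_c(Point d, ℝ)) : Integrable fun x => φ x :=
  φ.continuous.integrable_of_hasCompactSupport φ.hasCompactSupport

lemma hasDerivAt_integral_exp_sub_one (φ : C_c(Point d, ℝ)) (t : ℝ) :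
    HasDerivAt (fun t => ∫ x, (Real.exp (t * φ x) - 1)) (∫ x, Real.exp (t * φ x) * φ x) t := by
  obtain ⟨M, hM0, hM⟩ := exists_bound φ
  refine (hasDerivAt_integral_of_dominated_loc_of_deriv_le (Metric.ball_mem_nhds t one_pos)
    (F := fun t x => Real.exp (t * φ x) - 1) (F' := fun t x => Real.exp (t * φ x) * φ x)
    (bound := fun x => Real.exp ((|t| + 1) * M) * |φ x|)
    (Eventually.of_forall fun s => (Continuous.aestronglyMeasurable (by fun_prop)))
    (by simpa using integrable_exp_sub_one (t • φ))
    (Continuous.aestronglyMeasurable (by fun_prop))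
    (ae_of_all _ fun x s hs => ?_) ((integrable_coe φ).abs.const_mul _)
    (ae_of_all _ fun x s _ => ?_)).2
  · rw [norm_mul, Real.norm_of_nonneg (Real.exp_pos _).le, Real.norm_eq_abs]
    refine mul_le_mul_of_nonneg_right (Real.exp_le_exp.2 ?_) (abs_nonneg _)
    have h1 : |s| ≤ |t| + 1 := by
      have h2 : |s - t| < 1 := hs
      have h3 : |s| ≤ |s - t| + |t| := by simpa using abs_add_le (s - t) t
      linarith
    calc s * φ x ≤ |s * φ x| := le_abs_self _
      _ = |s| * |φ x| := abs_mul _ _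
      _ ≤ _ := by gcongr; exact hM x
  · have := (((hasDerivAt_id s).mul_const (φ x)).exp).sub_const 1
    simpa using this

/-- The Laplace functional of a Poisson measure. -/
theorem IsPoissonMeasure.integral_expPairing [NullSingletonClass (volume : Measure (Point d))]
    (hz : 0 < z) (hπ : IsPoissonMeasure z π) (φ : C_c(Point d, ℝ)) :
    ∫ γ, expPairing φ γ ∂π = Real.exp (z * ∫ x, (Real.exp (φ x) - 1)) := by
  have := hπ.isProbabilityMeasure
  let X : Config d → ℝ := fun γ => γ.pairing φ
  have hexp : ∀ t γ, Real.exp (t * X γ) = expPairing (t • φ) γ := fun t γ => by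
    rw [expPairing, pairing_smul]
  have hset : integrableExpSet X π = Set.univ := by
    refine Set.eq_univ_of_forall fun t => ?_
    change Integrable _ _
    simp_rw [hexp]
    exact hπ.integrable_expPairing _
  -- The Mecke formula applied to ∫ ⟨φ,γ⟩ exp(t⟨φ,γ⟩) dπ gives a linear differential equation for
  -- the moment generating function.
  have hmgf : ∀ t, HasDerivAt (mgf X π) (z * (∫ x, Real.exp (t * φ x) * φ x) * mgf X π t) t := by
    intro t
    have h1 := hasDerivAt_mgf (X := X) (μ := π) (t := t) (by simp [hset])
    convert h1 using 1
    have h2 := (hπ.integral_expPairing_mul_sum hz (t • φ) (g := fun x => φ x)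
      φ.continuous.measurable
      (integrable_coe φ)).2
    simp only [CompactlySupportedContinuousMap.smul_apply, smul_eq_mul] at h2
    rw [mgf]
    simp_rw [hexp]
    rw [← h2]
    refine integral_congr_ae (ae_of_all _ fun γ => ?_)
    simp only [X]
    rw [pairing_eq_integral, mul_comm]
  -- The quotient by the expected solution has zero derivative; its values at 0 and 1 are compared.
  let G : ℝ → ℝ := fun t => mgf X π t * Real.exp (-(z * ∫ x, (Real.exp (t * φ x) - 1)))
  have hG : ∀ t, HasDerivAt G 0 t := by
    intro t
    have h := (hmgf t).mul (((hasDerivAt_integral_exp_sub_one φ t).const_mul z).neg.exp)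
    refine HasDerivAt.congr_deriv (f := G) h ?_
    simp only [Pi.neg_apply]
    ring
  have hconst := is_const_of_deriv_eq_zero (fun t => (hG t).differentiableAt)
    (fun t => (hG t).deriv) 1 0
  simp only [G, mgf, one_mul, zero_mul, Real.exp_zero, sub_self, integral_zero, mul_zero,
    neg_zero, mul_one, integral_const, probReal_univ, smul_eq_mul] at hconst
  rw [Real.exp_neg, mul_inv_eq_one₀ (Real.exp_pos _).ne'] at hconst
  exact hconst

end Laplace

end BirthDeath

/-! ### Second moments of shot noise and exponentially tilted Poisson measures. -/

namespace BirthDeath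

open Config

variable {d : ℕ} {z : ℝ} {π : Measure (Config d)}

lemma lintegral_pointKernel_add_le (γ : Config d) (x : Point d) (f : Point d → ℝ≥0∞) :
    ∫⁻ y, f y ∂pointKernel d (γ.add x) ≤ ∫⁻ y, f y ∂pointKernel d γ + f x := by
  by_cases hx : x ∈ γ.points
  · rw [add_of_mem hx]
    exact le_self_add
  · rw [lintegral_pointKernel_add hx]

lemma lintegral_comp_sub (f : Point d → ℝ≥0∞) (x : Point d) :
    ∫⁻ y, f (y - x) = ∫⁻ y, f y := lintegral_sub_right_eq_self f x

section SecondMoment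

/-- The sum `∑_{y ∈ γ} β (y - x)`. -/
noncomputable def shotNoise (β : Point d → ℝ≥0∞) (x : Point d) (γ : Config d) : ℝ≥0∞ :=
  ∫⁻ y, β (y - x) ∂pointKernel d γ

/-- The sum `∑_{x ∈ γ} f x ∑_{y ∈ γ} β (y - x)`. -/
noncomputable def weightedShotNoise (f β : Point d → ℝ≥0∞) (γ : Config d) : ℝ≥0∞ :=
  ∫⁻ x, f x * shotNoise β x γ ∂pointKernel d γ

variable {β f : Point d → ℝ≥0∞}

lemma measurable_shotNoise_uncurry (hβ : Measurable β) :
    Measurable fun q : Config d × Point d => shotNoise β q.2 q.1 := by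
  have h : Measurable (Function.uncurry fun (q : Config d × Point d) (y : Point d) =>
      β (y - q.2)) := hβ.comp (by fun_prop)
  have := Measurable.lintegral_kernel_prod_right
    (κ := (pointKernel d).comap (Prod.fst : Config d × Point d → Config d) measurable_fst) h
  exact this

lemma measurable_shotNoise (hβ : Measurable β) (x : Point d) : Measurable (shotNoise β x) :=
  Measurable.of_uncurry_right (f := fun (γ : Config d) (x : Point d) => shotNoise β x γ)
    (measurable_shotNoise_uncurry hβ)

lemma measurable_mul_shotNoise (hf : Measurable f) (hβ : Measurable β) (γ : Config d) :
    Measurable fun y => f y * shotNoise β y γ :=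
  hf.mul (Measurable.of_uncurry_left (f := fun (γ : Config d) (x : Point d) => shotNoise β x γ)
    (measurable_shotNoise_uncurry hβ))

lemma measurable_weightedShotNoise (hf : Measurable f) (hβ : Measurable β) :
    Measurable (weightedShotNoise f β : Config d → ℝ≥0∞) := by
  have h : Measurable (Function.uncurry fun (γ : Config d) (x : Point d) =>
      f x * shotNoise β x γ) :=
    (hf.comp measurable_snd).mul (measurable_shotNoise_uncurry hβ)
  exact Measurable.lintegral_kernel_prod_right h

lemma shotNoise_add_le (γ : Config d) (x y : Point d) :
    shotNoise β x (γ.add y) ≤ shotNoise β x γ + β (y - x) :=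
  lintegral_pointKernel_add_le γ y _

/-- With β(0) = 0 a point does not contribute to the noise measured at itself. No bound on b at the
single point 0 is then needed. -/
lemma shotNoise_add_self_le (h0 : β 0 = 0) (γ : Config d) (x : Point d) :
    shotNoise β x (γ.add x) ≤ shotNoise β x γ := by
  simpa [h0] using shotNoise_add_le (β := β) γ x x

/-- The new point enters the double sum once as first and once as second index; by evenness of β and
f ≤ 1 each contribution is at most the shot noise at x. -/
lemma weightedShotNoise_add_le (hf : Measurable f) (hβ : Measurable β) (h0 : β 0 = 0)
    (heven : ∀ x, β (-x) = β x) (hf1 : ∀ x, f x ≤ 1) (γ : Config d) (x : Point d) :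
    weightedShotNoise f β (γ.add x) ≤ weightedShotNoise f β γ + 2 * shotNoise β x γ := by
  have hm := measurable_mul_shotNoise hf hβ γ
  calc weightedShotNoise f β (γ.add x)
      ≤ ∫⁻ y, f y * shotNoise β y (γ.add x) ∂pointKernel d γ + f x * shotNoise β x (γ.add x) :=
        lintegral_pointKernel_add_le γ x _
    _ ≤ ∫⁻ y, (f y * shotNoise β y γ + β (y - x)) ∂pointKernel d γ + shotNoise β x γ := by
        refine add_le_add (lintegral_mono fun y => ?_) ?_
        · calc f y * shotNoise β y (γ.add x) ≤ f y * (shotNoise β y γ + β (x - y)) := by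
                gcongr
                exact shotNoise_add_le γ y x
            _ ≤ f y * shotNoise β y γ + β (y - x) := by
                rw [mul_add, ← heven (x - y), neg_sub]
                gcongr _ + ?_
                exact mul_le_of_le_one_left' (hf1 y)
        · exact (mul_le_of_le_one_left' (hf1 x)).trans (shotNoise_add_self_le h0 γ x)
    _ = _ := by
        rw [lintegral_add_left hm, add_assoc, ← weightedShotNoise, two_mul]
        rfl

/-- A shot noise with a bounded integrable response function has a finite second moment, under a
measure that satisfies a Mecke type inequality. -/
theorem lintegral_weightedShotNoise_sq_lt_top {μ : Measure (Config d)} [IsFiniteMeasure μ]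
    {C M : ℝ≥0∞} (hC : C ≠ ∞) (hM : M ≠ ∞)
    (hμ : ∀ g : Config d × Point d → ℝ≥0∞, Measurable g →
      ∫⁻ γ, ∫⁻ x, g (γ, x) ∂pointKernel d γ ∂μ ≤ C * ∫⁻ x, ∫⁻ γ, g (γ.add x, x) ∂μ)
    (hf : Measurable f) (hβ : Measurable β) (h0 : β 0 = 0) (heven : ∀ x, β (-x) = β x)
    (hβint : ∫⁻ x, β x ≠ ∞) (hβM : ∀ᵐ x, β x ≤ M) (hf1 : ∀ x, f x ≤ 1) (hfint : ∫⁻ x, f x ≠ ∞) :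
    ∫⁻ γ, weightedShotNoise f β γ ^ 2 ∂μ < ∞ := by
  set m := μ Set.univ
  have hm : m ≠ ∞ := measure_ne_top μ _
  have hT := measurable_shotNoise_uncurry (d := d) hβ
  have hTx := fun x => measurable_shotNoise (d := d) hβ x
  have hTT : ∀ x y, Measurable fun γ : Config d => shotNoise β x γ * shotNoise β y γ :=
    fun x y => (hTx x).mul (hTx y)
  have hR := measurable_weightedShotNoise (d := d) hf hβ
  have hsub : ∀ x, Measurable fun y => β (y - x) := fun x => hβ.comp (by fun_prop)
  -- Write T_x for the shot noise and R for the weighted one. The constants bound the integrals of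
  -- T_x, T_x T_y and T_x R uniformly in x and y. In each step the Mecke inequality opens one sum,
  -- and the effect of the added point on the other factor is expressed by the preceding bounds.
  let e₁ := C * ((∫⁻ x, β x) * m)
  have he₁ : ∀ x, ∫⁻ γ, shotNoise β x γ ∂μ ≤ e₁ := by
    intro x
    refine (hμ (fun q => β (q.2 - x)) ((hsub x).comp measurable_snd)).trans ?_
    simp only [lintegral_const]
    rw [lintegral_mul_const _ (hsub x), lintegral_comp_sub]
  let e₂ := C * ((∫⁻ x, β x) * (e₁ + M * m))
  have he₂ : ∀ x y, ∫⁻ γ, shotNoise β x γ * shotNoise β y γ ∂μ ≤ e₂ := by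
    intro x y
    have h1 : ∀ γ : Config d, shotNoise β x γ * shotNoise β y γ =
        ∫⁻ w, β (w - x) * shotNoise β y γ ∂pointKernel d γ := fun γ => by
      rw [lintegral_mul_const _ (hsub x)]
      rfl
    simp_rw [h1]
    refine (hμ (fun q => β (q.2 - x) * shotNoise β y q.1) (((hsub x).comp measurable_snd).mul
      ((hTx y).comp measurable_fst))).trans (mul_le_mul_right ?_ C)
    calc ∫⁻ w, ∫⁻ γ, β (w - x) * shotNoise β y (γ.add w) ∂μ
        ≤ ∫⁻ w, β (w - x) * (e₁ + M * m) := by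
          -- The essential bound on β is used here only: when the added point w enters both sums the
          -- product β(w−x)β(w−y) appears, and one factor must be bounded.
          have hM' : ∀ᵐ w : Point d, β (w - y) ≤ M :=
            (measurePreserving_sub_right volume y).quasiMeasurePreserving.ae hβM
          refine lintegral_mono_ae ?_
          filter_upwards [hM'] with w hw
          calc ∫⁻ γ, β (w - x) * shotNoise β y (γ.add w) ∂μ
              ≤ ∫⁻ γ, β (w - x) * (shotNoise β y γ + M) ∂μ := by
                refine lintegral_mono fun γ => ?_
                gcongr
                exact (shotNoise_add_le γ y w).trans (by gcongr)
            _ = β (w - x) * (∫⁻ γ, shotNoise β y γ ∂μ + M * m) := by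
                rw [lintegral_const_mul _ ((hTx y).add_const M), lintegral_add_left (hTx y),
                  lintegral_const]
            _ ≤ _ := by
                gcongr
                exact he₁ y
      _ = _ := by rw [lintegral_mul_const _ (hsub x), lintegral_comp_sub]
  let e₃ := C * ((∫⁻ x, f x) * e₂ + (∫⁻ x, β x) * e₁)
  have he₃ : ∀ x, ∫⁻ γ, shotNoise β x γ * weightedShotNoise f β γ ∂μ ≤ e₃ := by
    intro x
    have h1 : ∀ γ : Config d, shotNoise β x γ * weightedShotNoise f β γ =
        ∫⁻ y, shotNoise β x γ * (f y * shotNoise β y γ) ∂pointKernel d γ := fun γ => by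
      rw [lintegral_const_mul _ (measurable_mul_shotNoise hf hβ γ)]
      rfl
    simp_rw [h1]
    refine (hμ (fun q => shotNoise β x q.1 * (f q.2 * shotNoise β q.2 q.1))
      (((hTx x).comp measurable_fst).mul ((hf.comp measurable_snd).mul hT))).trans
        (mul_le_mul_right ?_ C)
    calc ∫⁻ y, ∫⁻ γ, shotNoise β x (γ.add y) * (f y * shotNoise β y (γ.add y)) ∂μ
        ≤ ∫⁻ y, (f y * e₂ + β (y - x) * e₁) := by
          refine lintegral_mono fun y => ?_
          calc ∫⁻ γ, shotNoise β x (γ.add y) * (f y * shotNoise β y (γ.add y)) ∂μ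
              ≤ ∫⁻ γ, (f y * (shotNoise β x γ * shotNoise β y γ)
                  + β (y - x) * shotNoise β y γ) ∂μ := by
                refine lintegral_mono fun γ => ?_
                calc shotNoise β x (γ.add y) * (f y * shotNoise β y (γ.add y))
                    ≤ (shotNoise β x γ + β (y - x)) * (f y * shotNoise β y γ) := by
                      gcongr
                      · exact shotNoise_add_le γ x y
                      · exact shotNoise_add_self_le h0 γ y
                  _ = f y * (shotNoise β x γ * shotNoise β y γ)
                        + f y * (β (y - x) * shotNoise β y γ) := by ring
                  _ ≤ _ := by
                      gcongr _ + ?_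
                      exact mul_le_of_le_one_left' (hf1 y)
            _ = f y * ∫⁻ γ, shotNoise β x γ * shotNoise β y γ ∂μ
                  + β (y - x) * ∫⁻ γ, shotNoise β y γ ∂μ := by
                rw [lintegral_add_left ((hTT x y).const_mul _),
                  lintegral_const_mul _ (hTT x y), lintegral_const_mul _ (hTx y)]
            _ ≤ _ := by
                gcongr
                · exact he₂ x y
                · exact he₁ y
      _ = _ := by
          rw [lintegral_add_left (hf.mul_const _), lintegral_mul_const _ hf,
            lintegral_mul_const _ (hsub x), lintegral_comp_sub]
  have he₄ : ∫⁻ γ, weightedShotNoise f β γ ^ 2 ∂μ ≤ C * ((∫⁻ x, f x) * (e₃ + 2 * e₂)) := by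
    have h1 : ∀ γ : Config d, weightedShotNoise f β γ ^ 2 =
        ∫⁻ x, f x * (shotNoise β x γ * weightedShotNoise f β γ) ∂pointKernel d γ := fun γ => by
      simp_rw [← mul_assoc]
      rw [lintegral_mul_const _ (measurable_mul_shotNoise hf hβ γ), sq]
      rfl
    simp_rw [h1]
    refine (hμ (fun q => f q.2 * (shotNoise β q.2 q.1 * weightedShotNoise f β q.1))
      ((hf.comp measurable_snd).mul (hT.mul (hR.comp measurable_fst)))).trans
        (mul_le_mul_right ?_ C)
    rw [← lintegral_mul_const _ hf]
    refine lintegral_mono fun x => ?_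
    calc ∫⁻ γ, f x * (shotNoise β x (γ.add x) * weightedShotNoise f β (γ.add x)) ∂μ
        ≤ ∫⁻ γ, f x * (shotNoise β x γ * weightedShotNoise f β γ
            + 2 * (shotNoise β x γ * shotNoise β x γ)) ∂μ := by
          refine lintegral_mono fun γ => ?_
          calc f x * (shotNoise β x (γ.add x) * weightedShotNoise f β (γ.add x))
              ≤ f x * (shotNoise β x γ * (weightedShotNoise f β γ + 2 * shotNoise β x γ)) := by
                gcongr
                · exact shotNoise_add_self_le h0 γ x
                · exact weightedShotNoise_add_le hf hβ h0 heven hf1 γ x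
            _ = _ := by ring
      _ = f x * (∫⁻ γ, shotNoise β x γ * weightedShotNoise f β γ ∂μ
            + 2 * ∫⁻ γ, shotNoise β x γ * shotNoise β x γ ∂μ) := by
          have hTR : Measurable fun γ : Config d => shotNoise β x γ * weightedShotNoise f β γ :=
            (hTx x).mul hR
          have hsum : Measurable fun γ : Config d => shotNoise β x γ * weightedShotNoise f β γ
            + 2 * (shotNoise β x γ * shotNoise β x γ) := hTR.add ((hTT x x).const_mul 2)
          rw [lintegral_const_mul _ hsum, lintegral_add_left hTR, lintegral_const_mul _ (hTT x x)]
      _ ≤ _ := by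
          gcongr
          · exact he₃ x
          · exact he₂ x x
  refine he₄.trans_lt ?_
  have hadd : ∀ {u v : ℝ≥0∞}, u ≠ ∞ → v ≠ ∞ → u + v ≠ ∞ := fun hu hv => ENNReal.add_ne_top.2 ⟨hu, hv⟩
  have f₁ : e₁ ≠ ∞ := ENNReal.mul_ne_top hC (ENNReal.mul_ne_top hβint hm)
  have f₂ : e₂ ≠ ∞ := ENNReal.mul_ne_top hC
    (ENNReal.mul_ne_top hβint (hadd f₁ (ENNReal.mul_ne_top hM hm)))
  have f₃ : e₃ ≠ ∞ := ENNReal.mul_ne_top hC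
    (hadd (ENNReal.mul_ne_top hfint f₂) (ENNReal.mul_ne_top hβint f₁))
  exact (ENNReal.mul_ne_top hC (ENNReal.mul_ne_top hfint
    (hadd f₃ (ENNReal.mul_ne_top ENNReal.ofNat_ne_top f₂)))).lt_top

end SecondMoment

/-- The tilted measure `exp ⟨θ, γ⟩ π(dγ)`. -/
noncomputable def tilted (π : Measure (Config d)) (θ : C_c(Point d, ℝ)) : Measure (Config d) :=
  π.withDensity fun γ => ENNReal.ofReal (expPairing θ γ)

lemma measurable_ofReal_expPairing (θ : C_c(Point d, ℝ)) :
    Measurable fun γ => ENNReal.ofReal (expPairing θ γ) := (measurable_expPairing θ).ennreal_ofReal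

lemma lintegral_tilted (θ : C_c(Point d, ℝ)) {f : Config d → ℝ≥0∞} (hf : Measurable f) :
    ∫⁻ γ, f γ ∂tilted π θ = ∫⁻ γ, ENNReal.ofReal (expPairing θ γ) * f γ ∂π := by
  rw [tilted, lintegral_withDensity_eq_lintegral_mul _ (measurable_ofReal_expPairing θ) hf]
  rfl

lemma IsPoissonMeasure.isFiniteMeasure_tilted (hπ : IsPoissonMeasure z π) (θ : C_c(Point d, ℝ)) :
    IsFiniteMeasure (tilted π θ) :=
  isFiniteMeasure_withDensity_ofReal (hπ.integrable_expPairing θ).2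

/-- Adding a point multiplies the density of the tilted measure by at most e^M, where M bounds |θ|,
so the Mecke formula survives as an inequality with constant z e^M. -/
lemma IsPoissonMeasure.lintegral_tilted_le [NullSingletonClass (volume : Measure (Point d))]
    (hz : 0 < z) (hπ : IsPoissonMeasure z π) (θ : C_c(Point d, ℝ)) :
    ∃ C : ℝ≥0∞, C ≠ ∞ ∧ ∀ g : Config d × Point d → ℝ≥0∞, Measurable g →
      ∫⁻ γ, ∫⁻ x, g (γ, x) ∂pointKernel d γ ∂tilted π θ ≤
        C * ∫⁻ x, ∫⁻ γ : Config d, g (γ.add x, x) ∂tilted π θ := by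
  have := hπ.isProbabilityMeasure
  obtain ⟨M, -, hM⟩ := exists_bound θ
  refine ⟨ENNReal.ofReal z * ENNReal.ofReal (Real.exp M),
    ENNReal.mul_ne_top ENNReal.ofReal_ne_top ENNReal.ofReal_ne_top, fun g hg => ?_⟩
  have hg1 : ∀ γ, Measurable fun x => g (γ, x) := fun γ => hg.comp measurable_prodMk_left
  have hW := measurable_ofReal_expPairing θ
  have hgadd : Measurable fun q : Config d × Point d => g (q.1.add q.2, q.2) :=
    hg.comp (measurable_add.prodMk measurable_snd)
  have hgadd1 : ∀ x, Measurable fun γ : Config d => g (γ.add x, x) := fun x =>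
    hgadd.comp measurable_prodMk_right
  rw [lintegral_tilted θ (f := fun γ => ∫⁻ x, g (γ, x) ∂pointKernel d γ)
    (Measurable.lintegral_kernel_prod_right (f := fun γ x => g (γ, x)) hg)]
  simp_rw [fun γ => (lintegral_const_mul (ENNReal.ofReal (expPairing θ γ)) (hg1 γ)
    (μ := pointKernel d γ)).symm, fun x => lintegral_tilted (π := π) θ (hgadd1 x)]
  rw [hπ.lintegral_pointKernel hz (f := fun q => ENNReal.ofReal (expPairing θ q.1) * g q)
    ((hW.comp measurable_fst).mul hg), lintegral_intensity, mul_assoc]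
  refine mul_le_mul_right ?_ _
  have hprod : Measurable fun q : Config d × Point d =>
    ENNReal.ofReal (expPairing θ q.1) * g (q.1.add q.2, q.2) := (hW.comp measurable_fst).mul hgadd
  rw [← lintegral_const_mul _ hprod.lintegral_prod_left']
  refine lintegral_mono fun x => ?_
  have hWg : Measurable fun γ : Config d => ENNReal.ofReal (expPairing θ γ) * g (γ.add x, x) :=
    hW.mul (hgadd1 x)
  rw [← lintegral_const_mul _ hWg]
  refine lintegral_mono fun γ => ?_
  simp only
  rw [← mul_assoc, ← ENNReal.ofReal_mul (Real.exp_pos _).le]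
  refine mul_le_mul_left (ENNReal.ofReal_le_ofReal ?_) _
  -- If x already lies in γ, adding it changes nothing, and 1 ≤ e^M suffices.
  by_cases hx : x ∈ γ.points
  · rw [add_of_mem hx]
    exact le_mul_of_one_le_left (expPairing_pos _ _).le
      (Real.one_le_exp ((abs_nonneg _).trans (hM x)))
  · rw [expPairing_add θ hx, mul_comm]
    gcongr
    · exact (expPairing_pos _ _).le
    · exact (le_abs_self _).trans (hM x)

end BirthDeath

/-! ### The operator on exponentials and its linearity. -/

namespace BirthDeath

open Config

variable {d : ℕ} {z : ℝ} {π : Measure (Config d)} {a b : Point d → ℝ≥0∞}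

/-- The assumptions on the function `b`. -/
structure IsPairRate (b : Point d → ℝ≥0∞) : Prop where
  measurable : Measurable b
  even : ∀ x, b (-x) = b x
  integrable : ∫⁻ x, b x < ∞
  bounded : essSup b volume < ∞

/-- The function `b (y - x) (exp (φ x + φ y) - 1)` of the pair `(x, y)`. -/
noncomputable def pairJump (b : Point d → ℝ≥0∞) (φ : C_c(Point d, ℝ)) (p : Point d × Point d) : ℝ :=
  (b (p.2 - p.1)).toReal * (Real.exp (φ p.1 + φ p.2) - 1)

namespace IsPairRate

lemma measurable_toReal (hb : IsPairRate b) : Measurable fun p : Point d × Point d =>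
    (b (p.2 - p.1)).toReal :=
  (hb.measurable.comp (measurable_snd.sub measurable_fst)).ennreal_toReal

lemma measurable_pairJump (hb : IsPairRate b) (φ : C_c(Point d, ℝ)) :
    Measurable (pairJump b φ) := by
  have : Continuous fun p : Point d × Point d => Real.exp (φ p.1 + φ p.2) - 1 := by fun_prop
  exact hb.measurable_toReal.mul this.measurable

lemma integrable_toReal (hb : IsPairRate b) : Integrable fun x => (b x).toReal :=
  integrable_toReal_of_lintegral_ne_top hb.measurable.aemeasurable hb.integrable.ne

lemma integrable_toReal_mul_fst (hb : IsPairRate b) {f : Point d → ℝ} (hf : Integrable f) :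
    Integrable (fun p : Point d × Point d => (b (p.2 - p.1)).toReal * f p.1)
      (volume.prod volume) := by
  have h1 : Integrable (fun p : Point d × Point d => f p.1 * (b p.2).toReal)
      (volume.prod volume) := hf.mul_prod hb.integrable_toReal
  have h2 := (measurePreserving_prod_neg_add (volume : Measure (Point d)) volume).integrable_comp_of_integrable
    h1
  refine h2.congr (ae_of_all _ fun p => ?_)
  simp only [Function.comp_apply]
  rw [mul_comm, neg_add_eq_sub]

lemma integrable_toReal_mul_snd (hb : IsPairRate b) {f : Point d → ℝ} (hf : Integrable f) :
    Integrable (fun p : Point d × Point d => (b (p.2 - p.1)).toReal * f p.2)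
      (volume.prod volume) := by
  refine (hb.integrable_toReal_mul_fst hf).swap.congr (ae_of_all _ fun p => ?_)
  simp only [Function.comp_apply, Prod.fst_swap, Prod.snd_swap]
  rw [← hb.even, neg_sub]

end IsPairRate

/-- The factor exp(φ(x)+φ(y)) − 1 is bounded and vanishes unless x or y lies in the support of φ.
This gives one finite point to integrate over, the other being controlled by ∫ b. -/
lemma abs_pairJump_le (φ : C_c(Point d, ℝ)) : ∃ C : ℝ, 0 ≤ C ∧ ∀ p : Point d × Point d,
    |pairJump b φ p| ≤ C * ((b (p.2 - p.1)).toReal * (tsupport φ).indicator (fun _ => 1) p.1 +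
      (b (p.2 - p.1)).toReal * (tsupport φ).indicator (fun _ => 1) p.2) := by
  obtain ⟨M, hM0, hM⟩ := exists_bound φ
  refine ⟨Real.exp (M + M) + 1, by positivity, fun p => ?_⟩
  have hβ : 0 ≤ (b (p.2 - p.1)).toReal := ENNReal.toReal_nonneg
  rw [pairJump, abs_mul, abs_of_nonneg hβ, ← mul_add, mul_left_comm]
  refine mul_le_mul_of_nonneg_left ?_ hβ
  have hbd : |Real.exp (φ p.1 + φ p.2) - 1| ≤ Real.exp (M + M) + 1 := by
    have h1 : Real.exp (φ p.1 + φ p.2) ≤ Real.exp (M + M) := Real.exp_le_exp.2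
      (add_le_add ((le_abs_self _).trans (hM _)) ((le_abs_self _).trans (hM _)))
    rw [abs_le]
    constructor <;> linarith [Real.exp_pos (φ p.1 + φ p.2), Real.exp_pos (M + M)]
  have hC : 0 ≤ Real.exp (M + M) + 1 := by positivity
  by_cases h1 : p.1 ∈ tsupport φ <;> by_cases h2 : p.2 ∈ tsupport φ
  · simp only [h1, h2, Set.indicator_of_mem]
    linarith
  · simp only [h1, h2, Set.indicator_of_mem, Set.indicator_of_notMem, not_false_eq_true]
    linarith
  · simp only [h1, h2, Set.indicator_of_mem, Set.indicator_of_notMem, not_false_eq_true]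
    linarith
  · rw [image_eq_zero_of_notMem_tsupport h1, image_eq_zero_of_notMem_tsupport h2]
    simp [h1, h2]

lemma integrable_indicator_tsupport (φ : C_c(Point d, ℝ)) :
    Integrable ((tsupport φ).indicator fun _ => (1 : ℝ)) := by
  have hc : IsCompact (tsupport φ) := φ.hasCompactSupport
  rw [integrable_indicator_iff hc.measurableSet]
  exact integrableOn_const hc.measure_lt_top.ne

lemma IsPairRate.integrable_pairJump (hb : IsPairRate b) (φ : C_c(Point d, ℝ)) :
    Integrable (pairJump b φ) (volume.prod volume) := by
  obtain ⟨C, hC, hle⟩ := abs_pairJump_le (b := b) φ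
  have h := ((hb.integrable_toReal_mul_fst (integrable_indicator_tsupport φ)).add
    (hb.integrable_toReal_mul_snd (integrable_indicator_tsupport φ))).const_mul C
  exact h.mono' (hb.measurable_pairJump φ).aestronglyMeasurable (ae_of_all _ hle)

section Operator

variable [NullSingletonClass (volume : Measure (Point d))]

lemma ae_volume_notMem_points (γ : Config d) : ∀ᵐ x, x ∉ γ.points :=
  measure_eq_zero_iff_ae_notMem.1 (γ.countable_points.measure_zero _)

lemma ae_volume_ne (y : Point d) : ∀ᵐ x, x ≠ y := by
  simpa using measure_eq_zero_iff_ae_notMem.1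
    (measure_singleton (μ := (volume : Measure (Point d))) y)

omit [NullSingletonClass (volume : Measure (Point d))] in
lemma expPairing_remove_remove_sub (φ : C_c(Point d, ℝ)) (γ : Config d)
    (p : γ.points.offDiag) :
    expPairing φ ((γ.remove p.1.1).remove p.1.2) - expPairing φ γ =
      expPairing φ γ * (Real.exp ((-φ) p.1.1 + (-φ) p.1.2) - 1) := by
  have h2 : p.1.2 ∈ (γ.remove p.1.1).points :=
    mem_remove.2 ⟨p.2.2.1, fun h => p.2.2.2 h.symm⟩
  rw [expPairing_remove φ h2, expPairing_remove φ p.2.1, CompactlySupportedContinuousMap.neg_apply,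
    CompactlySupportedContinuousMap.neg_apply, Real.exp_add]
  ring

lemma expPairing_add_add_sub_ae (φ : C_c(Point d, ℝ)) (γ : Config d) :
    ∀ᵐ x, ∀ᵐ y, expPairing φ ((γ.add x).add y) - expPairing φ γ =
      expPairing φ γ * (Real.exp (φ x + φ y) - 1) := by
  filter_upwards [ae_volume_notMem_points γ] with x hx
  filter_upwards [ae_volume_notMem_points γ, ae_volume_ne x] with y hy hyx
  have : y ∉ (γ.add x).points := fun h => (mem_add.1 h).elim hy hyx
  rw [expPairing_add φ this, expPairing_add φ hx, Real.exp_add]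
  ring

lemma expPairing_add_sub_ae (φ : C_c(Point d, ℝ)) (γ : Config d) :
    ∀ᵐ x, expPairing φ (γ.add x) - expPairing φ γ =
      expPairing φ γ * (Real.exp (φ x) - 1) := by
  filter_upwards [ae_volume_notMem_points γ] with x hx
  rw [expPairing_add φ hx]
  ring

/-- The operator `L₀` on an exponential function. -/
lemma IsPairRate.genL_expPairing (hb : IsPairRate b) (φ : C_c(Point d, ℝ)) (γ : Config d) :
    genL a b z (expPairing φ) γ = mean a ^ 2 * (
      (1 / 2) * (expPairing φ γ * ∫ p, pairJump b (-φ) p ∂pairKernel d γ)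
      + (1 / 2) * (expPairing φ γ * (z ^ 2 * ∫ p, pairJump b φ p ∂(volume.prod volume)))
      + z * mean b * (expPairing φ γ * ∫ x, (Real.exp ((-φ) x) - 1) ∂pointKernel d γ)
      + z * mean b * (expPairing φ γ * (z * ∫ x, (Real.exp (φ x) - 1)))) := by
  -- No summability is needed: if the pair series diverges, both sides take the default value 0. The
  -- formula therefore holds for every γ.
  have h1 : ∑' p : γ.points.offDiag, (b (p.1.2 - p.1.1)).toReal *
      (expPairing φ ((γ.remove p.1.1).remove p.1.2) - expPairing φ γ) =
      expPairing φ γ * ∫ p, pairJump b (-φ) p ∂pairKernel d γ := by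
    rw [pairKernel_apply, integral_pointMeasure γ.countable_offDiag, ← tsum_mul_left]
    refine tsum_congr fun p => ?_
    rw [expPairing_remove_remove_sub, pairJump]
    ring
  have h2 : ∫ x₁, z * ∫ x₂, z * ((b (x₂ - x₁)).toReal *
      (expPairing φ ((γ.add x₁).add x₂) - expPairing φ γ)) =
      expPairing φ γ * (z ^ 2 * ∫ p, pairJump b φ p ∂(volume.prod volume)) := by
    rw [integral_prod _ (hb.integrable_pairJump φ)]
    rw [← mul_assoc, ← integral_const_mul]
    refine integral_congr_ae ?_
    filter_upwards [expPairing_add_add_sub_ae φ γ] with x hx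
    rw [← integral_const_mul, ← integral_const_mul]
    refine integral_congr_ae ?_
    filter_upwards [hx] with y hy
    rw [hy, pairJump]
    ring
  have h3 : ∑' x : γ.points, (expPairing φ (γ.remove x) - expPairing φ γ) =
      expPairing φ γ * ∫ x, (Real.exp ((-φ) x) - 1) ∂pointKernel d γ := by
    rw [pointKernel_apply, integral_pointMeasure γ.countable_points, ← tsum_mul_left]
    refine tsum_congr fun x => ?_
    rw [expPairing_remove φ x.2, CompactlySupportedContinuousMap.neg_apply]
    ring
  have h4 : ∫ x, z * (expPairing φ (γ.add x) - expPairing φ γ) =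
      expPairing φ γ * (z * ∫ x, (Real.exp (φ x) - 1)) := by
    rw [← mul_assoc, ← integral_const_mul]
    refine integral_congr_ae ?_
    filter_upwards [expPairing_add_sub_ae φ γ] with x hx
    rw [hx]
    ring
  rw [genL, h1, h2, h3, h4]

end Operator

section Linearity

/-- All the series and integrals in the definition of `genL a b z F γ` converge absolutely. -/
structure GenLConverges (b : Point d → ℝ≥0∞) (F : Config d → ℝ) (γ : Config d) : Prop where
  pairs : Summable fun p : γ.points.offDiag =>
    (b (p.1.2 - p.1.1)).toReal * (F ((γ.remove p.1.1).remove p.1.2) - F γ)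
  inner : ∀ᵐ x₁, Integrable fun x₂ => (b (x₂ - x₁)).toReal * (F ((γ.add x₁).add x₂) - F γ)
  outer : Integrable fun x₁ => ∫ x₂, (b (x₂ - x₁)).toReal * (F ((γ.add x₁).add x₂) - F γ)
  points : Summable fun x : γ.points => F (γ.remove x) - F γ
  adding : Integrable fun x => F (γ.add x) - F γ

variable {F G : Config d → ℝ} {γ : Config d}

lemma genL_eq (F : Config d → ℝ) (γ : Config d) : genL a b z F γ = mean a ^ 2 *
    ((1 / 2) * (∑' p : γ.points.offDiag,
        (b (p.1.2 - p.1.1)).toReal * (F ((γ.remove p.1.1).remove p.1.2) - F γ))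
      + (1 / 2) * (z * (z * ∫ x₁, ∫ x₂, (b (x₂ - x₁)).toReal * (F ((γ.add x₁).add x₂) - F γ)))
      + z * mean b * (∑' x : γ.points, (F (γ.remove x) - F γ))
      + z * mean b * (z * ∫ x, (F (γ.add x) - F γ))) := by
  simp_rw [genL, integral_const_mul]

/-- Since divergent series and integrals default to 0, the operator is additive only where
everything converges. Scaling by a constant is compatible with the default value and needs no such
condition. -/
lemma GenLConverges.add (hF : GenLConverges b F γ) (hG : GenLConverges b G γ) :
    GenLConverges b (F + G) γ ∧
      genL a b z (F + G) γ = genL a b z F γ + genL a b z G γ := by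
  have e1 : ∀ p : Point d × Point d, (b (p.2 - p.1)).toReal *
      ((F + G) ((γ.remove p.1).remove p.2) - (F + G) γ) =
      (b (p.2 - p.1)).toReal * (F ((γ.remove p.1).remove p.2) - F γ) +
      (b (p.2 - p.1)).toReal * (G ((γ.remove p.1).remove p.2) - G γ) := fun p => by
    simp only [Pi.add_apply]; ring
  have e2 : ∀ x₁ x₂, (b (x₂ - x₁)).toReal * ((F + G) ((γ.add x₁).add x₂) - (F + G) γ) =
      (b (x₂ - x₁)).toReal * (F ((γ.add x₁).add x₂) - F γ) +
      (b (x₂ - x₁)).toReal * (G ((γ.add x₁).add x₂) - G γ) := fun x₁ x₂ => by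
    simp only [Pi.add_apply]; ring
  have e3 : ∀ x, (F + G) (γ.remove x) - (F + G) γ =
      (F (γ.remove x) - F γ) + (G (γ.remove x) - G γ) := fun x => by
    simp only [Pi.add_apply]; ring
  have e4 : ∀ x, (F + G) (γ.add x) - (F + G) γ =
      (F (γ.add x) - F γ) + (G (γ.add x) - G γ) := fun x => by
    simp only [Pi.add_apply]; ring
  have e5 : ∀ᵐ x₁, ∫ x₂, (b (x₂ - x₁)).toReal * ((F + G) ((γ.add x₁).add x₂) - (F + G) γ) =
      (∫ x₂, (b (x₂ - x₁)).toReal * (F ((γ.add x₁).add x₂) - F γ)) +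
      ∫ x₂, (b (x₂ - x₁)).toReal * (G ((γ.add x₁).add x₂) - G γ) := by
    filter_upwards [hF.inner, hG.inner] with x₁ h1 h2
    simp_rw [e2]
    exact integral_add h1 h2
  refine ⟨⟨?_, ?_, ?_, ?_, ?_⟩, ?_⟩
  · exact (hF.pairs.add hG.pairs).congr fun p => (e1 p).symm
  · filter_upwards [hF.inner, hG.inner] with x₁ h1 h2
    exact (h1.add h2).congr (ae_of_all _ fun x₂ => (e2 x₁ x₂).symm)
  · refine (hF.outer.add hG.outer).congr ?_
    filter_upwards [e5] with x₁ h
    exact h.symm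
  · exact (hF.points.add hG.points).congr fun x => (e3 x).symm
  · exact (hF.adding.add hG.adding).congr (ae_of_all _ fun x => (e4 x).symm)
  · rw [genL_eq, genL_eq, genL_eq, integral_congr_ae e5, integral_add hF.outer hG.outer]
    simp_rw [e3, e4]
    rw [tsum_congr fun p : γ.points.offDiag => e1 p, hF.pairs.tsum_add hG.pairs,
      hF.points.tsum_add hG.points, integral_add hF.adding hG.adding]
    ring

lemma GenLConverges.smul (hF : GenLConverges b F γ) (c : ℝ) : GenLConverges b (c • F) γ := by
  refine ⟨?_, ?_, ?_, ?_, ?_⟩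
  · exact (hF.pairs.mul_left c).congr fun p => by simp only [Pi.smul_apply, smul_eq_mul]; ring
  · filter_upwards [hF.inner] with x₁ h1
    exact (h1.const_mul c).congr (ae_of_all _ fun x₂ => by
      simp only [Pi.smul_apply, smul_eq_mul]; ring)
  · refine (hF.outer.const_mul c).congr (ae_of_all _ fun x₁ => ?_)
    simp only
    rw [← integral_const_mul]
    refine integral_congr_ae (ae_of_all _ fun x₂ => ?_)
    simp only [Pi.smul_apply, smul_eq_mul]
    ring
  · exact (hF.points.mul_left c).congr fun p => by simp only [Pi.smul_apply, smul_eq_mul]; ring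
  · exact (hF.adding.const_mul c).congr (ae_of_all _ fun x₂ => by
      simp only [Pi.smul_apply, smul_eq_mul]; ring)

lemma genL_smul (c : ℝ) (F : Config d → ℝ) (γ : Config d) :
    genL a b z (c • F) γ = c * genL a b z F γ := by
  have e : ∀ s u v : ℝ, s * (c * u - c * v) = c * (s * (u - v)) := fun s u v => by ring
  have e' : ∀ u v : ℝ, c * u - c * v = c * (u - v) := fun u v => by ring
  simp only [genL_eq, Pi.smul_apply, smul_eq_mul, e]
  simp only [e', tsum_mul_left, integral_const_mul]
  ring

variable [NullSingletonClass (volume : Measure (Point d))]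

lemma IsPairRate.genLConverges_expPairing (hb : IsPairRate b) (φ : C_c(Point d, ℝ)) (γ : Config d)
    (h : Integrable (pairJump b (-φ)) (pairKernel d γ)) :
    GenLConverges b (expPairing φ) γ := by
  have hi := hb.integrable_pairJump φ
  have hin : ∀ᵐ x, (fun y => (b (y - x)).toReal *
      (expPairing φ ((γ.add x).add y) - expPairing φ γ)) =ᵐ[volume]
      fun y => expPairing φ γ * pairJump b φ (x, y) := by
    filter_upwards [expPairing_add_add_sub_ae φ γ] with x hx
    filter_upwards [hx] with y hy
    rw [hy, pairJump]
    ring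
  refine ⟨?_, ?_, ?_, ?_, ?_⟩
  · rw [pairKernel_apply, integrable_pointMeasure_iff γ.countable_offDiag] at h
    refine (h.mul_left (expPairing φ γ)).congr fun p => ?_
    rw [expPairing_remove_remove_sub, pairJump]
    ring
  · filter_upwards [hi.prod_right_ae, hin] with x hx hx'
    exact (hx.const_mul _).congr hx'.symm
  · refine (hi.integral_prod_left.const_mul (expPairing φ γ)).congr ?_
    filter_upwards [hin] with x hx
    rw [integral_congr_ae hx, integral_const_mul]
  · have h1 := integrable_pointKernel_of_hasCompactSupport γ (hasCompactSupport_exp_sub_one (-φ))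
    rw [pointKernel_apply, integrable_pointMeasure_iff γ.countable_points] at h1
    refine (h1.mul_left (expPairing φ γ)).congr fun x => ?_
    rw [expPairing_remove φ x.2, CompactlySupportedContinuousMap.neg_apply]
    ring
  · refine ((integrable_exp_sub_one φ).const_mul (expPairing φ γ)).congr ?_
    filter_upwards [expPairing_add_sub_ae φ γ] with x hx using hx.symm

lemma IsPairRate.ae_genLConverges (hb : IsPairRate b) (hz : 0 < z) (hπ : IsPoissonMeasure z π)
    {F : Config d → ℝ} (hF : F ∈ expSpan d) : ∀ᵐ γ ∂π, GenLConverges b F γ := by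
  induction hF using Submodule.span_induction with
  | mem F hF =>
    obtain ⟨φ, rfl⟩ := hF
    -- Only the sum over pairs can diverge, as b need not have compact support. The pair Mecke
    -- formula with the trivial weight e_0 = 1 shows that it converges almost surely.
    filter_upwards [(hπ.integral_expPairing_mul_pairSum hz 0 (hb.measurable_pairJump (-φ))
      (hb.integrable_pairJump (-φ))).2.2] with γ hγ
    exact hb.genLConverges_expPairing φ γ hγ
  | zero =>
    refine ae_of_all _ fun γ => ⟨?_, ?_, ?_, ?_, ?_⟩ <;> simp [summable_zero]
  | add F G _ _ hF hG =>
    filter_upwards [hF, hG] with γ h1 h2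
    -- Convergence does not involve a and z; the zeros are placeholders.
    exact (h1.add (a := 0) (z := 0) h2).1
  | smul c F _ hF =>
    filter_upwards [hF] with γ h using h.smul c

lemma IsPairRate.genL_add_ae (hb : IsPairRate b) (hz : 0 < z) (hπ : IsPoissonMeasure z π)
    {F G : Config d → ℝ} (hF : F ∈ expSpan d) (hG : G ∈ expSpan d) :
    genL a b z (F + G) =ᵐ[π] genL a b z F + genL a b z G := by
  filter_upwards [hb.ae_genLConverges hz hπ hF, hb.ae_genLConverges hz hπ hG] with γ h1 h2
  exact (h1.add h2).2

end Linearity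

end BirthDeath

/-! ### Square integrability of the operator applied to exponentials. -/

namespace BirthDeath

open Config

variable {d : ℕ} {z : ℝ} {π : Measure (Config d)} {a b : Point d → ℝ≥0∞}

section SquareIntegrability

/-- The function `b` with the value at the origin replaced by `0`. -/
noncomputable def offZero (b : Point d → ℝ≥0∞) : Point d → ℝ≥0∞ :=
  ({0}ᶜ : Set (Point d)).indicator fun x => ENNReal.ofReal (b x).toReal

lemma offZero_le (b : Point d → ℝ≥0∞) (x : Point d) : offZero b x ≤ b x := by
  by_cases h : x = 0
  · simp [offZero, h]
  · simpa [offZero, h] using ENNReal.ofReal_toReal_le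

lemma lintegral_pairJump_le (hb : IsPairRate b) (φ : C_c(Point d, ℝ)) :
    ∃ C : ℝ≥0∞, C ≠ ∞ ∧ ∀ γ : Config d, ∫⁻ p, ‖pairJump b φ p‖ₑ ∂pairKernel d γ ≤
      C * weightedShotNoise ((tsupport φ).indicator 1) (offZero b) γ := by
  obtain ⟨C, hC, hle⟩ := abs_pairJump_le (b := b) φ
  have hK : MeasurableSet (tsupport φ) := (isClosed_tsupport φ).measurableSet
  have hβm : Measurable (offZero b) :=
    hb.measurable.ennreal_toReal.ennreal_ofReal.indicator (measurableSet_singleton 0).compl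
  have h1m : Measurable ((tsupport φ).indicator (1 : Point d → ℝ≥0∞)) :=
    measurable_one.indicator hK
  set k := (tsupport φ).indicator (1 : Point d → ℝ≥0∞)
  have heven : ∀ x, offZero b (-x) = offZero b x := fun x => by
    by_cases h : x = 0 <;> simp [offZero, h, hb.even]
  refine ⟨ENNReal.ofReal C * 2, ENNReal.mul_ne_top ENNReal.ofReal_ne_top (by simp), fun γ => ?_⟩
  have hpt : ∀ x y, {p : Point d × Point d | p.1 ≠ p.2}.indicator
      (fun p => ‖pairJump b φ p‖ₑ) (x, y) ≤
      ENNReal.ofReal C * (k x * offZero b (y - x) + k y * offZero b (y - x)) := by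
    intro x y
    by_cases hxy : x = y
    · simp [hxy]
    · rw [Set.indicator_of_mem (by exact hxy), Real.enorm_eq_ofReal_abs]
      refine (ENNReal.ofReal_le_ofReal (hle (x, y))).trans (le_of_eq ?_)
      rw [ENNReal.ofReal_mul hC]
      congr 1
      have hoff : offZero b (y - x) = ENNReal.ofReal (b (y - x)).toReal :=
        Set.indicator_of_mem (by simpa [sub_eq_zero] using Ne.symm hxy) _
      rw [hoff]
      have hnn : 0 ≤ (b (y - x)).toReal := ENNReal.toReal_nonneg
      by_cases h1 : x ∈ tsupport φ <;> by_cases h2 : y ∈ tsupport φ <;>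
        simp [k, h1, h2, ENNReal.ofReal_add]
  have hm1 : Measurable fun p : Point d × Point d => k p.1 * offZero b (p.2 - p.1) :=
    (h1m.comp measurable_fst).mul (hβm.comp (measurable_snd.sub measurable_fst))
  have hm2 : Measurable fun p : Point d × Point d => k p.2 * offZero b (p.2 - p.1) :=
    (h1m.comp measurable_snd).mul (hβm.comp (measurable_snd.sub measurable_fst))
  have hsub : ∀ x, Measurable fun y => offZero b (y - x) := fun x => hβm.comp (by fun_prop)
  have e1 : ∫⁻ x, ∫⁻ y, k x * offZero b (y - x) ∂pointKernel d γ ∂pointKernel d γ =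
      weightedShotNoise k (offZero b) γ := by
    refine lintegral_congr fun x => ?_
    rw [lintegral_const_mul _ (hsub x)]
    rfl
  have e2 : ∫⁻ x, ∫⁻ y, k y * offZero b (y - x) ∂pointKernel d γ ∂pointKernel d γ =
      weightedShotNoise k (offZero b) γ := by
    -- Exchanging the two sums and using evenness turns the second term into the first.
    rw [lintegral_lintegral_swap hm2.aemeasurable, ← e1]
    refine lintegral_congr fun x => lintegral_congr fun y => ?_
    rw [← heven (y - x), neg_sub]
  rw [lintegral_pairKernel γ (hb.measurable_pairJump φ).enorm]
  calc _ ≤ ∫⁻ x, ∫⁻ y, ENNReal.ofReal C * (k x * offZero b (y - x) + k y * offZero b (y - x))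
        ∂pointKernel d γ ∂pointKernel d γ :=
        lintegral_mono fun x => lintegral_mono fun y => hpt x y
    _ = ENNReal.ofReal C * ∫⁻ x, ((∫⁻ y, k x * offZero b (y - x) ∂pointKernel d γ) +
        ∫⁻ y, k y * offZero b (y - x) ∂pointKernel d γ) ∂pointKernel d γ := by
        have hsum : Measurable fun x => (∫⁻ y, k x * offZero b (y - x) ∂pointKernel d γ) +
            ∫⁻ y, k y * offZero b (y - x) ∂pointKernel d γ :=
          hm1.lintegral_prod_right'.add hm2.lintegral_prod_right'
        rw [← lintegral_const_mul _ hsum]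
        refine lintegral_congr fun x => ?_
        have hx1 : Measurable fun y => k x * offZero b (y - x) := (hsub x).const_mul _
        have hx2 : Measurable fun y => k y * offZero b (y - x) := h1m.mul (hsub x)
        have hx12 : Measurable fun y => k x * offZero b (y - x) + k y * offZero b (y - x) :=
          hx1.add hx2
        rw [lintegral_const_mul _ hx12, lintegral_add_left hx1]
    _ = _ := by
        rw [lintegral_add_left hm1.lintegral_prod_right', e1, e2]
        ring

variable [NullSingletonClass (volume : Measure (Point d))]

lemma IsPairRate.lintegral_weightedShotNoise_lt_top (hb : IsPairRate b) (hz : 0 < z)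
    (hπ : IsPoissonMeasure z π) (φ θ : C_c(Point d, ℝ)) :
    ∫⁻ γ, weightedShotNoise ((tsupport φ).indicator 1) (offZero b) γ ^ 2 ∂tilted π θ < ∞ := by
  have := hπ.isFiniteMeasure_tilted θ
  obtain ⟨C, hC, hle⟩ := hπ.lintegral_tilted_le hz θ
  have hc : IsCompact (tsupport φ) := φ.hasCompactSupport
  have hK : MeasurableSet (tsupport φ) := hc.measurableSet
  refine lintegral_weightedShotNoise_sq_lt_top hC hb.bounded.ne hle
    (measurable_one.indicator hK)
    (hb.measurable.ennreal_toReal.ennreal_ofReal.indicator (measurableSet_singleton 0).compl)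
    (by simp [offZero]) (fun x => ?_) ?_ ?_ (fun x => Set.indicator_le_self' (by simp) x) ?_
  · by_cases h : x = 0 <;> simp [offZero, h, hb.even]
  · exact ((lintegral_mono (offZero_le b)).trans_lt hb.integrable).ne
  · filter_upwards [ENNReal.ae_le_essSup b] with x hx
    exact (offZero_le b x).trans hx
  · rw [lintegral_indicator_one hK]
    exact hc.measure_lt_top.ne

lemma IsPairRate.memLp_expPairing_mul_pairSum (hb : IsPairRate b) (hz : 0 < z)
    (hπ : IsPoissonMeasure z π) (θ φ : C_c(Point d, ℝ)) :
    MemLp (fun γ => expPairing θ γ * ∫ p, pairJump b φ p ∂pairKernel d γ) 2 π := by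
  have hI : Measurable fun γ => ∫ p, pairJump b φ p ∂pairKernel d γ :=
    (hb.measurable_pairJump φ).stronglyMeasurable.integral_kernel.measurable
  have hm : Measurable fun γ => expPairing θ γ * ∫ p, pairJump b φ p ∂pairKernel d γ :=
    (measurable_expPairing θ).mul hI
  obtain ⟨C, hC, hle⟩ := lintegral_pairJump_le hb φ
  have hc : IsCompact (tsupport φ) := φ.hasCompactSupport
  have hR : Measurable
      (weightedShotNoise ((tsupport φ).indicator 1) (offZero b) : Config d → ℝ≥0∞) :=
    measurable_weightedShotNoise (measurable_one.indicator hc.measurableSet)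
      (hb.measurable.ennreal_toReal.ennreal_ofReal.indicator (measurableSet_singleton 0).compl)
  rw [memLp_two_iff_integrable_sq hm.aestronglyMeasurable]
  refine ⟨(hm.pow_const 2).aestronglyMeasurable, ?_⟩
  calc ∫⁻ γ, ‖(expPairing θ γ * ∫ p, pairJump b φ p ∂pairKernel d γ) ^ 2‖ₑ ∂π
      ≤ ∫⁻ γ, ENNReal.ofReal (expPairing (θ + θ) γ) *
        (C ^ 2 * weightedShotNoise ((tsupport φ).indicator 1) (offZero b) γ ^ 2) ∂π := by
        refine lintegral_mono fun γ => ?_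
        -- The square of the exponential weight is again an exponential, so the L² norm becomes a
        -- second moment under the measure tilted by 2θ.
        rw [mul_pow, enorm_mul, sq (expPairing θ γ), expPairing_mul,
          Real.enorm_eq_ofReal (expPairing_pos _ _).le, enorm_pow, ← mul_pow]
        gcongr
        exact (enorm_integral_le_lintegral_enorm _).trans (hle γ)
    _ = C ^ 2 * ∫⁻ γ, weightedShotNoise ((tsupport φ).indicator 1) (offZero b) γ ^ 2
        ∂tilted π (θ + θ) := by
        rw [← lintegral_const_mul _ (hR.pow_const 2),
          lintegral_tilted _ ((hR.pow_const 2).const_mul _)]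
    _ < ∞ := ENNReal.mul_lt_top (ENNReal.pow_lt_top hC.lt_top)
        (hb.lintegral_weightedShotNoise_lt_top hz hπ φ _)

omit [NullSingletonClass (volume : Measure (Point d))] in
-- With χ = e^φ − 1 the sum is ⟨χ,γ⟩, and |s| ≤ e^s + e^{−s} dominates the product by e_{θ+χ} +
-- e_{θ−χ}.
lemma IsPoissonMeasure.memLp_expPairing_mul_sum (hπ : IsPoissonMeasure z π)
    (θ φ : C_c(Point d, ℝ)) :
    MemLp (fun γ => expPairing θ γ * ∫ x, (Real.exp (φ x) - 1) ∂pointKernel d γ) 2 π := by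
  let χ : C_c(Point d, ℝ) :=
    ⟨⟨fun x => Real.exp (φ x) - 1, by fun_prop⟩, hasCompactSupport_exp_sub_one φ⟩
  have hχ : ∀ γ : Config d, ∫ x, (Real.exp (φ x) - 1) ∂pointKernel d γ = γ.pairing χ := fun γ =>
    (pairing_eq_integral χ γ).symm
  simp_rw [hχ]
  refine ((hπ.memLp_expPairing (θ + χ)).add (hπ.memLp_expPairing (θ + (-1 : ℝ) • χ))).mono
    ((measurable_expPairing θ).mul (measurable_pairing χ)).aestronglyMeasurable
    (ae_of_all _ fun γ => ?_)
  rw [Pi.add_apply, ← expPairing_mul, ← expPairing_mul, ← mul_add, norm_mul, norm_mul]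
  refine mul_le_mul_of_nonneg_left ?_ (norm_nonneg _)
  rw [expPairing, expPairing, pairing_smul, Real.norm_eq_abs, Real.norm_of_nonneg (by positivity),
    abs_le]
  have h1 := Real.add_one_le_exp (γ.pairing χ)
  have h2 := Real.add_one_le_exp (-1 * γ.pairing χ)
  have h3 := Real.exp_pos (γ.pairing χ)
  have h4 := Real.exp_pos (-1 * γ.pairing χ)
  constructor <;> linarith

lemma IsPairRate.memLp_genL_expPairing (hb : IsPairRate b) (hz : 0 < z)
    (hπ : IsPoissonMeasure z π) (φ : C_c(Point d, ℝ)) :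
    MemLp (genL a b z (expPairing φ)) 2 π := by
  have h : genL a b z (expPairing φ) = _ := funext (hb.genL_expPairing φ)
  rw [h]
  exact (((((hb.memLp_expPairing_mul_pairSum hz hπ φ (-φ)).const_mul _).add
    (((hπ.memLp_expPairing φ).mul_const _).const_mul _)).add
    ((hπ.memLp_expPairing_mul_sum φ (-φ)).const_mul _)).add
    (((hπ.memLp_expPairing φ).mul_const _).const_mul _)).const_mul _

omit [NullSingletonClass (volume : Measure (Point d))] in
lemma IsPoissonMeasure.memLp_of_mem_expSpan (hπ : IsPoissonMeasure z π) {F : Config d → ℝ}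
    (hF : F ∈ expSpan d) : MemLp F 2 π := by
  induction hF using Submodule.span_induction with
  | mem F hF =>
    obtain ⟨φ, rfl⟩ := hF
    exact hπ.memLp_expPairing φ
  | zero => exact MemLp.zero
  | add F G _ _ hF hG => exact hF.add hG
  | smul c F _ hF => exact hF.const_smul c

lemma IsPairRate.memLp_genL (hb : IsPairRate b) (hz : 0 < z) (hπ : IsPoissonMeasure z π)
    {F : Config d → ℝ} (hF : F ∈ expSpan d) : MemLp (genL a b z F) 2 π := by
  induction hF using Submodule.span_induction with
  | mem F hF =>
    obtain ⟨φ, rfl⟩ := hF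
    exact hb.memLp_genL_expPairing hz hπ φ
  | zero =>
    have : genL a b z (0 : Config d → ℝ) = 0 := by
      funext γ
      simp [genL]
    rw [this]
    exact MemLp.zero
  | add F G hFm hGm hF hG =>
    exact (memLp_congr_ae (hb.genL_add_ae hz hπ hFm hGm)).2 (hF.add hG)
  | smul c F _ hF =>
    have : genL a b z (c • F) = c • genL a b z F := funext fun γ => genL_smul c F γ
    rw [this]
    exact hF.const_smul c

end SquareIntegrability

/-! ### The form on a pair of exponentials. -/

section FormOnExponentials

/-- The function `b (y - x) (exp (φ x + φ y) - 1) (exp (ψ x + ψ y) - 1)` of the pair `(x, y)`. -/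
noncomputable def pairCross (b : Point d → ℝ≥0∞) (φ ψ : C_c(Point d, ℝ)) (p : Point d × Point d) :
    ℝ :=
  (b (p.2 - p.1)).toReal *
    ((Real.exp (φ p.1 + φ p.2) - 1) * (Real.exp (ψ p.1 + ψ p.2) - 1))

/-- This is (e^s − 1)(e^t − 1) = −(e^{s+t}(e^{−s} − 1) + (e^s − 1)). After the Mecke formula the
first summand comes from the deaths and the second from the births; together they become symmetric
in φ and ψ. -/
lemma pairCross_eq (φ ψ : C_c(Point d, ℝ)) (p : Point d × Point d) :
    pairCross b φ ψ p =
      -(Real.exp ((φ + ψ) p.1 + (φ + ψ) p.2) * pairJump b (-φ) p + pairJump b φ p) := by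
  simp only [pairCross, pairJump, CompactlySupportedContinuousMap.add_apply,
    CompactlySupportedContinuousMap.neg_apply]
  have h1 : φ p.1 + ψ p.1 + (φ p.2 + ψ p.2) = (φ p.1 + φ p.2) + (ψ p.1 + ψ p.2) := by ring
  have h2 : -φ p.1 + -φ p.2 = -(φ p.1 + φ p.2) := by ring
  rw [h1, h2]
  generalize φ p.1 + φ p.2 = s
  generalize ψ p.1 + ψ p.2 = t
  have : Real.exp (s + t) * Real.exp (-s) = Real.exp t := by
    rw [← Real.exp_add]
    ring_nf
  linear_combination (b (p.2 - p.1)).toReal * this - (b (p.2 - p.1)).toReal * Real.exp_add s t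

lemma exp_mul_pairJump_integrable (hb : IsPairRate b) (φ θ : C_c(Point d, ℝ)) :
    Integrable (fun p => Real.exp (θ p.1 + θ p.2) * pairJump b φ p) (volume.prod volume) := by
  obtain ⟨M, -, hM⟩ := exists_bound θ
  have hcont : Continuous fun p : Point d × Point d => Real.exp (θ p.1 + θ p.2) := by fun_prop
  refine (hb.integrable_pairJump φ).bdd_mul (c := Real.exp (M + M)) hcont.aestronglyMeasurable
    (ae_of_all _ fun p => ?_)
  rw [Real.norm_of_nonneg (Real.exp_pos _).le]
  exact Real.exp_le_exp.2
    (add_le_add ((le_abs_self _).trans (hM _)) ((le_abs_self _).trans (hM _)))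

lemma IsPairRate.integrable_pairCross (hb : IsPairRate b) (φ ψ : C_c(Point d, ℝ)) :
    Integrable (pairCross b φ ψ) (volume.prod volume) := by
  have : pairCross b φ ψ = _ := funext (pairCross_eq φ ψ)
  rw [this]
  exact ((exp_mul_pairJump_integrable hb (-φ) (φ + ψ)).add (hb.integrable_pairJump φ)).neg

lemma integrable_exp_sub_one_mul (φ ψ : C_c(Point d, ℝ)) :
    Integrable fun x => (Real.exp (φ x) - 1) * (Real.exp (ψ x) - 1) :=
  Continuous.integrable_of_hasCompactSupport (by fun_prop)
    ((hasCompactSupport_exp_sub_one φ).mul_right)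

variable [NullSingletonClass (volume : Measure (Point d))]

/-- The form `ℰ₀` on two exponential functions. -/
lemma IsPairRate.preForm_expPairing (hb : IsPairRate b) (hz : 0 < z)
    (hπ : IsPoissonMeasure z π) (φ ψ : C_c(Point d, ℝ)) :
    preForm a b z π (expPairing φ) (expPairing ψ) = mean a ^ 2 *
      ((1 / 2) * z ^ 2 *
          ((∫ p, pairCross b φ ψ p ∂(volume.prod volume)) * ∫ γ, expPairing (φ + ψ) γ ∂π)
        + z * mean b * ((z * ∫ x, (Real.exp (φ x) - 1) * (Real.exp (ψ x) - 1)) *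
          ∫ γ, expPairing (φ + ψ) γ ∂π)) := by
  set θ := φ + ψ with hθ
  obtain ⟨i1, v1, -⟩ := hπ.integral_expPairing_mul_pairSum hz θ (hb.measurable_pairJump (-φ))
    (hb.integrable_pairJump (-φ))
  obtain ⟨i2, v2⟩ := hπ.integral_expPairing_mul_sum hz θ
    (g := fun x => Real.exp ((-φ) x) - 1) (Continuous.measurable (by fun_prop))
    (integrable_exp_sub_one (-φ))
  have i3 := hπ.integrable_expPairing θ
  set c2 := ∫ p, pairJump b φ p ∂(volume.prod volume)
  set c4 := ∫ x, (Real.exp (φ x) - 1)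
  have hpt : ∀ γ, (-genL a b z (expPairing φ) γ) * expPairing ψ γ =
      (-(mean a ^ 2) / 2) * (expPairing θ γ * ∫ p, pairJump b (-φ) p ∂pairKernel d γ)
      + (-(mean a ^ 2) * (z * mean b)) *
        (expPairing θ γ * ∫ x, (Real.exp ((-φ) x) - 1) ∂pointKernel d γ)
      + (-(mean a ^ 2) * (z ^ 2 * c2 / 2 + z * mean b * (z * c4))) * expPairing θ γ := by
    intro γ
    rw [hb.genL_expPairing, hθ, ← expPairing_mul]
    ring
  have hcross : ∫ p, pairCross b φ ψ p ∂(volume.prod volume) =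
      -((∫ p, Real.exp (θ p.1 + θ p.2) * pairJump b (-φ) p ∂(volume.prod volume)) + c2) := by
    simp_rw [pairCross_eq]
    rw [integral_neg, integral_add (exp_mul_pairJump_integrable hb (-φ) (φ + ψ))
      (hb.integrable_pairJump φ)]
  have hsingle : ∫ x, (Real.exp (φ x) - 1) * (Real.exp (ψ x) - 1) =
      -((∫ x, Real.exp (θ x) * (Real.exp ((-φ) x) - 1)) + c4) := by
    rw [← integral_add (integrable_exp_mul (integrable_exp_sub_one (-φ)) θ)
      (integrable_exp_sub_one φ), ← integral_neg]
    refine integral_congr_ae (ae_of_all _ fun x => ?_)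
    simp only [hθ, CompactlySupportedContinuousMap.add_apply,
      CompactlySupportedContinuousMap.neg_apply, Real.exp_add, Real.exp_neg]
    have := (Real.exp_pos (φ x)).ne'
    field_simp
    ring
  rw [preForm]
  simp_rw [hpt]
  have i12 : Integrable (fun γ =>
      (-(mean a ^ 2) / 2) * (expPairing θ γ * ∫ p, pairJump b (-φ) p ∂pairKernel d γ)
      + (-(mean a ^ 2) * (z * mean b)) *
        (expPairing θ γ * ∫ x, (Real.exp ((-φ) x) - 1) ∂pointKernel d γ)) π :=
    (i1.const_mul _).add (i2.const_mul _)
  rw [integral_add i12 (i3.const_mul _), integral_add (i1.const_mul _) (i2.const_mul _),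
    integral_const_mul, integral_const_mul, integral_const_mul, v1, v2, hcross, hsingle]
  ring

end FormOnExponentials

end BirthDeath

/-! ### Closures of symmetric forms and their spectral gap, in an abstract Hilbert space. -/

namespace BirthDeath

/-- A nonnegative symmetric bilinear form on a vector space `V` that is mapped into a Hilbert space
`H`, such that `v ↦ q(·, v)` is bounded with respect to the norm of `H`. -/
structure SymmForm (V H : Type*) [AddCommGroup V] [Module ℝ V] [NormedAddCommGroup H]
    [InnerProductSpace ℝ H] where
  q : LinearMap.BilinForm ℝ V
  j : V →ₗ[ℝ] H
  symm : ∀ v w, q v w = q w v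
  nonneg : ∀ v, 0 ≤ q v v
  bdd : ∀ v, ∃ C, ∀ w, |q v w| ≤ C * ‖j w‖

section Quadratic

variable {V : Type*} [AddCommGroup V] [Module ℝ V] (B : LinearMap.BilinForm ℝ V)

/-- A minimising sequence for the functional `B v v - 2 ℓ v`. -/
lemma exists_seq_tendsto_functional (hs : ∀ v w, B v w = B w v) (hp : ∀ v, 0 ≤ B v v)
    (l : V →ₗ[ℝ] ℝ) {C : ℝ} (hl : ∀ v, l v ^ 2 ≤ C * B v v) :
    ∃ v : ℕ → V, (∀ ε > 0, ∃ N, ∀ m ≥ N, ∀ n ≥ N, B (v m - v n) (v m - v n) < ε) ∧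
      ∀ w, Tendsto (fun n => B (v n) w) atTop (𝓝 (l w)) := by
  -- A minimiser of J would represent l through B. Since V is not complete, a minimising sequence is
  -- kept instead; it suffices for the closure.
  let J : V → ℝ := fun v => B v v - 2 * l v
  have hbelow : BddBelow (Set.range J) := by
    refine ⟨-(|C| + 1), ?_⟩
    rintro _ ⟨v, rfl⟩
    have h1 := hl v
    have h2 := hp v
    have h3 : l v ^ 2 ≤ (|C| + 1) * B v v :=
      h1.trans (mul_le_mul_of_nonneg_right ((le_abs_self C).trans (by linarith)) h2)
    have h4 : 0 < |C| + 1 := by positivity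
    simp only [J]
    have h5 : l v ^ 2 / (|C| + 1) ≤ B v v := by
      rw [div_le_iff₀ h4]
      linarith
    have h6 : 2 * l v ≤ l v ^ 2 / (|C| + 1) + (|C| + 1) := by
      rw [← sub_nonneg]
      have : l v ^ 2 / (|C| + 1) + (|C| + 1) - 2 * l v =
          (l v - (|C| + 1)) ^ 2 / (|C| + 1) := by
        field_simp
        ring
      rw [this]
      positivity
    linarith
  set m := ⨅ v, J v
  have hm : ∀ v, m ≤ J v := fun v => ciInf_le hbelow v
  have hex : ∀ n : ℕ, ∃ v, J v < m + 1 / (n + 1) := fun n =>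
    exists_lt_of_ciInf_lt (lt_add_of_pos_right m Nat.one_div_pos_of_nat)
  choose v hv using hex
  refine ⟨v, fun ε hε => ?_, fun w => ?_⟩
  · obtain ⟨N, hN⟩ := exists_nat_one_div_lt (show 0 < ε / 4 by positivity)
    refine ⟨N, fun k hk n hn => ?_⟩
    have hmono : ∀ i ≥ N, (1 : ℝ) / (i + 1) ≤ 1 / (N + 1) := fun i hi =>
      Nat.one_div_le_one_div hi
    have h1 := hv k
    have h2 := hv n
    -- Parallelogram identity: B(v_k − v_n) = 2J(v_k) + 2J(v_n) − 4J((v_k + v_n)/2), which is below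
    -- 4/(N+1) for k, n ≥ N.
    have h3 := hm ((1 / 2 : ℝ) • (v k + v n))
    simp only [J, map_smul, map_add, LinearMap.add_apply, LinearMap.smul_apply, smul_eq_mul,
      map_sub, LinearMap.sub_apply] at h1 h2 h3 ⊢
    have h4 := hs (v n) (v k)
    linarith [hmono k hk, hmono n hn]
  · have hkey : ∀ n : ℕ, (B (v n) w - l w) ^ 2 ≤ 1 / (n + 1) * B w w := by
      intro n
      -- J(v_n + t w) cannot fall more than 1/(n+1) below J(v_n). The discriminant of this quadratic
      -- in t bounds the error B(v_n, w) − l(w).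
      have h0 : ∀ t : ℝ, 0 ≤ B w w * (t * t) + (2 * (B (v n) w - l w)) * t + 1 / (n + 1) := by
        intro t
        have h1 := hm (v n + t • w)
        have h2 := hv n
        simp only [J, map_smul, map_add, LinearMap.add_apply, LinearMap.smul_apply,
          smul_eq_mul] at h1 h2
        rw [hs w (v n)] at h1
        nlinarith
      have h3 := discrim_le_zero h0
      rw [discrim] at h3
      linarith
    rw [tendsto_iff_dist_tendsto_zero]
    have h4 : Tendsto (fun n : ℕ => √((1 : ℝ) / (n + 1) * B w w)) atTop (𝓝 0) := by
      have := (tendsto_one_div_add_atTop_nhds_zero_nat (𝕜 := ℝ)).mul_const (B w w)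
      rw [zero_mul] at this
      simpa using this.sqrt
    refine squeeze_zero (fun _ => dist_nonneg) (fun n => ?_) h4
    rw [Real.dist_eq]
    exact Real.abs_le_sqrt (hkey n)

end Quadratic

namespace SymmForm

variable {V H : Type*} [AddCommGroup V] [Module ℝ V] [NormedAddCommGroup H]
    [InnerProductSpace ℝ H] (S : SymmForm V H)

/-- The seminorm of a form. -/
noncomputable def p (v : V) : ℝ := √(S.q v v)

lemma p_nonneg (v : V) : 0 ≤ S.p v := Real.sqrt_nonneg _

lemma p_sq (v : V) : S.p v ^ 2 = S.q v v := Real.sq_sqrt (S.nonneg v)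

lemma abs_q_le (v w : V) : |S.q v w| ≤ S.p v * S.p w := by
  have h := LinearMap.BilinForm.apply_sq_le_of_symm S.q S.nonneg ⟨fun v w => S.symm v w⟩ v w
  rw [← S.p_sq, ← S.p_sq, ← mul_pow] at h
  exact abs_le_of_sq_le_sq' h (mul_nonneg (S.p_nonneg v) (S.p_nonneg w)) |> abs_le.2

lemma p_add_le (v w : V) : S.p (v + w) ≤ S.p v + S.p w := by
  refine (sq_le_sq₀ (S.p_nonneg _) (add_nonneg (S.p_nonneg v) (S.p_nonneg w))).1 ?_
  have h := (le_abs_self _).trans (S.abs_q_le v w)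
  have e : S.q (v + w) (v + w) = S.q v v + 2 * S.q v w + S.q w w := by
    simp only [map_add, LinearMap.add_apply, S.symm w v]
    ring
  rw [p_sq, e, add_sq, p_sq, p_sq]
  linarith

lemma p_lt_of_q_lt {v : V} {ε : ℝ} (hε : 0 < ε) (h : S.q v v < ε ^ 2) : S.p v < ε :=
  (Real.sqrt_lt' hε).2 h

/-- Cauchy sequences for the form. -/
def FCauchy (v : ℕ → V) : Prop :=
  ∀ ε > 0, ∃ N, ∀ m ≥ N, ∀ n ≥ N, S.q (v m - v n) (v m - v n) < ε

/-- `v n` is Cauchy for the form and `j (v n)` converges to `f`. -/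
def Approx (v : ℕ → V) (f : H) : Prop :=
  S.FCauchy v ∧ Tendsto (fun n => S.j (v n)) atTop (𝓝 f)

/-- The domain of the closure. -/
def dom : Set H := {f | ∃ v, S.Approx v f}

variable {S} {v w v' w' : ℕ → V} {f g h : H}

lemma FCauchy.p_lt (hv : S.FCauchy v) {ε : ℝ} (hε : 0 < ε) :
    ∃ N, ∀ m ≥ N, ∀ n ≥ N, S.p (v m - v n) < ε := by
  obtain ⟨N, hN⟩ := hv (ε ^ 2) (by positivity)
  exact ⟨N, fun m hm n hn => S.p_lt_of_q_lt hε (hN m hm n hn)⟩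

lemma fCauchy_of_p (h : ∀ ε > 0, ∃ N, ∀ m ≥ N, ∀ n ≥ N, S.p (v m - v n) < ε) : S.FCauchy v := by
  intro ε hε
  obtain ⟨N, hN⟩ := h (√ε) (Real.sqrt_pos.2 hε)
  refine ⟨N, fun m hm n hn => ?_⟩
  have h1 := hN m hm n hn
  rw [← S.p_sq]
  calc S.p (v m - v n) ^ 2 < √ε ^ 2 := by
        have := S.p_nonneg (v m - v n)
        gcongr
    _ = ε := Real.sq_sqrt hε.le

lemma FCauchy.exists_bound (hv : S.FCauchy v) : ∃ M, 0 ≤ M ∧ ∀ᶠ n in atTop, S.p (v n) ≤ M := by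
  obtain ⟨N, hN⟩ := hv.p_lt one_pos
  refine ⟨1 + S.p (v N), add_nonneg zero_le_one (S.p_nonneg _), ?_⟩
  filter_upwards [eventually_ge_atTop N] with n hn
  have h1 := S.p_add_le (v n - v N) (v N)
  rw [sub_add_cancel] at h1
  linarith [hN n hn N le_rfl]

lemma FCauchy.add (hv : S.FCauchy v) (hw : S.FCauchy w) : S.FCauchy (v + w) := by
  refine fCauchy_of_p fun ε hε => ?_
  obtain ⟨N, hN⟩ := hv.p_lt (half_pos hε)
  obtain ⟨M, hM⟩ := hw.p_lt (half_pos hε)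
  refine ⟨max N M, fun m hm n hn => ?_⟩
  have h1 := S.p_add_le (v m - v n) (w m - w n)
  rw [sub_add_sub_comm] at h1
  have h2 := hN m (le_of_max_le_left hm) n (le_of_max_le_left hn)
  have h3 := hM m (le_of_max_le_right hm) n (le_of_max_le_right hn)
  simp only [Pi.add_apply]
  linarith

lemma FCauchy.smul (hv : S.FCauchy v) (c : ℝ) : S.FCauchy (c • v) := by
  intro ε hε
  obtain ⟨N, hN⟩ := hv (ε / (c ^ 2 + 1)) (by positivity)
  refine ⟨N, fun m hm n hn => ?_⟩
  have h1 := hN m hm n hn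
  rw [lt_div_iff₀ (by positivity)] at h1
  simp only [Pi.smul_apply, ← smul_sub, map_smul, LinearMap.smul_apply, smul_eq_mul]
  nlinarith [S.nonneg (v m - v n)]

lemma Approx.add (hv : S.Approx v f) (hw : S.Approx w g) : S.Approx (v + w) (f + g) :=
  ⟨hv.1.add hw.1, by simpa using hv.2.add hw.2⟩

lemma Approx.smul (hv : S.Approx v f) (c : ℝ) : S.Approx (c • v) (c • f) :=
  ⟨hv.1.smul c, by simpa using hv.2.const_smul c⟩

lemma Approx.sub (hv : S.Approx v f) (hw : S.Approx w g) : S.Approx (v - w) (f - g) := by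
  have := hv.add (hw.smul (-1))
  simpa [sub_eq_add_neg] using this

lemma approx_const (u : V) : S.Approx (fun _ => u) (S.j u) :=
  ⟨fun ε hε => ⟨0, fun m _ n _ => by simpa using hε⟩, tendsto_const_nhds⟩

/-- Closability. -/
lemma FCauchy.tendsto_zero (hv : S.FCauchy v) (h0 : Tendsto (fun n => S.j (v n)) atTop (𝓝 0)) :
    Tendsto (fun n => S.q (v n) (v n)) atTop (𝓝 0) := by
  obtain ⟨M, hM0, hM⟩ := hv.exists_bound
  rw [Metric.tendsto_atTop']
  intro ε hε
  obtain ⟨N, hN⟩ := hv.p_lt (show 0 < ε / (2 * (M + 1)) by positivity)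
  obtain ⟨C, hC⟩ := S.bdd (v N)
  have h1 : ∀ᶠ n in atTop, ‖S.j (v n)‖ < ε / (2 * (|C| + 1)) := by
    have := h0.norm
    rw [norm_zero] at this
    exact this.eventually_lt_const (by positivity)
  have hev : ∀ᶠ n in atTop, S.q (v n) (v n) < ε := by
    filter_upwards [h1, hM, eventually_ge_atTop N] with n h1 h2 h3
    -- The first term is small by the Cauchy property and boundedness of p(v_n); the second is small
    -- for fixed N, because q(v_N,·) is bounded in the norm of H and j(v_n) tends to 0.
    have e : S.q (v n) (v n) = S.q (v n - v N) (v n) + S.q (v N) (v n) := by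
      simp
    have h4 : S.q (v n - v N) (v n) ≤ ε / (2 * (M + 1)) * M := by
      refine ((le_abs_self _).trans (S.abs_q_le _ _)).trans ?_
      exact mul_le_mul (hN n h3 N le_rfl).le h2 (S.p_nonneg _) (by positivity)
    have h5 : S.q (v N) (v n) ≤ |C| * (ε / (2 * (|C| + 1))) := by
      refine ((le_abs_self _).trans (hC _)).trans ?_
      exact mul_le_mul (le_abs_self C) h1.le (norm_nonneg _) (abs_nonneg _)
    have h6 : ε / (2 * (M + 1)) * M < ε / 2 := by
      rw [div_mul_eq_mul_div, div_lt_div_iff₀ (by positivity) (by positivity)]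
      nlinarith
    have h7 : |C| * (ε / (2 * (|C| + 1))) ≤ ε / 2 := by
      rw [mul_div_assoc', div_le_div_iff₀ (by positivity) (by positivity)]
      nlinarith [abs_nonneg C]
    linarith
  obtain ⟨K, hK⟩ := eventually_atTop.1 hev
  refine ⟨K, fun n hn => ?_⟩
  rw [Real.dist_eq, sub_zero, abs_of_nonneg (S.nonneg _)]
  exact hK n hn.le

lemma Approx.tendsto_p_sub (hv : S.Approx v f) (hv' : S.Approx v' f) :
    Tendsto (fun n => S.p (v n - v' n)) atTop (𝓝 0) := by
  have h := hv.sub hv'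
  rw [sub_self] at h
  have := (h.1.tendsto_zero h.2).sqrt
  rw [Real.sqrt_zero] at this
  exact this

lemma Approx.cauchySeq (hv : S.Approx v f) (hw : S.Approx w g) :
    CauchySeq fun n => S.q (v n) (w n) := by
  obtain ⟨M, hM0, hM⟩ := hv.1.exists_bound
  obtain ⟨M', hM0', hM'⟩ := hw.1.exists_bound
  obtain ⟨K, hK⟩ := eventually_atTop.1 (hM.and hM')
  rw [Metric.cauchySeq_iff]
  intro ε hε
  obtain ⟨N, hN⟩ := hv.1.p_lt (show 0 < ε / (2 * (M' + 1)) by positivity)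
  obtain ⟨N', hN'⟩ := hw.1.p_lt (show 0 < ε / (2 * (M + 1)) by positivity)
  refine ⟨max K (max N N'), fun m hm n hn => ?_⟩
  simp only [ge_iff_le, max_le_iff] at hm hn
  have e : S.q (v m) (w m) - S.q (v n) (w n) =
      S.q (v m) (w m - w n) + S.q (v m - v n) (w n) := by
    simp
  have h1 : |S.q (v m) (w m - w n)| ≤ M * (ε / (2 * (M + 1))) :=
    (S.abs_q_le _ _).trans (mul_le_mul (hK m hm.1).1 (hN' m hm.2.2 n hn.2.2).le
      (S.p_nonneg _) hM0)
  have h2 : |S.q (v m - v n) (w n)| ≤ ε / (2 * (M' + 1)) * M' :=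
    (S.abs_q_le _ _).trans (mul_le_mul (hN m hm.2.1 n hn.2.1).le (hK n hn.1).2
      (S.p_nonneg _) (by positivity))
  have h3 : M * (ε / (2 * (M + 1))) < ε / 2 := by
    rw [mul_div_assoc', div_lt_div_iff₀ (by positivity) (by positivity)]
    nlinarith
  have h4 : ε / (2 * (M' + 1)) * M' < ε / 2 := by
    rw [div_mul_eq_mul_div, div_lt_div_iff₀ (by positivity) (by positivity)]
    nlinarith
  rw [Real.dist_eq, e]
  exact (abs_add_le _ _).trans_lt (by linarith)

/-- Closability, applied to the differences of two approximating sequences, makes the limit of q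
independent of their choice. -/
lemma Approx.tendsto_sub (hv : S.Approx v f) (hv' : S.Approx v' f) (hw : S.Approx w g)
    (hw' : S.Approx w' g) :
    Tendsto (fun n => S.q (v n) (w n) - S.q (v' n) (w' n)) atTop (𝓝 0) := by
  obtain ⟨M, hM0, hM⟩ := hv.1.exists_bound
  obtain ⟨M', hM0', hM'⟩ := hw'.1.exists_bound
  have h1 := ((hw.tendsto_p_sub hw').const_mul M).add ((hv.tendsto_p_sub hv').mul_const M')
  rw [mul_zero, zero_mul, add_zero] at h1
  refine squeeze_zero_norm' ?_ h1
  filter_upwards [hM, hM'] with n h2 h3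
  have e : S.q (v n) (w n) - S.q (v' n) (w' n) =
      S.q (v n) (w n - w' n) + S.q (v n - v' n) (w' n) := by
    simp
  rw [e, Real.norm_eq_abs]
  refine (abs_add_le _ _).trans (add_le_add ?_ ?_)
  · exact (S.abs_q_le _ _).trans (mul_le_mul_of_nonneg_right h2 (S.p_nonneg _))
  · exact (S.abs_q_le _ _).trans (mul_le_mul_of_nonneg_left h3 (S.p_nonneg _))

/-- `E` is the closure of the form. -/
def IsClosure (S : SymmForm V H) (E : H → H → ℝ) : Prop :=
  ∀ (v w : ℕ → V) (f g : H), S.Approx v f → S.Approx w g →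
    Tendsto (fun n => S.q (v n) (w n)) atTop (𝓝 (E f g))

variable {E : H → H → ℝ}

lemma IsClosure.add_left (hE : S.IsClosure E) (hf : f ∈ S.dom) (hg : g ∈ S.dom) (hh : h ∈ S.dom) :
    E (f + g) h = E f h + E g h := by
  obtain ⟨v, hv⟩ := hf
  obtain ⟨w, hw⟩ := hg
  obtain ⟨u, hu⟩ := hh
  refine tendsto_nhds_unique (hE _ _ _ _ (hv.add hw) hu) ?_
  simpa using (hE _ _ _ _ hv hu).add (hE _ _ _ _ hw hu)

lemma IsClosure.smul_left (hE : S.IsClosure E) (c : ℝ) (hf : f ∈ S.dom) (hh : h ∈ S.dom) :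
    E (c • f) h = c * E f h := by
  obtain ⟨v, hv⟩ := hf
  obtain ⟨u, hu⟩ := hh
  refine tendsto_nhds_unique (hE _ _ _ _ (hv.smul c) hu) ?_
  simpa using (hE _ _ _ _ hv hu).const_mul c

lemma add_mem_dom (hf : f ∈ S.dom) (hg : g ∈ S.dom) : f + g ∈ S.dom := by
  obtain ⟨v, hv⟩ := hf
  obtain ⟨w, hw⟩ := hg
  exact ⟨_, hv.add hw⟩

lemma smul_mem_dom (c : ℝ) (hf : f ∈ S.dom) : c • f ∈ S.dom := by
  obtain ⟨v, hv⟩ := hf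
  exact ⟨_, hv.smul c⟩

/-- It suffices to know `E f` on the range of `j`. -/
lemma IsClosure.eq_inner (hE : S.IsClosure E) (hf : f ∈ S.dom) {k : H}
    (hk : ∀ u, E f (S.j u) = inner ℝ k (S.j u)) (hg : g ∈ S.dom) : E f g = inner ℝ k g := by
  obtain ⟨v, hv⟩ := hf
  obtain ⟨w, hw⟩ := hg
  obtain ⟨M, hM0, hM⟩ := hw.1.exists_bound
  -- Here E f (j w_n) is the limit of q(v_m, w_n) in m, and |q(v_n − v_m, w_n)| is uniformly small,
  -- as p(w_n) stays bounded.
  have h1 : Tendsto (fun n => S.q (v n) (w n) - E f (S.j (w n))) atTop (𝓝 0) := by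
    rw [Metric.tendsto_atTop']
    intro ε hε
    obtain ⟨N, hN⟩ := hv.1.p_lt (show 0 < ε / (2 * (M + 1)) by positivity)
    obtain ⟨K, hK⟩ := eventually_atTop.1 hM
    refine ⟨max N K, fun n hn => ?_⟩
    have hn1 : N ≤ n := (le_max_left _ _).trans hn.le
    have hn2 : K ≤ n := (le_max_right _ _).trans hn.le
    have h2 : Tendsto (fun m => |S.q (v n) (w n) - S.q (v m) (w n)|) atTop
        (𝓝 |S.q (v n) (w n) - E f (S.j (w n))|) :=
      ((hE _ _ _ _ hv (approx_const (w n))).const_sub _).abs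
    rw [Real.dist_eq, sub_zero]
    have h3 : ε / (2 * (M + 1)) * M < ε := by
      rw [div_mul_eq_mul_div, div_lt_iff₀ (by positivity)]
      nlinarith
    refine lt_of_le_of_lt (le_of_tendsto h2 ?_) h3
    filter_upwards [eventually_ge_atTop N] with m hm
    have e : S.q (v n) (w n) - S.q (v m) (w n) = S.q (v n - v m) (w n) := by simp
    rw [e]
    exact (S.abs_q_le _ _).trans (mul_le_mul (hN n hn1 m hm).le (hK n hn2) (S.p_nonneg _)
      (by positivity))
  have h4 := (hE _ _ _ _ hv hw).sub h1
  simp only [sub_sub_cancel, hk, sub_zero] at h4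
  exact tendsto_nhds_unique h4 (tendsto_const_nhds.inner hw.2)

/-- The graph of the generator of the closed form `E`. -/
def Graph (S : SymmForm V H) (E : H → H → ℝ) (f h : H) : Prop :=
  f ∈ S.dom ∧ ∀ g ∈ S.dom, E f g = inner ℝ h g

/-- The form vanishes on the unit vector `j e` and has the spectral gap `c` on its complement. -/
structure HasGap (S : SymmForm V H) (e : V) (c : ℝ) : Prop where
  norm_eq_one : ‖S.j e‖ = 1
  apply_eq_zero : ∀ v, S.q e v = 0
  gap : ∀ v, c * (‖S.j v‖ ^ 2 - inner ℝ (S.j e) (S.j v) ^ 2) ≤ S.q v v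

variable {e : V} {c : ℝ}

lemma norm_sub_sq_eq {x y : H} (hx : ‖x‖ = 1) :
    ‖y - (inner ℝ x y : ℝ) • x‖ ^ 2 = ‖y‖ ^ 2 - (inner ℝ x y : ℝ) ^ 2 := by
  rw [norm_sub_sq_real, inner_smul_right, norm_smul, hx, real_inner_comm, Real.norm_eq_abs, mul_one,
    sq_abs]
  ring

lemma HasGap.poincare (hG : S.HasGap e c) (hE : S.IsClosure E) (hf : f ∈ S.dom) :
    c * (‖f‖ ^ 2 - inner ℝ (S.j e) f ^ 2) ≤ E f f := by
  obtain ⟨v, hv⟩ := hf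
  refine le_of_tendsto_of_tendsto' ?_ (hE _ _ _ _ hv hv) fun n => hG.gap (v n)
  exact ((hv.2.norm.pow 2).sub ((tendsto_const_nhds.inner hv.2).pow 2)).const_mul c

lemma HasGap.closure_apply_left (hG : S.HasGap e c) (hE : S.IsClosure E) (hf : f ∈ S.dom) :
    E (S.j e) f = 0 := by
  obtain ⟨v, hv⟩ := hf
  have := hE _ _ _ _ (approx_const e) hv
  simp only [hG.apply_eq_zero] at this
  exact tendsto_nhds_unique this tendsto_const_nhds |>.symm ▸ rfl

lemma HasGap.closure_apply_right (hG : S.HasGap e c) (hE : S.IsClosure E) (hf : f ∈ S.dom) :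
    E f (S.j e) = 0 := by
  obtain ⟨v, hv⟩ := hf
  have := hE _ _ _ _ hv (approx_const e)
  simp only [S.symm _ e, hG.apply_eq_zero] at this
  exact tendsto_nhds_unique this tendsto_const_nhds

/-- If the generator annihilates f, then E(f,f) = 0, and the gap forces the component of f
orthogonal to j e to vanish. -/
lemma HasGap.graph_zero_iff (hG : S.HasGap e c) (hE : S.IsClosure E) (hc : 0 < c) (f : H) :
    S.Graph E f 0 ↔ ∃ t : ℝ, f = t • S.j e := by
  constructor
  · rintro ⟨hf, h0⟩
    have h1 := hG.poincare hE hf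
    rw [h0 f hf, inner_zero_left, ← norm_sub_sq_eq hG.norm_eq_one] at h1
    refine ⟨inner ℝ (S.j e) f, sub_eq_zero.1 (norm_eq_zero.1 ?_)⟩
    have h2 : ‖f - (inner ℝ (S.j e) f : ℝ) • S.j e‖ ^ 2 ≤ 0 := by
      by_contra h
      nlinarith [mul_pos hc (not_le.1 h)]
    exact pow_eq_zero_iff (two_ne_zero) |>.1 (le_antisymm h2 (sq_nonneg _))
  · rintro ⟨t, rfl⟩
    have hm : S.j e ∈ S.dom := ⟨_, approx_const e⟩
    refine ⟨smul_mem_dom t hm, fun g hg => ?_⟩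
    rw [hE.smul_left t hm hg, hG.closure_apply_left hE hg, mul_zero, inner_zero_left]

/-- The parts of f along j e and orthogonal to it are estimated separately. On the line of j e the
shifted operator acts as −r, which gives 1/r; on the complement it is at least c − r, which gives
1/(c − r). -/
lemma HasGap.norm_le (hG : S.HasGap e c) (hE : S.IsClosure E) {r : ℝ} (hr : 0 < r) (hrc : r < c)
    (hfh : S.Graph E f h) : ‖f‖ ≤ (1 / (c - r) + 1 / r) * ‖h - r • f‖ := by
  obtain ⟨hf, hh⟩ := hfh
  set x := S.j e with hx
  set k := h - r • f with hk
  have hxd : x ∈ S.dom := ⟨_, approx_const e⟩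
  have hx1 : ‖x‖ = 1 := hG.norm_eq_one
  set m : ℝ := inner ℝ x f with hm
  have hcr : 0 < c - r := sub_pos.2 hrc
  have h1 : inner ℝ h x = (0 : ℝ) := by rw [← hh x hxd, hG.closure_apply_right hE hf]
  have h2 : inner ℝ k x = -r * m := by
    rw [hk, inner_sub_left, h1, inner_smul_left, real_inner_comm x f]
    simp [hm]
  have h3 : inner ℝ k f = E f f - r * ‖f‖ ^ 2 := by
    rw [hk, inner_sub_left, hh f hf, inner_smul_left, real_inner_self_eq_norm_sq]
    simp
  set y := f - m • x with hy
  have hy2 : ‖y‖ ^ 2 = ‖f‖ ^ 2 - m ^ 2 := norm_sub_sq_eq hx1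
  have h4 : (c - r) * ‖y‖ ^ 2 ≤ inner ℝ k y := by
    rw [hy, inner_sub_right, inner_smul_right, h2, h3, ← hy, hy2]
    have := hG.poincare hE hf
    nlinarith
  have h5 : (c - r) * ‖y‖ ≤ ‖k‖ := by
    have h6 := h4.trans (real_inner_le_norm k y)
    rcases (norm_nonneg y).eq_or_lt with h0 | h0
    · rw [← h0, mul_zero]
      exact norm_nonneg k
    · refine le_of_mul_le_mul_right ?_ h0
      calc (c - r) * ‖y‖ * ‖y‖ = (c - r) * ‖y‖ ^ 2 := by ring
        _ ≤ _ := h6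
  have h7 : r * |m| ≤ ‖k‖ := by
    have := abs_real_inner_le_norm k x
    rw [h2, hx1, mul_one, abs_mul, abs_neg, abs_of_pos hr] at this
    exact this
  have h8 : ‖f‖ ≤ ‖y‖ + |m| := by
    calc ‖f‖ = ‖y + m • x‖ := by rw [hy, sub_add_cancel]
      _ ≤ ‖y‖ + ‖m • x‖ := norm_add_le _ _
      _ = ‖y‖ + |m| := by rw [norm_smul, hx1, mul_one, Real.norm_eq_abs]
  have h9 : ‖y‖ ≤ 1 / (c - r) * ‖k‖ := by
    rw [one_div_mul_eq_div, le_div_iff₀ hcr]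
    linarith
  have h10 : |m| ≤ 1 / r * ‖k‖ := by
    rw [one_div_mul_eq_div, le_div_iff₀ hr]
    linarith
  linarith

lemma HasGap.exists_graph [CompleteSpace H] (hG : S.HasGap e c) (hE : S.IsClosure E) {r : ℝ}
    (hr : 0 < r) (hrc : r < c) (g : H) : ∃ f, S.Graph E f (g + r • f) := by
  have hc : 0 < c := hr.trans hrc
  have hcr : 0 < c - r := sub_pos.2 hrc
  set x := S.j e with hx
  have hx1 : ‖x‖ = 1 := hG.norm_eq_one
  let m : V →ₗ[ℝ] ℝ := (innerₗ H x).comp S.j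
  have hm : ∀ v, m v = inner ℝ x (S.j v) := fun v => rfl
  let I : LinearMap.BilinForm ℝ V := (innerₗ H).compl₁₂ S.j S.j
  have hI : ∀ v w, I v w = inner ℝ (S.j v) (S.j w) := fun v w => rfl
  let P : LinearMap.BilinForm ℝ V := LinearMap.BilinForm.linMulLin m m
  have hP : ∀ v w, P v w = m v * m w := fun v w => rfl
  -- The form q − r(·,·) equals −r on e; the rank one term with factor 1 + r raises this value to 1,
  -- and the gap takes care of the complement.
  let B : LinearMap.BilinForm ℝ V := S.q - r • I + (1 + r) • P
  have hB : ∀ v w, B v w = S.q v w - r * inner ℝ (S.j v) (S.j w) + (1 + r) * (m v * m w) :=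
    fun v w => by simp [B, hI, hP]
  have hvar : ∀ v, 0 ≤ ‖S.j v‖ ^ 2 - m v ^ 2 := fun v => by
    rw [hm, ← norm_sub_sq_eq hx1]
    positivity
  have hBq : ∀ v, (1 - r / c) * S.q v v + m v ^ 2 ≤ B v v := fun v => by
    have h1 := hG.gap v
    rw [← hx, ← hm] at h1
    have h2 : r * (‖S.j v‖ ^ 2 - m v ^ 2) ≤ r / c * S.q v v := by
      calc r * (‖S.j v‖ ^ 2 - m v ^ 2) = r / c * (c * (‖S.j v‖ ^ 2 - m v ^ 2)) := by
            field_simp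
        _ ≤ _ := mul_le_mul_of_nonneg_left h1 (by positivity)
    rw [hB, real_inner_self_eq_norm_sq]
    nlinarith
  have hrc1 : 0 < 1 - r / c := by
    rw [sub_pos, div_lt_one hc]
    exact hrc
  have hBpos : ∀ v, 0 ≤ B v v := fun v =>
    (add_nonneg (mul_nonneg hrc1.le (S.nonneg v)) (sq_nonneg _)).trans (hBq v)
  have hBnorm : ∀ v, ‖S.j v‖ ^ 2 ≤ (1 / (c - r) + 1) * B v v := fun v => by
    have h1 := hG.gap v
    rw [← hx, ← hm] at h1
    have h2 : (c - r) * (‖S.j v‖ ^ 2 - m v ^ 2) + m v ^ 2 ≤ B v v := by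
      rw [hB, real_inner_self_eq_norm_sq]
      nlinarith
    have h3 := hvar v
    have h4 : ‖S.j v‖ ^ 2 - m v ^ 2 ≤ 1 / (c - r) * B v v := by
      rw [one_div_mul_eq_div, le_div_iff₀ hcr]
      nlinarith [sq_nonneg (m v)]
    nlinarith [mul_nonneg hcr.le h3]
  -- The correction along x is chosen to cancel the added rank one term: the solution must satisfy
  -- (x,g) = −r(x,f), so (1+r)(x,f) = −((1+r)/r)(x,g).
  let l : V →ₗ[ℝ] ℝ := (innerₗ H (g - ((1 + r) / r * inner ℝ x g) • x)).comp S.j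
  have hl : ∀ v, l v = inner ℝ g (S.j v) - (1 + r) / r * inner ℝ x g * m v := fun v => by
    simp [l, hm]
  have hlB : ∀ v, l v ^ 2 ≤
      ‖g - ((1 + r) / r * inner ℝ x g) • x‖ ^ 2 * (1 / (c - r) + 1) * B v v := fun v => by
    have h1 := abs_real_inner_le_norm (g - ((1 + r) / r * inner ℝ x g) • x) (S.j v)
    have h2 : l v ^ 2 ≤ (‖g - ((1 + r) / r * inner ℝ x g) • x‖ * ‖S.j v‖) ^ 2 :=
      sq_le_sq.2 (h1.trans (le_abs_self _))
    rw [mul_pow] at h2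
    rw [mul_assoc]
    exact h2.trans (mul_le_mul_of_nonneg_left (hBnorm v) (sq_nonneg _))
  obtain ⟨v, hv1, hv2⟩ := exists_seq_tendsto_functional B
    (fun v w => by rw [hB, hB, S.symm v w, real_inner_comm, mul_comm (m v)]) hBpos l hlB
  have hFC : S.FCauchy v := by
    intro ε hε
    obtain ⟨N, hN⟩ := hv1 ((1 - r / c) * ε) (by positivity)
    refine ⟨N, fun a ha n hn => ?_⟩
    have h1 := (hBq (v a - v n)).trans_lt (hN a ha n hn)
    have h2 := sq_nonneg (m (v a - v n))
    exact lt_of_mul_lt_mul_left (by linarith) hrc1.le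
  have hCS : CauchySeq fun n => S.j (v n) := by
    rw [Metric.cauchySeq_iff]
    intro ε hε
    have hpos : 0 < 1 / (c - r) + 1 := by positivity
    obtain ⟨N, hN⟩ := hv1 (ε ^ 2 / (1 / (c - r) + 1)) (by positivity)
    refine ⟨N, fun a ha n hn => ?_⟩
    rw [dist_eq_norm, ← map_sub]
    refine lt_of_pow_lt_pow_left₀ 2 hε.le ((hBnorm _).trans_lt ?_)
    have := hN a ha n hn
    rw [lt_div_iff₀ hpos] at this
    linarith
  obtain ⟨f, hf⟩ := cauchySeq_tendsto_of_complete hCS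
  have hvf : S.Approx v f := ⟨hFC, hf⟩
  have hfd : f ∈ S.dom := ⟨v, hvf⟩
  have hlim : ∀ w, E f (S.j w) - r * inner ℝ f (S.j w) + (1 + r) * (inner ℝ x f * m w) = l w := by
    intro w
    refine tendsto_nhds_unique ?_ (hv2 w)
    simp only [hB]
    exact ((hE _ _ _ _ hvf (approx_const w)).sub
      ((hf.inner tendsto_const_nhds).const_mul r)).add
      (((tendsto_const_nhds.inner hf).mul_const (m w)).const_mul (1 + r))
  have hme : m e = 1 := by
    rw [hm, ← hx, real_inner_self_eq_norm_sq, hx1, one_pow]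
  -- Testing with e, where E(f, j e) = 0, yields (x,f) = −(x,g)/r. The auxiliary terms on both sides
  -- then coincide, and the original equation remains.
  have hmf : inner ℝ x g = -r * inner ℝ x f := by
    have h1 := hlim e
    rw [hl, ← hx, hG.closure_apply_right hE hfd, hme, real_inner_comm x f, real_inner_comm x g] at h1
    field_simp at h1
    linarith
  refine ⟨f, hfd, fun k hk => hE.eq_inner hfd (fun w => ?_) hk⟩
  have h1 := hlim w
  rw [hl, hmf] at h1
  rw [inner_add_left, inner_smul_left]
  simp only [conj_trivial]
  have h2 : (1 + r) / r * (-r * inner ℝ x f) = -(1 + r) * inner ℝ x f := by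
    field_simp
  rw [h2] at h1
  linarith

/-- Existence is the variational construction. Uniqueness is the norm estimate applied to the
difference of two solutions. -/
theorem HasGap.inResolventSet [CompleteSpace H] (hG : S.HasGap e c) (hE : S.IsClosure E) {r : ℝ}
    (hr : 0 < r) (hrc : r < c) : InResolventSet (S.Graph E) r := by
  refine ⟨fun g => ?_, _, fun f h hfh => hG.norm_le hE hr hrc hfh⟩
  obtain ⟨f, hf⟩ := hG.exists_graph hE hr hrc g
  refine ⟨f, ⟨_, hf, add_sub_cancel_right _ _⟩, ?_⟩
  rintro f' ⟨h', hf', hg'⟩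
  have hsub : S.Graph E (f' + (-1 : ℝ) • f) (h' + (-1 : ℝ) • (g + r • f)) := by
    refine ⟨add_mem_dom hf'.1 (smul_mem_dom _ hf.1), fun k hk => ?_⟩
    rw [hE.add_left hf'.1 (smul_mem_dom _ hf.1) hk, hE.smul_left _ hf.1 hk, hf'.2 k hk, hf.2 k hk,
      inner_add_left h', inner_smul_left (g + r • f)]
    simp
  have hle := hG.norm_le hE hr hrc hsub
  have h0 : h' + (-1 : ℝ) • (g + r • f) - r • (f' + (-1 : ℝ) • f) = 0 := by
    rw [← hg']
    module
  rw [h0, norm_zero, mul_zero] at hle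
  have := norm_le_zero_iff.1 hle
  rw [neg_one_smul, ← sub_eq_add_neg, sub_eq_zero] at this
  exact this

end SymmForm

end BirthDeath

/-! ### Positive semidefinite kernels and the Schur product. -/

namespace BirthDeath

section PositiveKernels

variable {ι α : Type*} [MeasurableSpace α] {μ : Measure α} {s : Finset ι}

/-- The kernel `k` is positive semidefinite on the finite set `s`. -/
def IsPosKernel (s : Finset ι) (k : ι → ι → ℝ) : Prop :=
  ∀ c : ι → ℝ, 0 ≤ ∑ i ∈ s, ∑ j ∈ s, c i * c j * k i j

lemma isPosKernel_one : IsPosKernel s fun _ _ => 1 := fun c => by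
  simp only [mul_one, ← Finset.sum_mul_sum]
  exact mul_self_nonneg _

/-- The product of a positive kernel and a Gram kernel is positive. -/
lemma IsPosKernel.integral_mul {k : ι → ι → ℝ} (hk : IsPosKernel s k) {w : α → ℝ}
    (hw : ∀ x, 0 ≤ w x) {u : ι → α → ℝ}
    (hu : ∀ i j, Integrable (fun x => w x * (u i x * u j x)) μ) :
    IsPosKernel s fun i j => (∫ x, w x * (u i x * u j x) ∂μ) * k i j := by
  intro c
  have h : ∑ i ∈ s, ∑ j ∈ s, c i * c j * ((∫ x, w x * (u i x * u j x) ∂μ) * k i j) =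
      -- For fixed x the values u_i(x) are absorbed into the coefficients, so positivity of k holds
      -- pointwise and is integrated.
      ∫ x, w x * ∑ i ∈ s, ∑ j ∈ s, (c i * u i x) * (c j * u j x) * k i j ∂μ := by
    have h1 : ∀ x, w x * ∑ i ∈ s, ∑ j ∈ s, (c i * u i x) * (c j * u j x) * k i j =
        ∑ i ∈ s, ∑ j ∈ s, (c i * c j * k i j) * (w x * (u i x * u j x)) := fun x => by
      simp only [Finset.mul_sum]
      exact Finset.sum_congr rfl fun i _ => Finset.sum_congr rfl fun j _ => by ring
    simp only [h1]
    rw [integral_finsetSum _ fun i _ => integrable_finsetSum _ fun j _ => (hu i j).const_mul _]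
    refine Finset.sum_congr rfl fun i _ => ?_
    rw [integral_finsetSum _ fun j _ => (hu i j).const_mul _]
    refine Finset.sum_congr rfl fun j _ => ?_
    rw [integral_const_mul]
    ring
  rw [h]
  exact integral_nonneg fun x => mul_nonneg (hw x) (hk fun i => c i * u i x)

lemma isPosKernel_pow {w : α → ℝ} (hw : ∀ x, 0 ≤ w x) {u : ι → α → ℝ}
    (hu : ∀ i j, Integrable (fun x => w x * (u i x * u j x)) μ) (n : ℕ) :
    IsPosKernel s fun i j => (∫ x, w x * (u i x * u j x) ∂μ) ^ n := by
  induction n with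
  | zero => simpa using isPosKernel_one
  | succ n ih => simpa only [pow_succ'] using ih.integral_mul hw hu

lemma hasSum_mul_exp_sub_exp (t : ℝ) :
    HasSum (fun n : ℕ => t ^ (n + 1) * (1 / (n.factorial : ℝ) - 1 / ((n + 1).factorial : ℝ)))
      (t * Real.exp t - Real.exp t + 1) := by
  have h := NormedSpace.expSeries_div_hasSum_exp t
  rw [← Real.exp_eq_exp_ℝ] at h
  have h1 := h.mul_left t
  have h2 := (hasSum_nat_add_iff' 1).2 h
  have h3 := h1.sub h2
  simp only [Finset.sum_range_one, pow_zero, Nat.factorial_zero, Nat.cast_one, div_one] at h3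
  have h4 : t * Real.exp t - Real.exp t + 1 = t * Real.exp t - (Real.exp t - 1) := by ring
  rw [h4]
  refine h3.congr_fun fun n => ?_
  ring

/-- The power series of s e^s − e^s + 1 has the coefficients 1/n! − 1/(n+1)! ≥ 0 at s^{n+1}, and
powers of the Gram kernel t are positive. -/
lemma isPosKernel_mul_exp_sub_exp {w : α → ℝ} (hw : ∀ x, 0 ≤ w x) {u : ι → α → ℝ}
    (hu : ∀ i j, Integrable (fun x => w x * (u i x * u j x)) μ) {t : ι → ι → ℝ}
    (ht : ∀ i j, t i j = ∫ x, w x * (u i x * u j x) ∂μ) :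
    IsPosKernel s fun i j => t i j * Real.exp (t i j) - Real.exp (t i j) + 1 := by
  intro c
  have h : HasSum (fun n : ℕ => ∑ i ∈ s, ∑ j ∈ s, c i * c j *
      (t i j ^ (n + 1) * (1 / (n.factorial : ℝ) - 1 / ((n + 1).factorial : ℝ))))
      (∑ i ∈ s, ∑ j ∈ s, c i * c j * (t i j * Real.exp (t i j) - Real.exp (t i j) + 1)) :=
    hasSum_sum fun i _ => hasSum_sum fun j _ => (hasSum_mul_exp_sub_exp _).mul_left _
  refine h.nonneg fun n => ?_
  simp only [← mul_assoc, ← Finset.sum_mul]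
  refine mul_nonneg ?_ (sub_nonneg.2 ?_)
  · simpa only [ht] using isPosKernel_pow (s := s) hw hu (n + 1) c
  · gcongr
    exact n.le_succ

end PositiveKernels

/-! ### The form as a symmetric form in L², and the gap on the span. -/

section ConcreteForm

open Config

variable {d : ℕ} {z : ℝ} {π : Measure (Config d)} {a b : Point d → ℝ≥0∞}

/-- The function `exp ⟨φ, ·⟩` as an element of `expSpan d`. -/
noncomputable def expVec (φ : C_c(Point d, ℝ)) : expSpan d :=
  ⟨expPairing φ, Submodule.subset_span ⟨φ, rfl⟩⟩

lemma exists_eq_sum_expVec (v : expSpan d) :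
    ∃ (s : Finset C_c(Point d, ℝ)) (c : C_c(Point d, ℝ) → ℝ), v = ∑ φ ∈ s, c φ • expVec φ := by
  obtain ⟨c, hc⟩ := Finsupp.mem_span_range_iff_exists_finsupp.1 v.2
  refine ⟨c.support, c, Subtype.ext ?_⟩
  rw [← hc, Finsupp.sum]
  push_cast
  rfl

/-- The inclusion of `expSpan d` in `L²(Γ, π)`. -/
noncomputable def IsPoissonMeasure.toLp (hπ : IsPoissonMeasure z π) :
    expSpan d →ₗ[ℝ] Lp ℝ 2 π where
  toFun v := (hπ.memLp_of_mem_expSpan v.2).toLp v.1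
  map_add' _ _ := rfl
  map_smul' _ _ := rfl

lemma IsPoissonMeasure.coeFn_toLp (hπ : IsPoissonMeasure z π) (v : expSpan d) :
    hπ.toLp v =ᵐ[π] v.1 :=
  (hπ.memLp_of_mem_expSpan v.2).coeFn_toLp

lemma IsPoissonMeasure.inner_toLp_expVec (hπ : IsPoissonMeasure z π) (φ ψ : C_c(Point d, ℝ)) :
    inner ℝ (hπ.toLp (expVec φ)) (hπ.toLp (expVec ψ)) = ∫ γ, expPairing (φ + ψ) γ ∂π := by
  rw [L2.inner_def]
  refine integral_congr_ae ?_
  filter_upwards [hπ.coeFn_toLp (expVec φ), hπ.coeFn_toLp (expVec ψ)] with γ h1 h2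
  rw [h1, h2, ← expPairing_mul, real_inner_eq_re_inner]
  simp [expVec, mul_comm]

variable [NullSingletonClass (volume : Measure (Point d))]

/-- The operator `-L₀` from `expSpan d` to `L²(Γ, π)`. -/
noncomputable def IsPairRate.negGenL (hb : IsPairRate b) (hz : 0 < z) (hπ : IsPoissonMeasure z π)
    (a : Point d → ℝ≥0∞) : expSpan d →ₗ[ℝ] Lp ℝ 2 π where
  toFun v := -(hb.memLp_genL (a := a) hz hπ v.2).toLp (genL a b z v.1)
  map_add' v w := by
    rw [← neg_add, ← MemLp.toLp_add, neg_inj, MemLp.toLp_eq_toLp_iff]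
    exact hb.genL_add_ae hz hπ v.2 w.2
  map_smul' c v := by
    rw [RingHom.id_apply, smul_neg, ← MemLp.toLp_const_smul, neg_inj, MemLp.toLp_eq_toLp_iff]
    exact ae_of_all _ fun γ => genL_smul c v.1 γ

/-- The form `ℰ₀` on `expSpan d`. -/
noncomputable def IsPairRate.bilin (hb : IsPairRate b) (hz : 0 < z) (hπ : IsPoissonMeasure z π)
    (a : Point d → ℝ≥0∞) : LinearMap.BilinForm ℝ (expSpan d) :=
  (innerₗ (Lp ℝ 2 π)).compl₁₂ (hb.negGenL hz hπ a) hπ.toLp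

lemma IsPairRate.bilin_eq_inner (hb : IsPairRate b) (hz : 0 < z) (hπ : IsPoissonMeasure z π)
    (v w : expSpan d) :
    hb.bilin hz hπ a v w = inner ℝ (hb.negGenL hz hπ a v) (hπ.toLp w) := rfl

lemma IsPairRate.bilin_apply (hb : IsPairRate b) (hz : 0 < z) (hπ : IsPoissonMeasure z π)
    (v w : expSpan d) : hb.bilin hz hπ a v w = preForm a b z π v.1 w.1 := by
  rw [hb.bilin_eq_inner, L2.inner_def, preForm]
  refine integral_congr_ae ?_
  have h : hb.negGenL hz hπ a v =ᵐ[π] fun γ => -genL a b z v.1 γ := by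
    refine (Lp.coeFn_neg _).trans ?_
    filter_upwards [(hb.memLp_genL (a := a) hz hπ v.2).coeFn_toLp] with γ h
    rw [Pi.neg_apply, h]
  filter_upwards [h, hπ.coeFn_toLp w] with γ h1 h2
  rw [h1, h2, real_inner_eq_re_inner]
  simp [mul_comm]

omit [NullSingletonClass (volume : Measure (Point d))] in
lemma pairCross_comm (φ ψ : C_c(Point d, ℝ)) : pairCross b φ ψ = pairCross b ψ φ := by
  funext p
  simp only [pairCross]
  ring

/-- By bilinearity it is enough to treat two exponentials, where the explicit formula is symmetric.
-/
lemma IsPairRate.bilin_comm (hb : IsPairRate b) (hz : 0 < z) (hπ : IsPoissonMeasure z π)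
    (v w : expSpan d) : hb.bilin hz hπ a v w = hb.bilin hz hπ a w v := by
  obtain ⟨s, c, rfl⟩ := exists_eq_sum_expVec v
  obtain ⟨s', c', rfl⟩ := exists_eq_sum_expVec w
  simp only [map_sum, map_smul, LinearMap.sum_apply, LinearMap.smul_apply, smul_eq_mul,
    Finset.mul_sum]
  rw [Finset.sum_comm]
  refine Finset.sum_congr rfl fun ψ _ => Finset.sum_congr rfl fun φ _ => ?_
  rw [hb.bilin_apply, hb.bilin_apply]
  have h := hb.preForm_expPairing (a := a) hz hπ φ ψ
  have h' := hb.preForm_expPairing (a := a) hz hπ ψ φ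
  rw [pairCross_comm ψ φ, add_comm ψ φ] at h'
  simp only [mul_comm (Real.exp (ψ _) - 1)] at h'
  simp only [expVec]
  rw [h, h']
  ring

/-- Laplace functional together with e^{φ+ψ} − 1 = (e^φ − 1) + (e^ψ − 1) + (e^φ − 1)(e^ψ − 1). -/
lemma IsPoissonMeasure.integral_expPairing_add (hz : 0 < z) (hπ : IsPoissonMeasure z π)
    (φ ψ : C_c(Point d, ℝ)) : ∫ γ, expPairing (φ + ψ) γ ∂π =
      (∫ γ, expPairing φ γ ∂π) * (∫ γ, expPairing ψ γ ∂π) *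
        Real.exp (∫ x, z * ((Real.exp (φ x) - 1) * (Real.exp (ψ x) - 1))) := by
  have h : Integrable fun x => (Real.exp (φ x) - 1) + (Real.exp (ψ x) - 1) :=
    (integrable_exp_sub_one φ).add (integrable_exp_sub_one ψ)
  rw [hπ.integral_expPairing hz, hπ.integral_expPairing hz, hπ.integral_expPairing hz,
    ← Real.exp_add, ← Real.exp_add, integral_const_mul, ← mul_add, ← mul_add,
    ← integral_add (integrable_exp_sub_one φ) (integrable_exp_sub_one ψ),
    ← integral_add h (integrable_exp_sub_one_mul φ ψ)]
  congr 3
  funext x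
  rw [CompactlySupportedContinuousMap.add_apply, Real.exp_add]
  ring

/-- The coercivity of `ℰ₀` on `expSpan d`. -/
lemma IsPairRate.gap_le_bilin (hb : IsPairRate b) (hz : 0 < z) (hπ : IsPoissonMeasure z π)
    (v : expSpan d) : mean a ^ 2 * z * mean b *
      (‖hπ.toLp v‖ ^ 2 - inner ℝ (hπ.toLp (expVec 0)) (hπ.toLp v) ^ 2) ≤ hb.bilin hz hπ a v v := by
  obtain ⟨s, c, rfl⟩ := exists_eq_sum_expVec v
  let m : C_c(Point d, ℝ) → ℝ := fun φ => ∫ γ, expPairing φ γ ∂π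
  let t : C_c(Point d, ℝ) → C_c(Point d, ℝ) → ℝ := fun φ ψ =>
    ∫ x, z * ((Real.exp (φ x) - 1) * (Real.exp (ψ x) - 1))
  let X : C_c(Point d, ℝ) → C_c(Point d, ℝ) → ℝ := fun φ ψ =>
    ∫ p, pairCross b φ ψ p ∂(volume.prod volume)
  have hm : ∀ φ ψ, m (φ + ψ) = m φ * m ψ * Real.exp (t φ ψ) := hπ.integral_expPairing_add hz
  have hpair : 0 ≤ ∑ φ ∈ s, ∑ ψ ∈ s, c φ * c ψ * (X φ ψ * m (φ + ψ)) := by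
    -- m(φ+ψ) is the L² inner product of e_φ and e_ψ; multiplying by the Gram kernel X keeps
    -- positivity.
    have hgram : IsPosKernel s fun φ ψ => m (φ + ψ) := by
      have := (isPosKernel_one (s := s)).integral_mul (μ := π) (w := fun _ => 1)
        (u := fun φ => expPairing φ) (fun _ => zero_le_one) fun φ ψ => by
          simpa only [one_mul, expPairing_mul] using hπ.integrable_expPairing (φ + ψ)
      simpa only [one_mul, mul_one, expPairing_mul] using this
    exact hgram.integral_mul (μ := volume.prod volume) (w := fun p => (b (p.2 - p.1)).toReal)
      (u := fun φ p => Real.exp (φ p.1 + φ p.2) - 1) (fun _ => ENNReal.toReal_nonneg)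
      (fun φ ψ => hb.integrable_pairCross φ ψ) c
  have hsingle : 0 ≤ ∑ φ ∈ s, ∑ ψ ∈ s, c φ * c ψ *
      (t φ ψ * m (φ + ψ) - m (φ + ψ) + m φ * m ψ) := by
    have := isPosKernel_mul_exp_sub_exp (s := s) (μ := (volume : Measure (Point d)))
      (w := fun _ => z) (u := fun (φ : C_c(Point d, ℝ)) x => Real.exp (φ x) - 1) (t := t)
      (fun _ => hz.le) (fun φ ψ => (integrable_exp_sub_one_mul φ ψ).const_mul z)
      -- The factors m(φ)m(ψ) of m(φ+ψ) = m(φ)m(ψ)e^t are absorbed into the coefficients.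
      (fun φ ψ => rfl) fun φ => c φ * m φ
    refine this.trans_eq (Finset.sum_congr rfl fun φ _ => Finset.sum_congr rfl fun ψ _ => ?_)
    rw [hm]
    ring
  have hnorm : ‖hπ.toLp (∑ φ ∈ s, c φ • expVec φ)‖ ^ 2 =
      ∑ φ ∈ s, ∑ ψ ∈ s, c φ * c ψ * m (φ + ψ) := by
    rw [← real_inner_self_eq_norm_sq]
    simp only [map_sum, map_smul, sum_inner, inner_sum, inner_smul_left, inner_smul_right,
      conj_trivial, hπ.inner_toLp_expVec, Finset.mul_sum]
    exact Finset.sum_congr rfl fun φ _ => Finset.sum_congr rfl fun ψ _ => by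
      rw [add_comm ψ φ]
      ring
  have hmean : inner ℝ (hπ.toLp (expVec 0)) (hπ.toLp (∑ φ ∈ s, c φ • expVec φ)) ^ 2 =
      ∑ φ ∈ s, ∑ ψ ∈ s, c φ * c ψ * (m φ * m ψ) := by
    simp only [map_sum, map_smul, inner_sum, inner_smul_right, hπ.inner_toLp_expVec, zero_add]
    rw [sq, Finset.sum_mul_sum]
    exact Finset.sum_congr rfl fun φ _ => Finset.sum_congr rfl fun ψ _ => by ring
  have hform : hb.bilin hz hπ a (∑ φ ∈ s, c φ • expVec φ) (∑ φ ∈ s, c φ • expVec φ) =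
      mean a ^ 2 * ((1 / 2) * z ^ 2) * ∑ φ ∈ s, ∑ ψ ∈ s, c φ * c ψ * (X φ ψ * m (φ + ψ)) +
      mean a ^ 2 * z * mean b * ∑ φ ∈ s, ∑ ψ ∈ s, c φ * c ψ * (t φ ψ * m (φ + ψ)) := by
    simp only [map_sum, map_smul, LinearMap.sum_apply, LinearMap.smul_apply, smul_eq_mul,
      Finset.mul_sum, ← Finset.sum_add_distrib]
    rw [Finset.sum_comm]
    refine Finset.sum_congr rfl fun φ _ => Finset.sum_congr rfl fun ψ _ => ?_
    rw [hb.bilin_apply]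
    have h := hb.preForm_expPairing (a := a) hz hπ φ ψ
    simp only [expVec, t, integral_const_mul]
    rw [h]
    ring
  have hmb : 0 ≤ mean b := ENNReal.toReal_nonneg
  have h1 : 0 ≤ mean a ^ 2 * ((1 / 2) * z ^ 2) *
      ∑ φ ∈ s, ∑ ψ ∈ s, c φ * c ψ * (X φ ψ * m (φ + ψ)) := mul_nonneg (by positivity) hpair
  have h2 := mul_nonneg (show 0 ≤ mean a ^ 2 * z * mean b by positivity) hsingle
  simp only [mul_add, mul_sub, Finset.sum_add_distrib, Finset.sum_sub_distrib] at h2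
  rw [hnorm, hmean, hform]
  linarith

omit [NullSingletonClass (volume : Measure (Point d))] in
lemma IsPoissonMeasure.norm_toLp_expVec_zero (hπ : IsPoissonMeasure z π) :
    ‖hπ.toLp (expVec 0)‖ = 1 := by
  have := hπ.isProbabilityMeasure
  have h := hπ.inner_toLp_expVec 0 0
  simp only [add_zero, expPairing_zero, integral_const, probReal_univ, smul_eq_mul, mul_one] at h
  rw [real_inner_self_eq_norm_sq] at h
  exact (pow_eq_one_iff_of_nonneg (norm_nonneg _) two_ne_zero).1 h

/-- The gap estimate already contains nonnegativity, because the variance is nonnegative by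
Cauchy–Schwarz. -/
lemma IsPairRate.bilin_nonneg (hb : IsPairRate b) (hz : 0 < z) (hπ : IsPoissonMeasure z π)
    (v : expSpan d) : 0 ≤ hb.bilin hz hπ a v v := by
  have hmb : 0 ≤ mean b := ENNReal.toReal_nonneg
  refine (mul_nonneg (by positivity) (sub_nonneg.2 ?_)).trans (hb.gap_le_bilin hz hπ v)
  have h := abs_real_inner_le_norm (hπ.toLp (expVec 0)) (hπ.toLp v)
  rw [hπ.norm_toLp_expVec_zero, one_mul] at h
  exact sq_le_sq.2 (h.trans (le_abs_self _))

/-- The form `(ℰ₀, expSpan d)` in `L²(Γ, π)`. -/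
noncomputable def IsPairRate.symmForm (hb : IsPairRate b) (hz : 0 < z) (hπ : IsPoissonMeasure z π)
    (a : Point d → ℝ≥0∞) : SymmForm (expSpan d) (Lp ℝ 2 π) where
  q := hb.bilin hz hπ a
  j := hπ.toLp
  symm := hb.bilin_comm hz hπ
  nonneg := hb.bilin_nonneg hz hπ
  bdd v := ⟨‖hb.negGenL hz hπ a v‖, fun w => by
    rw [hb.bilin_eq_inner]
    exact abs_real_inner_le_norm _ _⟩

lemma IsPairRate.symmForm_hasGap (hb : IsPairRate b) (hz : 0 < z) (hπ : IsPoissonMeasure z π) :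
    (hb.symmForm hz hπ a).HasGap (expVec 0) (mean a ^ 2 * z * mean b) where
  norm_eq_one := hπ.norm_toLp_expVec_zero
  apply_eq_zero v := by
    refine (hb.bilin_apply hz hπ _ _).trans ?_
    have h : ∀ γ, genL a b z (expVec 0 : expSpan d).1 γ = 0 := fun γ => by
      simp [genL, expVec, expPairing_zero]
    simp [preForm, h]
  gap := hb.gap_le_bilin hz hπ

end ConcreteForm

end BirthDeath

/-! ### Transfer of the abstract results to the closure of the form. -/

namespace BirthDeath

section Closure

variable {d : ℕ} {z : ℝ} {π : Measure (Config d)} {a b : Point d → ℝ≥0∞}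
  [NullSingletonClass (volume : Measure (Point d))]

lemma IsPairRate.formCauchy_iff (hb : IsPairRate b) (hz : 0 < z) (hπ : IsPoissonMeasure z π)
    (v : ℕ → expSpan d) :
    FormCauchy a b z π (fun n => (v n).1) ↔ (hb.symmForm hz hπ a).FCauchy v := by
  have h : ∀ m n, preForm a b z π ((v m).1 - (v n).1) ((v m).1 - (v n).1) =
      (hb.symmForm hz hπ a).q (v m - v n) (v m - v n) :=
    fun m n => (hb.bilin_apply hz hπ (v m - v n) (v m - v n)).symm
  simp only [FormCauchy, h, SymmForm.FCauchy]
  exact and_iff_right fun n => (v n).2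

lemma IsPairRate.approximates_iff (hb : IsPairRate b) (hz : 0 < z) (hπ : IsPoissonMeasure z π)
    (v : ℕ → expSpan d) (f : Lp ℝ 2 π) :
    Approximates a b z π (fun n => (v n).1) f ↔ (hb.symmForm hz hπ a).Approx v f := by
  refine and_congr (hb.formCauchy_iff hz hπ v) ?_
  refine Iff.trans ?_ (Lp.tendsto_Lp_iff_tendsto_eLpNorm' (fun n => hπ.toLp (v n)) f).symm
  have h : ∀ n, eLpNorm ((v n).1 - ⇑f) 2 π = eLpNorm (⇑(hπ.toLp (v n)) - ⇑f) 2 π := fun n =>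
    eLpNorm_congr_ae ((hπ.coeFn_toLp (v n)).symm.sub EventuallyEq.rfl)
  simp only [h]

lemma IsPairRate.approx_of_approximates (hb : IsPairRate b) (hz : 0 < z)
    (hπ : IsPoissonMeasure z π) {F : ℕ → Config d → ℝ} {f : Lp ℝ 2 π}
    (h : Approximates a b z π F f) :
    (hb.symmForm hz hπ a).Approx (fun n => ⟨F n, h.1.1 n⟩) f :=
  (hb.approximates_iff hz hπ _ f).1 h

lemma IsPairRate.formDomain_eq (hb : IsPairRate b) (hz : 0 < z) (hπ : IsPoissonMeasure z π) :
    formDomain a b z π = (hb.symmForm hz hπ a).dom := by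
  ext f
  exact ⟨fun ⟨F, hF⟩ => ⟨_, hb.approx_of_approximates hz hπ hF⟩,
    fun ⟨v, hv⟩ => ⟨_, (hb.approximates_iff hz hπ v f).2 hv⟩⟩

/-- The chosen approximating sequences give a Cauchy sequence of values, so its limit exists; any
other sequences give values with vanishing difference. -/
lemma IsPairRate.isClosure_form (hb : IsPairRate b) (hz : 0 < z) (hπ : IsPoissonMeasure z π) :
    (hb.symmForm hz hπ a).IsClosure (form a b z π) := by
  intro v w f g hv hw
  have h : f ∈ formDomain a b z π ∧ g ∈ formDomain a b z π :=
    ⟨⟨_, (hb.approximates_iff hz hπ v f).2 hv⟩, ⟨_, (hb.approximates_iff hz hπ w g).2 hw⟩⟩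
  have hv' := hb.approx_of_approximates hz hπ h.1.choose_spec
  have hw' := hb.approx_of_approximates hz hπ h.2.choose_spec
  have hlim := tendsto_nhds_limUnder (cauchySeq_tendsto_of_complete (hv'.cauchySeq hw'))
  have hsum := (hv.tendsto_sub hv' hw hw').add hlim
  simp only [sub_add_cancel, zero_add] at hsum
  rw [form, dif_pos h]
  have heq : (fun n => preForm a b z π (h.1.choose n) (h.2.choose n)) = fun n =>
      (hb.symmForm hz hπ a).q ⟨h.1.choose n, h.1.choose_spec.1.1 n⟩
        ⟨h.2.choose n, h.2.choose_spec.1.1 n⟩ :=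
    funext fun n => (hb.bilin_apply hz hπ ⟨h.1.choose n, h.1.choose_spec.1.1 n⟩
      ⟨h.2.choose n, h.2.choose_spec.1.1 n⟩).symm
  rw [heq]
  exact hsum

lemma IsPairRate.isClosableForm (hb : IsPairRate b) (hz : 0 < z) (hπ : IsPoissonMeasure z π) :
    IsClosableForm a b z π := by
  intro F hF h0
  have h1 : Approximates a b z π F 0 := by
    refine ⟨hF, h0.congr fun n => eLpNorm_congr_ae ?_⟩
    filter_upwards [Lp.coeFn_zero ℝ 2 π] with γ hγ
    rw [Pi.sub_apply, hγ, Pi.zero_apply, sub_zero]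
  have h2 := hb.approx_of_approximates hz hπ h1
  exact (h2.1.tendsto_zero h2.2).congr fun n =>
    hb.bilin_apply hz hπ ⟨F n, hF.1 n⟩ ⟨F n, hF.1 n⟩

lemma IsPairRate.generatorGraph_eq (hb : IsPairRate b) (hz : 0 < z) (hπ : IsPoissonMeasure z π) :
    GeneratorGraph a b z π = (hb.symmForm hz hπ a).Graph (form a b z π) := by
  funext f h
  simp only [GeneratorGraph, SymmForm.Graph, hb.formDomain_eq hz hπ]

omit [NullSingletonClass (volume : Measure (Point d))] in
lemma IsPoissonMeasure.coeFn_toLp_expVec_zero (hπ : IsPoissonMeasure z π) :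
    hπ.toLp (expVec 0) =ᵐ[π] fun _ => 1 := by
  filter_upwards [hπ.coeFn_toLp (expVec 0)] with γ h
  exact h.trans (expPairing_zero γ)

omit [NullSingletonClass (volume : Measure (Point d))] in
-- The variance, with the mean written as the inner product with the constant 1 = e_0, links the
-- abstract gap to the Poincaré inequality.
lemma IsPoissonMeasure.integral_sub_integral_sq (hπ : IsPoissonMeasure z π) (f : Lp ℝ 2 π) :
    ∫ γ, (f γ - ∫ γ', f γ' ∂π) ^ 2 ∂π =
      ‖f‖ ^ 2 - inner ℝ (hπ.toLp (expVec 0)) f ^ 2 := by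
  have := hπ.isProbabilityMeasure
  have h1 : inner ℝ (hπ.toLp (expVec 0)) f = ∫ γ, f γ ∂π := by
    rw [L2.inner_def]
    refine integral_congr_ae ?_
    filter_upwards [hπ.coeFn_toLp_expVec_zero] with γ h
    rw [h]
    simp
  have h2 : ‖f‖ ^ 2 = ∫ γ, f γ ^ 2 ∂π := by
    rw [← real_inner_self_eq_norm_sq, L2.inner_def]
    refine integral_congr_ae (ae_of_all _ fun γ => ?_)
    simp [sq]
  have hf := Lp.memLp f
  rw [h1, h2]
  have h3 := variance_eq_sub hf
  rw [variance_eq_integral hf.aestronglyMeasurable.aemeasurable] at h3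
  exact h3

omit [NullSingletonClass (volume : Measure (Point d))] in
lemma IsPoissonMeasure.exists_eq_smul_iff (hπ : IsPoissonMeasure z π) (f : Lp ℝ 2 π) :
    (∃ t : ℝ, f = t • hπ.toLp (expVec 0)) ↔ ∃ c : ℝ, f =ᵐ[π] fun _ => c := by
  refine exists_congr fun t => ?_
  have h : ⇑(t • hπ.toLp (expVec 0)) =ᵐ[π] fun _ => t := by
    filter_upwards [Lp.coeFn_smul t (hπ.toLp (expVec 0)), hπ.coeFn_toLp_expVec_zero] with γ h1 h2
    rw [h1, Pi.smul_apply, h2, smul_eq_mul, mul_one]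
  rw [Lp.ext_iff]
  exact ⟨fun h' => h'.trans h, fun h' => h'.trans h.symm⟩

end Closure

end BirthDeath

theorem corollary5p5 (d : ℕ) (hd : 1 ≤ d) (z : ℝ) (hz : 0 < z)
    (a b : EuclideanSpace ℝ (Fin d) → ℝ≥0∞)
    (ha : Measurable a) (hb : Measurable b)
    (ha_even : ∀ x, a (-x) = a x) (hb_even : ∀ x, b (-x) = b x)
    (ha_int : ∫⁻ x, a x < ∞) (hb_int : ∫⁻ x, b x < ∞)
    (hb_bdd : essSup b volume < ∞)
    (π : Measure (Config d)) (hπ : IsPoissonMeasure z π) :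
    -- the quadratic form on the span of the exponentials is well defined, symmetric and closable
    (∀ F ∈ expSpan d, MemLp F 2 π ∧ MemLp (genL a b z F) 2 π) ∧
    (∀ F ∈ expSpan d, ∀ G ∈ expSpan d, preForm a b z π F G = preForm a b z π G F) ∧
    IsClosableForm a b z π ∧
    (∀ (F G : ℕ → Config d → ℝ) (f g : Lp ℝ 2 π),
      Approximates a b z π F f → Approximates a b z π G g →
      Tendsto (fun n => preForm a b z π (F n) (G n)) atTop (𝓝 (form a b z π f g))) ∧
    -- the Poincaré inequality
    (∀ f ∈ formDomain a b z π,
      mean a ^ 2 * z * mean b * ∫ γ, (f γ - ∫ γ', f γ' ∂π) ^ 2 ∂π ≤ form a b z π f f) ∧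
    -- the spectral gap
    (∀ r : ℝ, 0 < r → r < mean a ^ 2 * z * mean b →
      InResolventSet (GeneratorGraph a b z π) r) ∧
    -- the kernel of the generator
    (0 < mean a → 0 < mean b → ∀ f : Lp ℝ 2 π,
      GeneratorGraph a b z π f 0 ↔ ∃ c : ℝ, f =ᵐ[π] fun _ => c) := by
  -- For d ≥ 1 Lebesgue measure has no atoms, so that added points are almost everywhere new.
  have : Nonempty (Fin d) := ⟨⟨0, hd⟩⟩
  have : NullSingletonClass (volume : Measure (Point d)) := inferInstance
  have hb' : IsPairRate b := ⟨hb, hb_even, hb_int, hb_bdd⟩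
  have hE := hb'.isClosure_form (a := a) hz hπ
  have hG := hb'.symmForm_hasGap (a := a) hz hπ
  refine ⟨fun F hF => ⟨hπ.memLp_of_mem_expSpan hF, hb'.memLp_genL hz hπ hF⟩, fun F hF G hG => ?_,
    hb'.isClosableForm hz hπ, fun F G f g hF hG => ?_, fun f hf => ?_, fun r hr hrc => ?_,
    fun ha0 hb0 f => ?_⟩
  · have h := hb'.bilin_comm (a := a) hz hπ ⟨F, hF⟩ ⟨G, hG⟩
    rwa [hb'.bilin_apply, hb'.bilin_apply] at h
  · exact (hE _ _ _ _ (hb'.approx_of_approximates hz hπ hF)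
      (hb'.approx_of_approximates hz hπ hG)).congr fun n =>
        hb'.bilin_apply hz hπ ⟨F n, hF.1.1 n⟩ ⟨G n, hG.1.1 n⟩
  · rw [hb'.formDomain_eq hz hπ] at hf
    rw [hπ.integral_sub_integral_sq]
    exact hG.poincare hE hf
  · rw [hb'.generatorGraph_eq hz hπ]
    exact hG.inResolventSet hE hr hrc
  · rw [hb'.generatorGraph_eq hz hπ, ← hπ.exists_eq_smul_iff]
    exact hG.graph_zero_iff hE (by positivity) f
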